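/- **Setting.** Let $(\mathcal V,\otimes,I)$ be a symmetric monoidal closed category, with internal hom $[-,-]$. Modules and comodules are left ones. - The global category of comodules $\mathbf{Comod}$ has as objects pairs $X_C$ of a comonoid $C$ in $\mathcal V$ and a $C$-comodule $X$, with coaction $\delta:X\to C\otimes X$. A morphism $X_C\to Y_D$ is a comonoid morphism $g:C\to D$ together with a morphism $k:X\to Y$ such that $(g\otimes k)\delta_X=\delta_Y k$. It is a symmetric monoidal category with $X_C\otimes Y_D=(X\otimes Y)_{C\otimes D}$. - The global category of modules $\mathbf{Mod}$ has as objects pairs $M_A$ of a monoid $A$ in $\mathcal V$ and an $A$-module $M$, with action $\mu:A\otimes M\to M$. A morphism $M_A\to N_B$ is a monoid morphism $f:A\to B$ together with a morphism $p:M\to N$ such that $p\,\mu_M=\mu_N(f\otimes p)$. - For a comonoid $C$ and a monoid $B$, $[C,B]$ is the convolution monoid. For $X_C\in\mathbf{Comod}$ and $N_B\in\mathbf{Mod}$, $[X,N]$ is a $[C,B]$-module by convolution, that is, by $[C,B]\otimes[X,N]\to[C\otimes X,B\otimes N]\xrightarrow{[\delta,\mu]}[X,N]$. This gives functors $\mathbf{Comon}(\mathcal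 V)^{\mathrm{op}}\times\mathbf{Mon}(\mathcal V)\to\mathbf{Mon}(\mathcal V)$ and $\mathrm{Hom}:\mathbf{Comod}^{\mathrm{op}}\times\mathbf{Mod}\to\mathbf{Mod}$, $\mathrm{Hom}(X_C,N_B)=[X,N]_{[C,B]}$. - A universal measuring comonoid $P(A,B)$ is a comonoid with bijections $\mathbf{Comon}(\mathcal V)(C,P(A,B))\cong\mathbf{Mon}(\mathcal V)(A,[C,B])$ natural in $C$. A universal measuring comodule $Q(M,N)$ is an object of $\mathbf{Comod}$ with bijections $\mathbf{Comod}(X_C,Q(M,N))\cong\mathbf{Mod}(M_A,[X,N]_{[C,B]})$ natural in $X_C$. **Theorem.** Suppose that $\mathcal V$ is moreover locally presentable. Then $\mathbf{Comod}$ is a (symmetric) monoidal closed category; universal measuring comonoids $P(A,B)$ exist for all monoids $A,B$; and universal measuring comodules $Q(M,N)$ exist for all $M_A,N_B\in\mathbf{Mod}$. They can be chosen so that $Q(M,N)$ is a comodule over $P(A,B)$ and the bijection for $Q(M,N)$ lies over the bijection for $P(A,B)$. Furthermore: 1. $\mathbf{Mod}^{\mathrm{op}}$ is a tensored and cotensored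 $\mathbf{Comod}$-enriched category, with hom-objects $\underline{\mathbf{Mod}^{\mathrm{op}}}(M_A,N_B)=Q(N,M)_{P(B,A)}$. 2. $\mathbf{Mod}$ is a tensored and cotensored $\mathbf{Comod}$-enriched category, with hom-objects $\underline{\mathbf{Mod}}(M_A,N_B)=Q(M,N)_{P(A,B)}$. The cotensor of $N_B$ by $X_C$ is $[X,N]_{[C,B]}$. The tensors are given by a functor $\overline{\triangleright}:\mathbf{Comod}\times\mathbf{Mod}\to\mathbf{Mod}$ such that $X_C\,\overline{\triangleright}\,-$ is left adjoint to $\mathrm{Hom}(X_C,-)$, naturally in $X_C$. In (2) the underlying ordinary category is $\mathbf{Mod}$, and the bijections for $Q(M,N)$ are also natural in $M$ and $N$ with respect to the morphisms $\underline{\mathbf{Mod}}(M,N)\to\underline{\mathbf{Mod}}(M',N')$ given by the enrichment. The enrichment in (1) is the opposite of the one in (2); the tensors in (1) are the cotensors in (2), and the cotensors in (1) are the tensors in (2). The unit $X\to Q(M,X\,\overline{\triangleright}\,M)$ of the tensors and the counit $X\to Q([X,N],N)$ of the cotensors in (2) correspond, under the universal property of $Q$, to the unit $M\to[X,X\,\overline{\triangleright}\,M]$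 of the adjunction and to the identity of $[X,N]$. -/

import Mathlib

universe v u

open CategoryTheory MonoidalCategory Opposite
open scoped MonObj ComonObj

namespace MeasuringComodule

section Comodules

variable {V : Type u} [Category.{v} V] [MonoidalCategory V]

/-- The structure of a left `C`-comodule on an object `X`: a coassociative and counital coaction
`X ⟶ C ⊗ X`. -/
class ComodObj (C : V) [ComonObj C] (X : V) where
  /-- The coaction. -/
  coact : X ⟶ C ⊗ X
  counit_coact : coact ≫ ε[C] ▷ X = (λ_ X).inv
  comul_coact : coact ≫ Δ[C] ▷ X = coact ≫ C ◁ coact ≫ (α_ C C X).inv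

/-- The coaction of `C` on a left `C`-comodule `X`. -/
abbrev coaction (C X : V) [ComonObj C] [ComodObj C X] : X ⟶ C ⊗ X := ComodObj.coact

/-- Left comodules over the comonoid `C`. -/
structure Comodule (C : Comon V) where
  /-- The underlying object. -/
  X : V
  [comod : ComodObj C.X X]

attribute [instance] Comodule.comod

variable (V) in
/-- Objects of the global category of comodules: a comonoid together with a comodule over it. -/
structure GlobalComod where
  /-- The comonoid. -/
  base : Comon V
  /-- The comodule. -/
  fib : Comodule base

variable (V) in
/-- Objects of the global category of modules: a monoid together with a (left) module over it. -/
structure GlobalMod where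
  /-- The monoid. -/
  base : Mon V
  /-- The module. -/
  fib : Mod V base.X

namespace GlobalComod

/-- The underlying object of a comodule. -/
abbrev X (Y : GlobalComod V) : V := Y.fib.X

/-- The coaction `X ⟶ C ⊗ X` of a comodule. -/
abbrev coact (Y : GlobalComod V) : Y.X ⟶ Y.base.X ⊗ Y.X := ComodObj.coact

/-- A morphism `X_C ⟶ Y_D` in the global category of comodules: a comonoid morphism `g : C ⟶ D`
and a morphism `k : X ⟶ Y` compatible with the coactions. -/
@[ext]
structure Hom (X Y : GlobalComod V) where
  /-- The comonoid morphism. -/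
  base : X.base ⟶ Y.base
  /-- The morphism between the underlying objects. -/
  hom : X.X ⟶ Y.X
  coact_hom : X.coact ≫ base.hom ▷ X.X ≫ Y.base.X ◁ hom = hom ≫ Y.coact

instance : Category (GlobalComod V) where
  Hom := Hom
  id X := { base := 𝟙 _, hom := 𝟙 _, coact_hom := by simp }
  comp {X Y Z} f g :=
    { base := f.base ≫ g.base
      hom := f.hom ≫ g.hom
      coact_hom := by
        have hf := f.coact_hom
        have hg := g.coact_hom
        simp only [Comon.comp_hom', comp_whiskerRight, MonoidalCategory.whiskerLeft_comp,
          Category.assoc]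
        rw [← hg, ← reassoc_of% hf]
        rw [← whisker_exchange_assoc] }

@[ext]
lemma hom_ext {X Y : GlobalComod V} {f g : X ⟶ Y} (h₁ : f.base = g.base) (h₂ : f.hom = g.hom) :
    f = g := Hom.ext h₁ h₂

@[simp] lemma id_base (X : GlobalComod V) : Hom.base (𝟙 X) = 𝟙 X.base := rfl
@[simp] lemma id_hom (X : GlobalComod V) : Hom.hom (𝟙 X) = 𝟙 X.X := rfl
@[simp] lemma comp_base {X Y Z : GlobalComod V} (f : X ⟶ Y) (g : Y ⟶ Z) :
    (f ≫ g).base = f.base ≫ g.base := rfl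
@[simp] lemma comp_hom {X Y Z : GlobalComod V} (f : X ⟶ Y) (g : Y ⟶ Z) :
    (f ≫ g).hom = f.hom ≫ g.hom := rfl

/-- Compatibility with the coactions, in terms of the tensor product of morphisms. -/
lemma coact_tensorHom {X Y : GlobalComod V} (f : X ⟶ Y) :
    X.coact ≫ (f.base.hom ⊗ₘ f.hom) = f.hom ≫ Y.coact := by
  rw [MonoidalCategory.tensorHom_def]; exact f.coact_hom

/-- An isomorphism in the global category of comodules from isomorphisms of comonoids and of
underlying objects that are compatible with the coactions. -/
def mkIso {X Y : GlobalComod V} (e : X.base ≅ Y.base) (i : X.X ≅ Y.X)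
    (h : X.coact ≫ (e.hom.hom ⊗ₘ i.hom) = i.hom ≫ Y.coact) : X ≅ Y where
  hom := { base := e.hom, hom := i.hom, coact_hom := by rw [← h, MonoidalCategory.tensorHom_def] }
  inv :=
    { base := e.inv
      hom := i.inv
      coact_hom := by
        have h₁ : e.hom.hom ≫ e.inv.hom = 𝟙 _ := by
          rw [← Comon.comp_hom', e.hom_inv_id]; rfl
        rw [← MonoidalCategory.tensorHom_def, ← cancel_epi i.hom, ← reassoc_of% h, tensorHom_comp_tensorHom, h₁]
        simp }
  hom_inv_id := by ext1 <;> simp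
  inv_hom_id := by ext1 <;> simp

@[simp] lemma mkIso_hom_base {X Y : GlobalComod V} (e : X.base ≅ Y.base) (i : X.X ≅ Y.X) (h) :
    (mkIso e i h).hom.base = e.hom := rfl
@[simp] lemma mkIso_hom_hom {X Y : GlobalComod V} (e : X.base ≅ Y.base) (i : X.X ≅ Y.X) (h) :
    (mkIso e i h).hom.hom = i.hom := rfl
@[simp] lemma mkIso_inv_base {X Y : GlobalComod V} (e : X.base ≅ Y.base) (i : X.X ≅ Y.X) (h) :
    (mkIso e i h).inv.base = e.inv := rfl
@[simp] lemma mkIso_inv_hom {X Y : GlobalComod V} (e : X.base ≅ Y.base) (i : X.X ≅ Y.X) (h) :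
    (mkIso e i h).inv.hom = i.inv := rfl

end GlobalComod

namespace GlobalMod

/-- The underlying object of a module. -/
abbrev X (M : GlobalMod V) : V := M.fib.X

/-- The action `A ⊗ M ⟶ M` of a module. -/
abbrev act (M : GlobalMod V) : M.base.X ⊗ M.X ⟶ M.X := γ[M.base.X, M.X]

/-- A morphism `M_A ⟶ N_B` in the global category of modules: a monoid morphism `f : A ⟶ B`
and a morphism `p : M ⟶ N` compatible with the actions. -/
@[ext]
structure Hom (M N : GlobalMod V) where
  /-- The monoid morphism. -/
  base : M.base ⟶ N.base
  /-- The morphism between the underlying objects. -/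
  hom : M.X ⟶ N.X
  act_hom : M.act ≫ hom = M.base.X ◁ hom ≫ base.hom ▷ N.X ≫ N.act

instance : Category (GlobalMod V) where
  Hom := Hom
  id M := { base := 𝟙 _, hom := 𝟙 _, act_hom := by simp }
  comp {M N L} f g :=
    { base := f.base ≫ g.base
      hom := f.hom ≫ g.hom
      act_hom := by
        have hf := f.act_hom
        have hg := g.act_hom
        simp only [Mon.comp_hom', comp_whiskerRight, MonoidalCategory.whiskerLeft_comp,
          Category.assoc]
        rw [reassoc_of% hf, hg]; simp only [whisker_exchange_assoc] }

@[ext]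
lemma hom_ext {M N : GlobalMod V} {f g : M ⟶ N} (h₁ : f.base = g.base) (h₂ : f.hom = g.hom) :
    f = g := Hom.ext h₁ h₂

@[simp] lemma id_base (M : GlobalMod V) : Hom.base (𝟙 M) = 𝟙 M.base := rfl
@[simp] lemma id_hom (M : GlobalMod V) : Hom.hom (𝟙 M) = 𝟙 M.X := rfl
@[simp] lemma comp_base {M N L : GlobalMod V} (f : M ⟶ N) (g : N ⟶ L) :
    (f ≫ g).base = f.base ≫ g.base := rfl
@[simp] lemma comp_hom {M N L : GlobalMod V} (f : M ⟶ N) (g : N ⟶ L) :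
    (f ≫ g).hom = f.hom ≫ g.hom := rfl

/-- Compatibility with the actions, in terms of the tensor product of morphisms. -/
lemma act_tensorHom {M N : GlobalMod V} (f : M ⟶ N) :
    M.act ≫ f.hom = (f.base.hom ⊗ₘ f.hom) ≫ N.act := by
  rw [tensorHom_def', Category.assoc]; exact f.act_hom

end GlobalMod

end Comodules

section Monoidal

variable {V : Type u} [Category.{v} V] [MonoidalCategory V] [SymmetricCategory V]

/-- The middle-four interchange is compatible with the symmetry. -/
lemma tensorμ_braiding (C X D Y : V) :
    tensorμ C X D Y ≫ ((β_ C D).hom ⊗ₘ (β_ X Y).hom) =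
      (β_ (C ⊗ X) (D ⊗ Y)).hom ≫ tensorμ D Y C X := by
  simp only [tensorμ, BraidedCategory.braiding_tensor_right_hom,
    BraidedCategory.braiding_tensor_left_hom, MonoidalCategory.tensorHom_def]
  calc
    _ = 𝟙 _ ⊗≫ C ◁ (β_ X D).hom ▷ Y ⊗≫ ((β_ C D).hom ▷ (X ⊗ Y) ≫ (D ⊗ C) ◁ (β_ X Y).hom) ⊗≫
        D ◁ ((β_ C Y).hom ≫ (β_ Y C).hom) ▷ X ⊗≫ 𝟙 _ := by
      rw [SymmetricCategory.symmetry]; monoidal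
    _ = _ := by monoidal

lemma comon_associator (C D E : Comon V) : (α_ C D E).hom.hom = (α_ C.X D.X E.X).hom := by
  have h : 𝟙 (C.X ⊗ D.X) ▷ E.X ≫ (α_ C.X D.X E.X).hom ≫ C.X ◁ 𝟙 (D.X ⊗ E.X) =
    (α_ C.X D.X E.X).hom := by simp
  simp
  exact h

lemma comon_leftUnitor (C : Comon V) : (λ_ C).hom.hom = (λ_ C.X).hom := by
  have h : 𝟙 (𝟙_ V) ▷ C.X ≫ (λ_ C.X).hom = (λ_ C.X).hom := by simp
  simp
  exact h

lemma comon_rightUnitor (C : Comon V) : (ρ_ C).hom.hom = (ρ_ C.X).hom := by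
  have h : C.X ◁ 𝟙 (𝟙_ V) ≫ (ρ_ C.X).hom = (ρ_ C.X).hom := by simp
  simp
  exact h

lemma braiding_counit (C D : V) [ComonObj C] [ComonObj D] :
    (β_ C D).hom ≫ ε[D ⊗ C] = ε[C ⊗ D] := by
  rw [Comon.tensorObj_counit, Comon.tensorObj_counit,
    ← BraidedCategory.braiding_naturality_assoc]
  simp [← unitors_equal]

lemma braiding_comul (C D : V) [ComonObj C] [ComonObj D] :
    (β_ C D).hom ≫ Δ[D ⊗ C] = Δ[C ⊗ D] ≫ ((β_ C D).hom ⊗ₘ (β_ C D).hom) := by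
  rw [Comon.tensorObj_comul, Comon.tensorObj_comul, Category.assoc, tensorμ_braiding,
    ← BraidedCategory.braiding_naturality_assoc]

instance : BraidedCategory (Comon V) :=
  BraidedCategory.ofFaithful (Comon.forget V)
    (fun C D => Comon.mkIso (M := C ⊗ D) (N := D ⊗ C) (β_ C.X D.X)
      (braiding_counit C.X D.X) (braiding_comul C.X D.X))
    (fun C D => (Category.id_comp _).trans (Category.comp_id (β_ C.X D.X).hom).symm)

instance : SymmetricCategory (Comon V) where
  symmetry C D := by ext; exact SymmetricCategory.symmetry C.X D.X

/-- The tensor product of a `C`-comodule and a `D`-comodule is a `C ⊗ D`-comodule. -/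
instance tensorComodObj (C D X Y : V) [ComonObj C] [ComonObj D] [ComodObj C X] [ComodObj D Y] :
    ComodObj (C ⊗ D) (X ⊗ Y) where
  coact := (coaction C X ⊗ₘ coaction D Y) ≫ tensorμ C X D Y
  counit_coact := by
    have h := leftUnitor_monoidal X Y
    rw [Comon.tensorObj_counit, comp_whiskerRight, Category.assoc,
      ← tensorHom_id, ← id_tensorHom_id, ← tensorμ_natural_assoc]
    have hX : coaction C X ≫ ε[C] ▷ X ≫ (λ_ X).hom = 𝟙 X := by
      rw [← Category.assoc, ComodObj.counit_coact, Iso.inv_hom_id]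
    have hY : coaction D Y ≫ ε[D] ▷ Y ≫ (λ_ Y).hom = 𝟙 Y := by
      rw [← Category.assoc, ComodObj.counit_coact, Iso.inv_hom_id]
    rw [← cancel_mono (λ_ (X ⊗ Y)).hom, Category.assoc, Category.assoc, Category.assoc, ← h,
      tensorHom_id, tensorHom_id, tensorHom_comp_tensorHom, tensorHom_comp_tensorHom, hX, hY]
    simp
  comul_coact := by
    have h := associator_monoidal C C X D D Y
    rw [← cancel_mono (α_ _ _ _).hom, Comon.tensorObj_comul, comp_whiskerRight]
    simp only [Category.assoc, Iso.inv_hom_id, Category.comp_id]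
    rw [← tensorHom_id, ← id_tensorHom_id, ← tensorμ_natural_assoc, h, tensorHom_id, tensorHom_id,
      tensorHom_comp_tensorHom_assoc, ComodObj.comul_coact, ComodObj.comul_coact,
      tensorHom_comp_tensorHom_assoc]
    simp only [Category.assoc, Iso.inv_hom_id, Category.comp_id, MonoidalCategory.whiskerLeft_comp]
    rw [← tensorHom_comp_tensorHom_assoc, ← id_tensorHom, ← id_tensorHom, tensorμ_natural_assoc]
    simp

/-- The unit object as a comodule over the unit comonoid. -/
instance unitComodObj : ComodObj (𝟙_ (Comon V)).X (𝟙_ V) where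
  coact := (λ_ (𝟙_ V)).inv
  counit_coact := by
    change (λ_ (𝟙_ V)).inv ≫ (𝟙 (𝟙_ V)) ▷ (𝟙_ V) = (λ_ (𝟙_ V)).inv
    simp
  comul_coact := by
    change (λ_ (𝟙_ V)).inv ≫ (λ_ (𝟙_ V)).inv ▷ (𝟙_ V) =
      (λ_ (𝟙_ V)).inv ≫ (𝟙_ V) ◁ (λ_ (𝟙_ V)).inv ≫ (α_ (𝟙_ V) (𝟙_ V) (𝟙_ V)).inv
    monoidal

namespace GlobalComod

/-- The tensor product of objects in the global category of comodules. -/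
abbrev tensorObj (X Y : GlobalComod V) : GlobalComod V where
  base := X.base ⊗ Y.base
  fib :=
    { X := X.X ⊗ Y.X
      comod := tensorComodObj X.base.X Y.base.X X.X Y.X }

lemma coact_tensorObj (X Y : GlobalComod V) :
    (tensorObj X Y).coact = (X.coact ⊗ₘ Y.coact) ≫ tensorμ X.base.X X.X Y.base.X Y.X := rfl

lemma tensorHom_aux {X X' Y Y' : GlobalComod V} (f : X ⟶ X') (g : Y ⟶ Y') :
    ((X.coact ⊗ₘ Y.coact) ≫ tensorμ X.base.X X.X Y.base.X Y.X) ≫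
        ((f.base.hom ⊗ₘ g.base.hom) ⊗ₘ (f.hom ⊗ₘ g.hom)) =
      (f.hom ⊗ₘ g.hom) ≫ (X'.coact ⊗ₘ Y'.coact) ≫ tensorμ X'.base.X X'.X Y'.base.X Y'.X := by
  rw [Category.assoc, ← tensorμ_natural, tensorHom_comp_tensorHom_assoc,
    tensorHom_comp_tensorHom_assoc, coact_tensorHom, coact_tensorHom]

/-- The tensor product of morphisms in the global category of comodules. -/
abbrev tensorHom {X X' Y Y' : GlobalComod V} (f : X ⟶ X') (g : Y ⟶ Y') :
    tensorObj X Y ⟶ tensorObj X' Y' where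
  base := f.base ⊗ₘ g.base
  hom := f.hom ⊗ₘ g.hom
  coact_hom := by
    rw [← MonoidalCategory.tensorHom_def]
    exact tensorHom_aux f g

lemma associator_aux (X Y Z : GlobalComod V) :
    (((X.coact ⊗ₘ Y.coact) ≫ tensorμ X.base.X X.X Y.base.X Y.X ⊗ₘ Z.coact) ≫
        tensorμ (X.base.X ⊗ Y.base.X) (X.X ⊗ Y.X) Z.base.X Z.X) ≫
          ((α_ X.base.X Y.base.X Z.base.X).hom ⊗ₘ (α_ X.X Y.X Z.X).hom) =
      (α_ X.X Y.X Z.X).hom ≫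
        (X.coact ⊗ₘ (Y.coact ⊗ₘ Z.coact) ≫ tensorμ Y.base.X Y.X Z.base.X Z.X) ≫
          tensorμ X.base.X X.X (Y.base.X ⊗ Z.base.X) (Y.X ⊗ Z.X) := by
  have h := tensor_associativity X.base.X X.X Y.base.X Y.X Z.base.X Z.X
  have h₁ : ((X.coact ⊗ₘ Y.coact) ≫ tensorμ X.base.X X.X Y.base.X Y.X ⊗ₘ Z.coact) =
      ((X.coact ⊗ₘ Y.coact) ⊗ₘ Z.coact) ≫ (tensorμ X.base.X X.X Y.base.X Y.X ▷ _) := by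
    rw [← tensorHom_id, tensorHom_comp_tensorHom, Category.comp_id]
  have h₂ : (X.coact ⊗ₘ (Y.coact ⊗ₘ Z.coact) ≫ tensorμ Y.base.X Y.X Z.base.X Z.X) =
      (X.coact ⊗ₘ (Y.coact ⊗ₘ Z.coact)) ≫ (_ ◁ tensorμ Y.base.X Y.X Z.base.X Z.X) := by
    rw [← id_tensorHom, tensorHom_comp_tensorHom, Category.comp_id]
  rw [h₁, h₂]
  simp only [Category.assoc]
  rw [h, associator_naturality_assoc]

lemma leftUnitor_aux (X : GlobalComod V) :
    (((λ_ (𝟙_ V)).inv ⊗ₘ X.coact) ≫ tensorμ (𝟙_ V) (𝟙_ V) X.base.X X.X) ≫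
        ((λ_ X.base.X).hom ⊗ₘ (λ_ X.X).hom) = (λ_ X.X).hom ≫ X.coact := by
  have h := tensor_left_unitality X.base.X X.X
  have h₁ : ((λ_ (𝟙_ V)).inv ⊗ₘ X.coact) = _ ◁ X.coact ≫ (λ_ (𝟙_ V)).inv ▷ _ := by
    rw [← tensorHom_def']
  rw [h₁]
  simp only [Category.assoc]
  rw [← h, leftUnitor_naturality]

lemma rightUnitor_aux (X : GlobalComod V) :
    ((X.coact ⊗ₘ (λ_ (𝟙_ V)).inv) ≫ tensorμ X.base.X X.X (𝟙_ V) (𝟙_ V)) ≫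
        ((ρ_ X.base.X).hom ⊗ₘ (ρ_ X.X).hom) = (ρ_ X.X).hom ≫ X.coact := by
  have h := tensor_right_unitality X.base.X X.X
  have h₁ : (X.coact ⊗ₘ (λ_ (𝟙_ V)).inv) = X.coact ▷ _ ≫ _ ◁ (λ_ (𝟙_ V)).inv := by
    rw [← MonoidalCategory.tensorHom_def]
  rw [h₁]
  simp only [Category.assoc]
  rw [← h, rightUnitor_naturality]

lemma braiding_aux (X Y : GlobalComod V) :
    ((X.coact ⊗ₘ Y.coact) ≫ tensorμ X.base.X X.X Y.base.X Y.X) ≫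
        ((β_ X.base.X Y.base.X).hom ⊗ₘ (β_ X.X Y.X).hom) =
      (β_ X.X Y.X).hom ≫ (Y.coact ⊗ₘ X.coact) ≫ tensorμ Y.base.X Y.X X.base.X X.X := by
  rw [Category.assoc, tensorμ_braiding, ← BraidedCategory.braiding_naturality_assoc]

instance : MonoidalCategoryStruct (GlobalComod V) where
  tensorObj := tensorObj
  whiskerLeft X _ _ f :=
    { base := X.base ◁ f.base
      hom := X.X ◁ f.hom
      coact_hom := by
        rw [← MonoidalCategory.tensorHom_def]
        have := tensorHom_aux (𝟙 X) f
        simp only [id_hom, id_base, Comon.id_hom', id_tensorHom] at this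
        exact this }
  whiskerRight f Y :=
    { base := f.base ▷ Y.base
      hom := f.hom ▷ Y.X
      coact_hom := by
        rw [← MonoidalCategory.tensorHom_def]
        have := tensorHom_aux f (𝟙 Y)
        simp only [id_hom, id_base, Comon.id_hom', tensorHom_id] at this
        exact this }
  tensorHom := tensorHom
  tensorUnit := { base := 𝟙_ (Comon V), fib := { X := 𝟙_ V } }
  associator X Y Z := mkIso (α_ X.base Y.base Z.base) (α_ X.X Y.X Z.X)
    (by rw [comon_associator]; exact associator_aux X Y Z)
  leftUnitor X := mkIso (λ_ X.base) (λ_ X.X)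
    (by rw [comon_leftUnitor]; exact leftUnitor_aux X)
  rightUnitor X := mkIso (ρ_ X.base) (ρ_ X.X)
    (by rw [comon_rightUnitor]; exact rightUnitor_aux X)

instance : MonoidalCategory (GlobalComod V) where
  tensorHom_def _ _ :=
    hom_ext (MonoidalCategory.tensorHom_def _ _) (MonoidalCategory.tensorHom_def _ _)
  id_tensorHom_id _ _ := hom_ext (id_tensorHom_id _ _) (id_tensorHom_id _ _)
  tensorHom_comp_tensorHom _ _ _ _ :=
    hom_ext (tensorHom_comp_tensorHom _ _ _ _) (tensorHom_comp_tensorHom _ _ _ _)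
  whiskerLeft_id _ _ := hom_ext (whiskerLeft_id _ _) (whiskerLeft_id _ _)
  id_whiskerRight _ _ := hom_ext (id_whiskerRight _ _) (id_whiskerRight _ _)
  associator_naturality _ _ _ :=
    hom_ext (associator_naturality _ _ _) (associator_naturality _ _ _)
  leftUnitor_naturality _ := hom_ext (leftUnitor_naturality _) (leftUnitor_naturality _)
  rightUnitor_naturality _ := hom_ext (rightUnitor_naturality _) (rightUnitor_naturality _)
  pentagon _ _ _ _ := hom_ext (pentagon _ _ _ _) (pentagon _ _ _ _)
  triangle _ _ := hom_ext (triangle _ _) (triangle _ _)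

instance : BraidedCategory (GlobalComod V) where
  braiding X Y := mkIso (β_ X.base Y.base) (β_ X.X Y.X) (braiding_aux X Y)
  braiding_naturality_left f Z :=
    hom_ext (BraidedCategory.braiding_naturality_left f.base Z.base)
      (BraidedCategory.braiding_naturality_left f.hom Z.X)
  braiding_naturality_right X _ _ f :=
    hom_ext (BraidedCategory.braiding_naturality_right X.base f.base)
      (BraidedCategory.braiding_naturality_right X.X f.hom)
  hexagon_forward X Y Z :=
    hom_ext (BraidedCategory.hexagon_forward X.base Y.base Z.base)
      (BraidedCategory.hexagon_forward X.X Y.X Z.X)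
  hexagon_reverse X Y Z :=
    hom_ext (BraidedCategory.hexagon_reverse X.base Y.base Z.base)
      (BraidedCategory.hexagon_reverse X.X Y.X Z.X)

instance : SymmetricCategory (GlobalComod V) where
  symmetry X Y :=
    hom_ext (SymmetricCategory.symmetry X.base Y.base) (SymmetricCategory.symmetry X.X Y.X)

end GlobalComod

end Monoidal

section ConvolutionAux

variable {V : Type u} [Category.{v} V] [MonoidalCategory V] [SymmetricCategory V]

lemma convolution_assoc_aux {C X B N P P' Q : V} (Δ' : C ⟶ C ⊗ C) (d : X ⟶ C ⊗ X)
    (m : B ⊗ B ⟶ B) (a : B ⊗ N ⟶ N) (p : C ⊗ P ⟶ B) (p' : C ⊗ P' ⟶ B) (q : X ⊗ Q ⟶ N)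
    (hd : d ≫ Δ' ▷ X = d ≫ C ◁ d ≫ (α_ C C X).inv)
    (ha : m ▷ N ≫ a = (α_ B B N).hom ≫ B ◁ a ≫ a) :
    d ▷ ((P ⊗ P') ⊗ Q) ≫ tensorμ C X (P ⊗ P') Q ≫
        ((Δ' ▷ (P ⊗ P') ≫ tensorμ C C P P' ≫ (p ⊗ₘ p') ≫ m) ⊗ₘ q) ≫ a =
      X ◁ (α_ P P' Q).hom ≫ d ▷ (P ⊗ P' ⊗ Q) ≫ tensorμ C X P (P' ⊗ Q) ≫
        (p ⊗ₘ (d ▷ (P' ⊗ Q) ≫ tensorμ C X P' Q ≫ (p' ⊗ₘ q) ≫ a)) ≫ a := by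
  have h := associator_monoidal C C X P P' Q
  have hd' : d ≫ Δ' ▷ X ≫ (α_ C C X).hom = d ≫ C ◁ d := by
    rw [reassoc_of% hd]; simp
  have e₁ : ((Δ' ▷ (P ⊗ P') ≫ tensorμ C C P P' ≫ (p ⊗ₘ p') ≫ m) ⊗ₘ q) =
      (Δ' ▷ (P ⊗ P') ⊗ₘ X ◁ 𝟙 Q) ≫ tensorμ C C P P' ▷ (X ⊗ Q) ≫ ((p ⊗ₘ p') ⊗ₘ q) ≫ m ▷ N := by
    rw [← tensorHom_id (tensorμ C C P P'), ← tensorHom_id m, tensorHom_comp_tensorHom,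
      tensorHom_comp_tensorHom, tensorHom_comp_tensorHom]
    simp
  have e₂ : (p ⊗ₘ (d ▷ (P' ⊗ Q) ≫ tensorμ C X P' Q ≫ (p' ⊗ₘ q) ≫ a)) =
      (C ◁ 𝟙 P ⊗ₘ d ▷ (P' ⊗ Q)) ≫ (C ⊗ P) ◁ tensorμ C X P' Q ≫ (p ⊗ₘ p' ⊗ₘ q) ≫ B ◁ a := by
    rw [← id_tensorHom (C ⊗ P), ← id_tensorHom B, tensorHom_comp_tensorHom, tensorHom_comp_tensorHom,
      tensorHom_comp_tensorHom]
    simp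
  have n₁ : tensorμ C X (P ⊗ P') Q ≫ (Δ' ▷ (P ⊗ P') ⊗ₘ X ◁ 𝟙 Q) =
      (Δ' ▷ X) ▷ ((P ⊗ P') ⊗ Q) ≫ tensorμ (C ⊗ C) X (P ⊗ P') Q := by
    have := tensorμ_natural Δ' (𝟙 X) (𝟙 (P ⊗ P')) (𝟙 Q)
    simp only [tensorHom_id, id_whiskerRight] at this
    rw [this]; simp
  have n₂ : tensorμ C X P (P' ⊗ Q) ≫ (C ◁ 𝟙 P ⊗ₘ d ▷ (P' ⊗ Q)) =
      (C ◁ d) ▷ (P ⊗ P' ⊗ Q) ≫ tensorμ C (C ⊗ X) P (P' ⊗ Q) := by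
    have := tensorμ_natural (𝟙 C) d (𝟙 P) (𝟙 (P' ⊗ Q))
    simp only [id_tensorHom, tensorHom_id, id_whiskerRight] at this
    rw [this]; simp
  rw [e₁, e₂]
  simp only [Category.assoc]
  rw [reassoc_of% n₁, reassoc_of% n₂, ha, associator_naturality_assoc, reassoc_of% h,
    ← comp_whiskerRight_assoc, ← comp_whiskerRight_assoc, ← hd', whisker_exchange_assoc]
  simp only [comp_whiskerRight, Category.assoc, MonoidalCategory.tensorHom_def]

lemma convolution_one_aux {C X B N Q : V} (e : C ⟶ 𝟙_ V) (d : X ⟶ C ⊗ X) (i : 𝟙_ V ⟶ B)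
    (a : B ⊗ N ⟶ N) (q : X ⊗ Q ⟶ N) (hd : d ≫ e ▷ X = (λ_ X).inv)
    (ha : i ▷ N ≫ a = (λ_ N).hom) :
    d ▷ (𝟙_ V ⊗ Q) ≫ tensorμ C X (𝟙_ V) Q ≫ (((ρ_ C).hom ≫ e ≫ i) ⊗ₘ q) ≫ a =
      X ◁ (λ_ Q).hom ≫ q := by
  have h := leftUnitor_monoidal X Q
  have e₁ : (((ρ_ C).hom ≫ e ≫ i) ⊗ₘ q) =
      (e ▷ 𝟙_ V ⊗ₘ X ◁ 𝟙 Q) ≫ (λ_ (𝟙_ V)).hom ▷ (X ⊗ Q) ≫ 𝟙_ V ◁ q ≫ i ▷ N := by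
    rw [← tensorHom_id (λ_ (𝟙_ V)).hom, ← id_tensorHom (𝟙_ V), ← tensorHom_id i, tensorHom_comp_tensorHom,
      tensorHom_comp_tensorHom, tensorHom_comp_tensorHom]
    simp [unitors_equal]
  have n₁ : tensorμ C X (𝟙_ V) Q ≫ (e ▷ 𝟙_ V ⊗ₘ X ◁ 𝟙 Q) =
      (e ▷ X) ▷ (𝟙_ V ⊗ Q) ≫ tensorμ (𝟙_ V) X (𝟙_ V) Q := by
    have := tensorμ_natural e (𝟙 X) (𝟙 (𝟙_ V)) (𝟙 Q)
    simp only [tensorHom_id, id_whiskerRight] at this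
    rw [this]; simp
  rw [e₁]
  simp only [Category.assoc]
  rw [reassoc_of% n₁, ha, leftUnitor_naturality, ← reassoc_of% h, ← comp_whiskerRight_assoc, hd]
  simp [MonoidalCategory.tensorHom_def]

lemma convolution_one_aux' {C B P : V} (e : C ⟶ 𝟙_ V) (d : C ⟶ C ⊗ C) (i : 𝟙_ V ⟶ B)
    (a : B ⊗ B ⟶ B) (p : C ⊗ P ⟶ B) (hd : d ≫ C ◁ e = (ρ_ C).inv)
    (ha : B ◁ i ≫ a = (ρ_ B).hom) :
    d ▷ (P ⊗ 𝟙_ V) ≫ tensorμ C C P (𝟙_ V) ≫ (p ⊗ₘ ((ρ_ C).hom ≫ e ≫ i)) ≫ a =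
      C ◁ (ρ_ P).hom ≫ p := by
  have h := rightUnitor_monoidal C P
  have e₁ : (p ⊗ₘ ((ρ_ C).hom ≫ e ≫ i)) =
      (C ◁ 𝟙 P ⊗ₘ e ▷ 𝟙_ V) ≫ (C ⊗ P) ◁ (λ_ (𝟙_ V)).hom ≫ p ▷ 𝟙_ V ≫ B ◁ i := by
    rw [← id_tensorHom (C ⊗ P), ← tensorHom_id p, ← id_tensorHom B, tensorHom_comp_tensorHom,
      tensorHom_comp_tensorHom, tensorHom_comp_tensorHom]
    simp [unitors_equal]
  have n₁ : tensorμ C C P (𝟙_ V) ≫ (C ◁ 𝟙 P ⊗ₘ e ▷ 𝟙_ V) =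
      (C ◁ e) ▷ (P ⊗ 𝟙_ V) ≫ tensorμ C (𝟙_ V) P (𝟙_ V) := by
    have := tensorμ_natural (𝟙 C) e (𝟙 P) (𝟙 (𝟙_ V))
    simp only [id_tensorHom, tensorHom_id, id_whiskerRight] at this
    rw [this]; simp
  rw [e₁]
  simp only [Category.assoc]
  rw [reassoc_of% n₁, ha, rightUnitor_naturality, ← reassoc_of% h, ← comp_whiskerRight_assoc, hd]
  simp [MonoidalCategory.tensorHom_def]

lemma convolution_natural_aux {C D X Y A B M N P Q : V} (g : C ⟶ D) (k : X ⟶ Y) (f : A ⟶ B)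
    (l : M ⟶ N) (d : X ⟶ C ⊗ X) (d' : Y ⟶ D ⊗ Y) (a : A ⊗ M ⟶ M) (a' : B ⊗ N ⟶ N)
    (p : D ⊗ P ⟶ A) (q : Y ⊗ Q ⟶ M)
    (hd : d ≫ (g ⊗ₘ k) = k ≫ d') (ha : a ≫ l = (f ⊗ₘ l) ≫ a') :
    k ▷ (P ⊗ Q) ≫ (d' ▷ (P ⊗ Q) ≫ tensorμ D Y P Q ≫ (p ⊗ₘ q) ≫ a) ≫ l =
      d ▷ (P ⊗ Q) ≫ tensorμ C X P Q ≫ ((g ▷ P ≫ p ≫ f) ⊗ₘ (k ▷ Q ≫ q ≫ l)) ≫ a' := by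
  simp only [Category.assoc]
  rw [ha, ← comp_whiskerRight_assoc, ← hd, comp_whiskerRight_assoc, tensorμ_natural_left_assoc,
    tensorHom_comp_tensorHom_assoc, tensorHom_comp_tensorHom_assoc, Category.assoc, Category.assoc]

end ConvolutionAux

section InternalHom

variable {V : Type u} [Category.{v} V] [MonoidalCategory V] [MonoidalClosed V]

open MonoidalClosed

/-- The morphism `[f, g] : [Y, M] ⟶ [X, N]` induced by `f : X ⟶ Y` and `g : M ⟶ N`. -/
def ihomMap {X Y M N : V} (f : X ⟶ Y) (g : M ⟶ N) : (ihom Y).obj M ⟶ (ihom X).obj N :=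
  (pre f).app M ≫ (ihom X).map g

lemma uncurry_ihomMap {X Y M N : V} (f : X ⟶ Y) (g : M ⟶ N) :
    uncurry (ihomMap f g) = f ▷ _ ≫ (ihom.ev Y).app M ≫ g := by
  rw [ihomMap, uncurry_natural_right, uncurry_pre, Category.assoc]

lemma uncurry_id_ihom (X N : V) : uncurry (𝟙 ((ihom X).obj N)) = (ihom.ev X).app N :=
  uncurry_id_eq_ev X N

lemma ihomMap_id (X M : V) : ihomMap (𝟙 X) (𝟙 M) = 𝟙 _ := by
  simp [ihomMap]

lemma ihomMap_comp {X Y Z M N L : V} (f : X ⟶ Y) (f' : Y ⟶ Z) (g : M ⟶ N) (g' : N ⟶ L) :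
    ihomMap f' g ≫ ihomMap f g' = ihomMap (f ≫ f') (g ≫ g') := by
  simp [ihomMap]

/-- The unit `I ⟶ [C, B]` for convolution attached to `e : C ⟶ I` and `i : I ⟶ B`. -/
def convolutionUnit {C B : V} (e : C ⟶ 𝟙_ V) (i : 𝟙_ V ⟶ B) : 𝟙_ V ⟶ (ihom C).obj B :=
  curry ((ρ_ C).hom ≫ e ≫ i)

lemma convolutionUnit_natural {C D A B : V} (g : C ⟶ D) (f : A ⟶ B) (e : C ⟶ 𝟙_ V)
    (e' : D ⟶ 𝟙_ V) (i : 𝟙_ V ⟶ A) (i' : 𝟙_ V ⟶ B) (he : g ≫ e' = e) (hi : i ≫ f = i') :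
    convolutionUnit e' i ≫ ihomMap g f = convolutionUnit e i' := by
  apply uncurry_injective
  rw [uncurry_natural_left, uncurry_ihomMap, whisker_exchange_assoc, ← Category.assoc (D ◁ _),
    ← uncurry_eq, convolutionUnit, convolutionUnit, uncurry_curry, uncurry_curry, ← he, ← hi]
  simp

end InternalHom

section Hom

variable {V : Type u} [Category.{v} V] [MonoidalCategory V] [SymmetricCategory V]
  [MonoidalClosed V]

open MonoidalClosed

/-- The convolution pairing `[C, B] ⊗ [X, N] ⟶ [X, N]` attached to `d : X ⟶ C ⊗ X` and
`a : B ⊗ N ⟶ N`: the composite of the lax monoidal structure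
`[C, B] ⊗ [X, N] ⟶ [C ⊗ X, B ⊗ N]` of the internal hom with `[d, a]`, described by its
transpose `X ⊗ ([C, B] ⊗ [X, N]) ⟶ N`. -/
def convolution {C X B N : V} (d : X ⟶ C ⊗ X) (a : B ⊗ N ⟶ N) :
    (ihom C).obj B ⊗ (ihom X).obj N ⟶ (ihom X).obj N :=
  curry (d ▷ _ ≫ tensorμ C X ((ihom C).obj B) ((ihom X).obj N) ≫
    ((ihom.ev C).app B ⊗ₘ (ihom.ev X).app N) ≫ a)

lemma uncurry_convolution_self {C X B N : V} (d : X ⟶ C ⊗ X) (a : B ⊗ N ⟶ N) :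
    uncurry (convolution d a) =
      d ▷ _ ≫ tensorμ C X ((ihom C).obj B) ((ihom X).obj N) ≫
        ((ihom.ev C).app B ⊗ₘ (ihom.ev X).app N) ≫ a := uncurry_curry _

lemma uncurry_convolution {C X B N Y Z : V} (d : X ⟶ C ⊗ X) (a : B ⊗ N ⟶ N)
    (f : Y ⟶ (ihom C).obj B) (g : Z ⟶ (ihom X).obj N) :
    uncurry ((f ⊗ₘ g) ≫ convolution d a) =
      d ▷ (Y ⊗ Z) ≫ tensorμ C X Y Z ≫ (uncurry f ⊗ₘ uncurry g) ≫ a := by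
  rw [uncurry_natural_left, uncurry_convolution_self, whisker_exchange_assoc,
    tensorμ_natural_right_assoc, tensorHom_comp_tensorHom_assoc, uncurry_eq, uncurry_eq]

lemma convolution_assoc {C X B N : V} (Δ' : C ⟶ C ⊗ C) (d : X ⟶ C ⊗ X) (m : B ⊗ B ⟶ B)
    (a : B ⊗ N ⟶ N) (hd : d ≫ Δ' ▷ X = d ≫ C ◁ d ≫ (α_ C C X).inv)
    (ha : m ▷ N ≫ a = (α_ B B N).hom ≫ B ◁ a ≫ a) :
    convolution Δ' m ▷ (ihom X).obj N ≫ convolution d a =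
      (α_ _ _ _).hom ≫ (ihom C).obj B ◁ convolution d a ≫ convolution d a := by
  apply uncurry_injective
  rw [← tensorHom_id, uncurry_convolution, uncurry_natural_left, ← id_tensorHom ((ihom C).obj B),
    uncurry_convolution, uncurry_convolution_self, uncurry_convolution_self,
    uncurry_id_ihom, uncurry_id_ihom]
  exact convolution_assoc_aux Δ' d m a _ _ _ hd ha

lemma convolution_one {C X B N : V} (e : C ⟶ 𝟙_ V) (d : X ⟶ C ⊗ X) (i : 𝟙_ V ⟶ B)
    (a : B ⊗ N ⟶ N) (hd : d ≫ e ▷ X = (λ_ X).inv) (ha : i ▷ N ≫ a = (λ_ N).hom) :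
    convolutionUnit e i ▷ (ihom X).obj N ≫ convolution d a = (λ_ _).hom := by
  apply uncurry_injective
  rw [← tensorHom_id, uncurry_convolution, uncurry_id_ihom, convolutionUnit, uncurry_curry,
    uncurry_eq]
  exact convolution_one_aux e d i a _ hd ha

lemma convolution_one' {C B : V} (e : C ⟶ 𝟙_ V) (d : C ⟶ C ⊗ C) (i : 𝟙_ V ⟶ B)
    (a : B ⊗ B ⟶ B) (hd : d ≫ C ◁ e = (ρ_ C).inv) (ha : B ◁ i ≫ a = (ρ_ B).hom) :
    (ihom C).obj B ◁ convolutionUnit e i ≫ convolution d a = (ρ_ _).hom := by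
  apply uncurry_injective
  rw [← id_tensorHom, uncurry_convolution, uncurry_id_ihom, convolutionUnit, uncurry_curry,
    uncurry_eq]
  exact convolution_one_aux' e d i a _ hd ha

lemma convolution_natural {C D X Y A B M N : V} (g : C ⟶ D) (k : X ⟶ Y) (f : A ⟶ B) (l : M ⟶ N)
    (d : X ⟶ C ⊗ X) (d' : Y ⟶ D ⊗ Y) (a : A ⊗ M ⟶ M) (a' : B ⊗ N ⟶ N)
    (hd : d ≫ (g ⊗ₘ k) = k ≫ d') (ha : a ≫ l = (f ⊗ₘ l) ≫ a') :
    convolution d' a ≫ ihomMap k l = (ihomMap g f ⊗ₘ ihomMap k l) ≫ convolution d a' := by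
  apply uncurry_injective
  rw [uncurry_convolution, uncurry_ihomMap, uncurry_ihomMap, uncurry_natural_left,
    uncurry_ihomMap, whisker_exchange_assoc, ← Category.assoc (Y ◁ _), ← uncurry_eq,
    uncurry_convolution_self]
  exact convolution_natural_aux g k f l d d' a a' _ _ hd ha

/-- The convolution monoid structure on `[C, B]`, for a comonoid `C` and a monoid `B`. -/
instance convMonObj (C B : V) [ComonObj C] [MonObj B] : MonObj ((ihom C).obj B) where
  one := convolutionUnit ε[C] η[B]
  mul := convolution Δ[C] μ[B]
  one_mul := convolution_one _ _ _ _ (ComonObj.counit_comul _) (MonObj.one_mul _)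
  mul_one := convolution_one' _ _ _ _ (ComonObj.comul_counit _) (MonObj.mul_one _)
  mul_assoc := convolution_assoc _ _ _ _ (ComonObj.comul_assoc_flip _) (MonObj.mul_assoc _)

/-- The convolution `[C, B]`-module structure on `[X, N]`, for a `C`-comodule `X` and a
`B`-module `N`. It is a definition and not an instance, as a monoid is a module over itself. -/
abbrev convModObj (C X B N : V) [ComonObj C] [ComodObj C X] [MonObj B] [ModObj B N] :
    ModObj ((ihom C).obj B) ((ihom X).obj N) where
  smul := convolution (coaction C X) γ[B, N]
  one_smul := convolution_one _ _ _ _ ComodObj.counit_coact (ModObj.one_smul_self (M := B) N)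
  mul_smul := convolution_assoc _ _ _ _ ComodObj.comul_coact (ModObj.mul_smul_self (M := B) N)

/-- The convolution monoid `[C, B]` of a comonoid `C` and a monoid `B`. -/
abbrev convMon (C : Comon V) (B : Mon V) : Mon V := ⟨(ihom C.X).obj B.X⟩

/-- The functor `(C, B) ↦ [C, B]` from comonoids (contravariantly) and monoids to monoids. -/
def convMonFunctor (V : Type u) [Category.{v} V] [MonoidalCategory V] [SymmetricCategory V]
    [MonoidalClosed V] : (Comon V)ᵒᵖ ⥤ Mon V ⥤ Mon V where
  obj C :=
    { obj := fun B => convMon C.unop B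
      map := fun f =>
        { hom := ihomMap (𝟙 _) f.hom
          isMonHom_hom :=
            { one_hom := convolutionUnit_natural _ _ _ _ _ _ (by simp) (by simp)
              mul_hom := convolution_natural _ _ _ _ _ _ _ _ (by simp) (by simp) } }
      map_id := fun B => by ext; exact ihomMap_id _ _
      map_comp := fun f g => by
        ext; exact ((ihomMap_comp _ _ _ _).trans (by simp)).symm }
  map g :=
    { app := fun B =>
        { hom := ihomMap g.unop.hom (𝟙 _)
          isMonHom_hom :=
            { one_hom := convolutionUnit_natural _ _ _ _ _ _ (by simp) (by simp)
              mul_hom := convolution_natural _ _ _ _ _ _ _ _ (by simp) (by simp) } }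
      naturality := fun A B f => by
        ext; exact (ihomMap_comp _ _ _ _).trans ((by simp : _ = _).trans (ihomMap_comp _ _ _ _).symm) }
  map_id C := by ext B; exact ihomMap_id _ _
  map_comp g g' := by ext B; exact ((ihomMap_comp _ _ _ _).trans (by simp)).symm

/-- The `[C, B]`-module `[X, N]` of a `C`-comodule `X` and a `B`-module `N`. -/
abbrev homMod (X : GlobalComod V) (N : GlobalMod V) : GlobalMod V where
  base := convMon X.base N.base
  fib :=
    { X := (ihom X.X).obj N.X
      mod := convModObj X.base.X X.X N.base.X N.X }

lemma act_homMod (X : GlobalComod V) (N : GlobalMod V) :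
    (homMod X N).act = convolution X.coact N.act := rfl

/-- The functor `(X_C, N_B) ↦ [X, N]_{[C, B]}` from the global category of comodules
(contravariantly) and the global category of modules to the global category of modules. -/
def homFunctor (V : Type u) [Category.{v} V] [MonoidalCategory V] [SymmetricCategory V]
    [MonoidalClosed V] : (GlobalComod V)ᵒᵖ ⥤ GlobalMod V ⥤ GlobalMod V where
  obj X :=
    { obj := fun N => homMod X.unop N
      map := fun {M N} f =>
        { base := ((convMonFunctor V).obj (op X.unop.base)).map f.base
          hom := ihomMap (𝟙 _) f.hom
          act_hom := by
            rw [← Category.assoc, ← tensorHom_def']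
            exact convolution_natural _ _ _ _ _ _ _ _ (by simp) (GlobalMod.act_tensorHom f) }
      map_id := fun N => GlobalMod.hom_ext (((convMonFunctor V).obj (op X.unop.base)).map_id N.base) (ihomMap_id _ _)
      map_comp := fun f g => GlobalMod.hom_ext (((convMonFunctor V).obj (op X.unop.base)).map_comp f.base g.base)
        ((ihomMap_comp _ _ _ _).trans (by simp)).symm }
  map {X Y} g :=
    { app := fun N =>
        { base := ((convMonFunctor V).map g.unop.base.op).app N.base
          hom := ihomMap g.unop.hom (𝟙 _)
          act_hom := by
            rw [← Category.assoc, ← tensorHom_def']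
            exact convolution_natural _ _ _ _ _ _ _ _ (GlobalComod.coact_tensorHom g.unop)
              (by simp) }
      naturality := fun M N f => GlobalMod.hom_ext
        (((convMonFunctor V).map g.unop.base.op).naturality f.base)
        ((ihomMap_comp _ _ _ _).trans ((by simp : _ = _).trans (ihomMap_comp _ _ _ _).symm)) }
  map_id X := NatTrans.ext <| funext fun N =>
    GlobalMod.hom_ext (congrArg (fun t => t.app N.base) ((convMonFunctor V).map_id (op X.unop.base)))
      (ihomMap_id _ _)
  map_comp g g' := NatTrans.ext <| funext fun N =>
    GlobalMod.hom_ext (congrArg (fun t => t.app N.base)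
      ((convMonFunctor V).map_comp g.unop.base.op g'.unop.base.op))
      ((ihomMap_comp _ _ _ _).trans (by simp)).symm

/-- The universal measuring comonoid property of `P = P(A, B)`: comonoid morphisms `C ⟶ P`
correspond, naturally in `C`, to monoid morphisms `A ⟶ [C, B]`. -/
structure UniversalMeasuringComonoid (A B : Mon V) (P : Comon V) where
  /-- The bijection. -/
  homEquiv (C : Comon V) : (C ⟶ P) ≃ (A ⟶ ((convMonFunctor V).obj (op C)).obj B)
  homEquiv_comp {C' C : Comon V} (f : C' ⟶ C) (g : C ⟶ P) :
    homEquiv C' (f ≫ g) = homEquiv C g ≫ ((convMonFunctor V).map f.op).app B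

/-- The universal measuring comodule property of `Q = Q(M, N)`: morphisms `X ⟶ Q` in the global
category of comodules correspond, naturally in `X`, to morphisms `M ⟶ [X, N]` in the global
category of modules. -/
structure UniversalMeasuringComodule (M N : GlobalMod V) (Q : GlobalComod V) where
  /-- The bijection. -/
  homEquiv (X : GlobalComod V) : (X ⟶ Q) ≃ (M ⟶ ((homFunctor V).obj (op X)).obj N)
  homEquiv_comp {X' X : GlobalComod V} (f : X' ⟶ X) (g : X ⟶ Q) :
    homEquiv X' (f ≫ g) = homEquiv X g ≫ ((homFunctor V).map f.op).app N

end Hom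

section Enrichment

universe v₁ u₁ v₂ u₂

/-- An enrichment of the ordinary category `A` in the monoidal category `W` with prescribed
hom-objects `H M N`: a `W`-category with the objects of `A` and the hom-objects `H M N`, together
with an identification of its underlying ordinary category with `A`. -/
structure EnrichmentOn (W : Type u₁) [Category.{v₁} W] [MonoidalCategory W]
    (A : Type u₂) [Category.{v₂} A] (H : A → A → W) where
  /-- The identities. -/
  id (M : A) : 𝟙_ W ⟶ H M M
  /-- The composition. -/
  comp (L M N : A) : H L M ⊗ H M N ⟶ H L N
  id_comp (M N : A) : (λ_ (H M N)).inv ≫ id M ▷ H M N ≫ comp M M N = 𝟙 (H M N)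
  comp_id (M N : A) : (ρ_ (H M N)).inv ≫ H M N ◁ id N ≫ comp M N N = 𝟙 (H M N)
  assoc (K L M N : A) :
    (α_ (H K L) (H L M) (H M N)).inv ≫ comp K L M ▷ H M N ≫ comp K M N =
      H K L ◁ comp L M N ≫ comp K L N
  /-- Morphisms of `A` are the morphisms of the underlying ordinary category. -/
  homEquiv {M N : A} : (M ⟶ N) ≃ (𝟙_ W ⟶ H M N)
  homEquiv_id (M : A) : homEquiv (𝟙 M) = id M
  homEquiv_comp {L M N : A} (f : L ⟶ M) (g : M ⟶ N) :
    homEquiv (f ≫ g) = (λ_ (𝟙_ W)).inv ≫ (homEquiv f ⊗ₘ homEquiv g) ≫ comp L M N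

namespace EnrichmentOn

variable {W : Type u₁} [Category.{v₁} W] [MonoidalCategory W] {A : Type u₂} [Category.{v₂} A]
  {H : A → A → W}

/-- An enrichment with prescribed hom-objects is an enriched ordinary category. -/
abbrev toEnrichedOrdinaryCategory (E : EnrichmentOn W A H) : EnrichedOrdinaryCategory W A where
  Hom := H
  id := E.id
  comp := E.comp
  id_comp := E.id_comp
  comp_id := E.comp_id
  assoc := E.assoc
  homEquiv := E.homEquiv
  homEquiv_id := E.homEquiv_id
  homEquiv_comp := E.homEquiv_comp

/-- The opposite enrichment, on the opposite category, of a category enriched in a braided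
monoidal category. -/
def op [BraidedCategory W] (E : EnrichmentOn W A H) :
    EnrichmentOn W Aᵒᵖ (fun M N => H N.unop M.unop) :=
  letI := E.toEnrichedOrdinaryCategory
  letI F : EnrichedOrdinaryCategory W Aᵒᵖ := inferInstance
  { id := F.id
    comp := F.comp
    id_comp := F.id_comp
    comp_id := F.comp_id
    assoc := F.assoc
    homEquiv := F.homEquiv
    homEquiv_id := F.homEquiv_id
    homEquiv_comp := F.homEquiv_comp }

lemma op_id [BraidedCategory W] (E : EnrichmentOn W A H) (M : Aᵒᵖ) : E.op.id M = E.id M.unop :=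
  rfl

lemma op_comp [BraidedCategory W] (E : EnrichmentOn W A H) (L M N : Aᵒᵖ) :
    E.op.comp L M N =
      (β_ (H M.unop L.unop) (H N.unop M.unop)).hom ≫ E.comp N.unop M.unop L.unop := rfl

lemma op_homEquiv [BraidedCategory W] (E : EnrichmentOn W A H) {M N : Aᵒᵖ} (f : M ⟶ N) :
    E.op.homEquiv f = E.homEquiv f.unop := rfl

/-- The morphism `H f N : H M N ⟶ H L N` induced by `f : L ⟶ M`. -/
def precomp (E : EnrichmentOn W A H) {L M : A} (f : L ⟶ M) (N : A) : H M N ⟶ H L N :=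
  (λ_ (H M N)).inv ≫ E.homEquiv f ▷ H M N ≫ E.comp L M N

/-- The morphism `H M g : H M N ⟶ H M L` induced by `g : N ⟶ L`. -/
def postcomp (E : EnrichmentOn W A H) (M : A) {N L : A} (g : N ⟶ L) : H M N ⟶ H M L :=
  (ρ_ (H M N)).inv ≫ H M N ◁ E.homEquiv g ≫ E.comp M N L

/-- `T`, with the unit `u : X ⟶ H M T`, is the tensor (copower) of `M` by `X`: the morphism
`H T N ⟶ [X, H M N]` induced by composition with `u` is invertible for all `N`. -/
def IsTensor [MonoidalClosed W] (E : EnrichmentOn W A H) (X : W) (M T : A) (u : X ⟶ H M T) :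
    Prop :=
  ∀ N : A, IsIso (MonoidalClosed.curry (u ▷ H T N ≫ E.comp M T N) :
    H T N ⟶ (ihom X).obj (H M N))

/-- `K`, with the counit `c : X ⟶ H K N`, is the cotensor (power) of `N` by `X`: the morphism
`H M K ⟶ [X, H M N]` induced by composition with `c` is invertible for all `M`. -/
def IsCotensor [BraidedCategory W] [MonoidalClosed W] (E : EnrichmentOn W A H) (X : W) (N K : A)
    (c : X ⟶ H K N) : Prop :=
  ∀ M : A, IsIso (MonoidalClosed.curry ((β_ X (H M K)).hom ≫ H M K ◁ c ≫ E.comp M K N) :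
    H M K ⟶ (ihom X).obj (H M N))

end EnrichmentOn

end Enrichment

end MeasuringComodule

open MeasuringComodule

/-! Two functors out of the category of comodules need right adjoints: tensoring with a fixed
comodule, which gives closedness, and `Hom(-, N)` with values in the opposite of modules, whose
right adjoint sends `M` to the universal measuring comodule `Q(M, N)`. Both are cocontinuous, since
colimits of comodules and limits of modules are computed on the underlying pairs in `V × V`. So it
suffices that every cocontinuous functor on comodules is a left adjoint
(`GlobalComod.isLeftAdjoint_of_preservesColimits`), and by `IsDenseProperty.isLeftAdjoint` this
follows from cocompleteness and an essentially small dense full subcategory.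

Density is the main work. A comodule is a dialgebra on a pair `(C, X)`, with structure maps `F i ⟶ G
i` subject to equations. Fix an uncountable regular `κ` such that `κ`-presentable objects are closed
under tensor products. For a map from a presentable pair to a comodule, the structure maps can be
defined, and each equation enforced, after enlarging the pair inside presentable ones. Iterating
along `ℕ` and passing to the colimit yields a comodule with presentable carrier through which the
map factors (`Dialg.exists_satisfies_of_obj`, and `Dialg.exists_satisfies_of_hom` for uniqueness).
Hence comodules with presentable carriers are dense (`Dialg.isDenseProperty_underlying`). The same
construction for modules shows that a measuring with presentable source factors through a
presentable module (`Measuring.exists_factorization`). This is the solution set condition for the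
left adjoint of `Hom(X, -)`.

The universal measuring comonoid is the comonoid underlying `Q(M, N)`: test the universal property
on the comodule carried by the initial object.

For the enrichment, maps `M ⟶ [X, N]` are rewritten as measurings, that is, pairings `A ⊗ C ⟶ B` and
`M ⊗ X ⟶ N`, which compose along the tensor product of comodules. Since `Q(M, N)` represents
measurings, composition, identities and their laws transfer by Yoneda. Cotensors express that
measurings by `X ⊗ Y` into `N` are measurings by `X` into `[Y, N]` (`Measuring.comp_ev_bijective`);
tensors combine this with the adjunction. The statements for the opposite enrichment follow through
the symmetry. -/

namespace MeasuringComodule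

/-! ### Adjoint functor theorem from a small dense subcategory -/

section DenseAdjoint

open Limits

universe u₁ u₂

/-- A morphism to `X` from an object satisfying `P`, as an object of the canonical diagram. -/
abbrev canonicalArrow {K : Type u₁} [Category.{v} K] {P : ObjectProperty K} {X : K} (c : K)
    (hc : P c) (u : c ⟶ X) : CostructuredArrow P.ι X :=
  CostructuredArrow.mk (S := P.ι) (Y := (⟨c, hc⟩ : P.FullSubcategory)) u

/-- The cocone with apex `X` on the diagram of all morphisms to `X` from objects satisfying `P`. -/
abbrev canonicalCocone {K : Type u₁} [Category.{v} K] (P : ObjectProperty K) (X : K) :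
    Cocone (CostructuredArrow.proj P.ι X ⋙ P.ι) :=
  ⟨X, { app := fun j => j.hom
        naturality := fun _ _ f => (CostructuredArrow.w f).trans (Category.comp_id _).symm }⟩

/-- Every object is the canonical colimit of the objects satisfying `P`, in elementary terms. -/
structure IsDenseProperty {K : Type u₁} [Category.{v} K] (P : ObjectProperty K) : Prop where
  hom_ext {X T : K} {f g : X ⟶ T} (h : ∀ c, P c → ∀ u : c ⟶ X, u ≫ f = u ≫ g) : f = g
  exists_desc {X T : K} (φ : ∀ c, P c → (c ⟶ X) → (c ⟶ T))
    (hφ : ∀ c c' (hc : P c) (hc' : P c') (a : c ⟶ c') (u : c' ⟶ X),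
      φ c hc (a ≫ u) = a ≫ φ c' hc' u) :
    ∃ h : X ⟶ T, ∀ c hc u, u ≫ h = φ c hc u

lemma IsDenseProperty.of_isDense {K : Type u₁} [Category.{v} K] (P : ObjectProperty K)
    [P.ι.IsDense] : IsDenseProperty P := by
  have h (X : K) : Nonempty (IsColimit (canonicalCocone P X)) :=
    ⟨IsColimit.ofIsoColimit (P.ι.denseAt X)
      (Cocone.ext (Iso.refl _) (fun j => (Category.comp_id _).trans (Category.id_comp _)))⟩
  constructor
  · intro X T f g hfg
    exact (h X).some.hom_ext fun j => hfg _ j.left.property j.hom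
  · intro X T φ hφ
    let c : Cocone (CostructuredArrow.proj P.ι X ⋙ P.ι) :=
      ⟨T, { app := fun j => φ _ j.left.property j.hom
            naturality := fun i j f => by
              refine Eq.trans ?_ (Category.comp_id _).symm
              rw [← CostructuredArrow.w f]
              exact (hφ _ _ i.left.property j.left.property f.left.hom j.hom).symm }⟩
    refine ⟨(h X).some.desc c, fun d hd u => ?_⟩
    exact (h X).some.fac c (canonicalArrow d hd u)

lemma IsDenseProperty.nonempty_isColimit {K : Type u₁} [Category.{v} K] {P : ObjectProperty K}
    (hP : IsDenseProperty P) (X : K) : Nonempty (IsColimit (canonicalCocone P X)) := by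
  have (s : Cocone (CostructuredArrow.proj P.ι X ⋙ P.ι)) : ∃ h : X ⟶ s.pt, ∀ c (hc : P c)
      (u : c ⟶ X), u ≫ h = s.ι.app (canonicalArrow c hc u) :=
    hP.exists_desc _ fun c c' hc hc' a u => by
      let f : (canonicalArrow c hc (a ≫ u)) ⟶
          canonicalArrow c' hc' u :=
        CostructuredArrow.homMk (ObjectProperty.homMk a)
      exact (s.w f).symm
  choose d hd using this
  exact ⟨{ desc := d
           fac := fun s j => hd s _ j.left.property j.hom
           uniq := fun s m hm => hP.hom_ext fun c hc u =>
            (hm (canonicalArrow c hc u)).trans (hd s c hc u).symm }⟩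

/-- A cocontinuous functor out of a cocomplete category with an essentially small dense full
subcategory is a left adjoint. -/
theorem IsDenseProperty.isLeftAdjoint {K : Type u₁} [Category.{v} K] [HasColimitsOfSize.{v, v} K]
    {P : ObjectProperty K} [ObjectProperty.EssentiallySmall.{v} P] (hP : IsDenseProperty P)
    {L : Type u₂} [Category.{v} L] (Ψ : K ⥤ L) [PreservesColimitsOfSize.{v, v} Ψ] :
    Ψ.IsLeftAdjoint := by
  have (Z : L) : HasTerminal (CostructuredArrow Ψ Z) := by
    -- The candidate value of the right adjoint at `Z` is the colimit of all small `c` equipped with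
    -- a map `Ψ c ⟶ Z`. Cocontinuity of `Ψ` provides its map to `Z`.
    let J := CostructuredArrow (P.ι ⋙ Ψ) Z
    let D : J ⥤ K := CostructuredArrow.proj (P.ι ⋙ Ψ) Z ⋙ P.ι
    have : HasColimitsOfShape J K :=
      hasColimitsOfShape_of_equivalence (equivSmallModel.{v} J).symm
    have : PreservesColimitsOfShape J Ψ :=
      preservesColimitsOfShape_of_equiv (equivSmallModel.{v} J).symm Ψ
    let c : Cocone (D ⋙ Ψ) :=
      ⟨Z, { app := fun j => j.hom
            naturality := fun i j f =>
              (CostructuredArrow.w f).trans (Category.comp_id _).symm }⟩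
    let hΨ := isColimitOfPreserves Ψ (colimit.isColimit D)
    let T : CostructuredArrow Ψ Z := CostructuredArrow.mk (Y := colimit D) (hΨ.desc c)
    -- Weak terminality: every small object over `X.left` indexes a leg of `colimit D`, and density
    -- glues these legs into one map.
    have hT (X : CostructuredArrow Ψ Z) : Nonempty (X ⟶ T) := by
      let a (c : K) (hc : P c) (u : c ⟶ X.left) : J :=
        CostructuredArrow.mk (S := P.ι ⋙ Ψ) (Y := ⟨c, hc⟩) (Ψ.map u ≫ X.hom)
      obtain ⟨d, hd⟩ := hP.exists_desc (X := X.left) (T := colimit D)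
        (fun c hc u => colimit.ι D (a c hc u)) (fun c c' hc hc' f u => by
          let g : a c hc (f ≫ u) ⟶ a c' hc' u :=
            CostructuredArrow.homMk (ObjectProperty.homMk f) (by
              dsimp [a]
              rw [Ψ.map_comp, Category.assoc])
          exact (colimit.w D g).symm)
      have : PreservesColimitsOfShape (CostructuredArrow P.ι X.left) Ψ :=
        preservesColimitsOfShape_of_equiv
          (equivSmallModel.{v} (CostructuredArrow P.ι X.left)).symm Ψ
      refine ⟨CostructuredArrow.homMk d ?_⟩
      apply (isColimitOfPreserves Ψ (hP.nonempty_isColimit X.left).some).hom_ext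
      intro j
      have h₂ := hΨ.fac c (a _ j.left.property j.hom)
      refine Eq.trans ?_ h₂
      change Ψ.map j.hom ≫ Ψ.map d ≫ hΨ.desc c = _
      rw [← Ψ.map_comp_assoc]
      exact congrArg (fun t => Ψ.map t ≫ hΨ.desc c) (hd _ j.left.property j.hom)
    -- Uniqueness needs no further computation: the comma category inherits colimits from `K`, so
    -- its opposite has wide equalizers, and a weakly initial object there yields an initial one.
    have : HasInitial (CostructuredArrow Ψ Z)ᵒᵖ :=
      hasInitial_of_weakly_initial_and_hasWideEqualizers (T := op T)
        (fun X => ⟨(hT X.unop).some.op⟩)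
    exact hasTerminal_of_hasInitial_op
  exact isLeftAdjoint_of_costructuredArrowTerminals _

/-- A locally presentable category is complete. -/
theorem hasLimits_of_isLocallyPresentable (V : Type u) [Category.{v} V]
    [IsLocallyPresentable.{v} V] : HasLimitsOfSize.{v, v} V := by
  obtain ⟨κ, _, _⟩ := IsLocallyPresentable.exists_cardinal.{v} V
  -- Limits of a given shape amount to a right adjoint of the diagonal functor, which is
  -- cocontinuous.
  exact ⟨fun _ _ => hasLimitsOfShape_iff_isLeftAdjoint_const.2
    ((IsDenseProperty.of_isDense (isCardinalPresentable V κ)).isLeftAdjoint _)⟩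

end DenseAdjoint

/-! ### Regular cardinals adapted to the tensor product -/

section Cardinal

/-- Any small family of objects of a locally presentable category consists of `κ`-presentable
objects for some large regular cardinal `κ`. -/
lemma exists_cardinal_forall_isCardinalPresentable {V : Type u} [Category.{v} V]
    [IsLocallyPresentable.{v} V] (κ₀ : Cardinal.{v}) [Fact κ₀.IsRegular] {I : Type*} [Small.{v} I]
    (Y : I → V) :
    ∃ (κ : Cardinal.{v}) (_ : Fact κ.IsRegular), κ₀ ≤ κ ∧ Cardinal.aleph0 < κ ∧
      ∀ i, IsCardinalPresentable (Y i) κ := by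
  have (i : I) : ∃ (κ : Cardinal.{v}) (_ : Fact κ.IsRegular), IsCardinalPresentable (Y i) κ :=
    Functor.IsAccessible.exists_cardinal (F := coyoneda.obj (op (Y i)))
  choose c hc hY using this
  -- The two extra indices place `κ` above `κ₀` and strictly above `ℵ₀`. The strict bound later
  -- gives closure under countable colimits.
  let Z : Option (Option I) → Cardinal.{v}
    | none => κ₀
    | some none => Cardinal.aleph0
    | some (some i) => c i
  have : Small.{v} (Option (Option I)) :=
    small_map ((Equiv.optionCongr (Equiv.optionCongr (equivShrink.{v} I))))
  obtain ⟨κ, h₁, h₂⟩ := HasCardinalLT.exists_regular_cardinal_forall.{v} (fun i => (Z i).ord.ToType)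
  have h₃ (i) : Z i < κ := by simpa [hasCardinalLT_iff_cardinal_mk_lt] using h₂ i
  have : Fact κ.IsRegular := ⟨h₁⟩
  exact ⟨κ, ⟨h₁⟩, (h₃ none).le, h₃ (some none), fun i =>
    isCardinalPresentable_of_le _ (h₃ (some (some i))).le⟩

/-- In a locally presentable monoidal category whose tensor product is cocontinuous in each
variable, there are large regular cardinals `κ` such that the `κ`-presentable objects are closed
under the tensor product. -/
lemma exists_cardinal_tensor {V : Type u} [Category.{v} V] [MonoidalCategory V]
    [IsLocallyPresentable.{v} V]
    [∀ X : V, Limits.PreservesColimitsOfSize.{v, v} (tensorLeft X)]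
    [∀ X : V, Limits.PreservesColimitsOfSize.{v, v} (tensorRight X)]
    {I : Type*} [Small.{v} I] (Y : I → V) :
    ∃ (κ : Cardinal.{v}) (_ : Fact κ.IsRegular), IsCardinalLocallyPresentable V κ ∧
      Cardinal.aleph0 < κ ∧ (∀ i, IsCardinalPresentable (Y i) κ) ∧
      ∀ p q : V, IsCardinalPresentable p κ → IsCardinalPresentable q κ →
        IsCardinalPresentable (p ⊗ q) κ := by
  obtain ⟨κ₀, _, _⟩ := IsLocallyPresentable.exists_cardinal.{v} V
  obtain ⟨S, _, hS₁, hS₂⟩ := (IsCardinalLocallyPresentable.iff_exists_isStrongGenerator V κ₀).1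
    inferInstance
  have : Small.{v} (Subtype S) := inferInstanceAs (ObjectProperty.Small.{v} S)
  -- Only products of two generators are made presentable by hand, because the `κ`-presentable
  -- objects are the closure of the generators under `κ`-small colimits.
  obtain ⟨κ, _, h₁, h₂, h₃⟩ := exists_cardinal_forall_isCardinalPresentable κ₀
    (Sum.elim (fun x : Subtype S × Subtype S => x.1.1 ⊗ x.2.1) Y)
  have hS₃ : S ≤ isCardinalPresentable V κ := hS₂.trans (isCardinalPresentable_monotone _ h₁)
  have eq : isCardinalPresentable V κ = S.colimitsCardinalClosure κ :=
    IsStrongGenerator.colimitsCardinalClosure_eq_isCardinalPresentable hS₁ hS₃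
  refine ⟨κ, inferInstance, IsCardinalLocallyPresentable.of_le V h₁, h₂, fun i => h₃ (Sum.inr i), ?_⟩
  have key (F : V ⥤ V) [Limits.PreservesColimitsOfSize.{v, v} F]
      (hF : ∀ s, S s → IsCardinalPresentable (F.obj s) κ) :
      S.colimitsCardinalClosure κ ≤ (isCardinalPresentable V κ).inverseImage F := by
    apply ObjectProperty.colimitsCardinalClosure_le
    · intro J _ hJ
      have := isClosedUnderColimitsOfShape_isCardinalPresentable V hJ
      constructor
      rintro X ⟨hX⟩
      exact (isCardinalPresentable V κ).prop_of_isColimit (Limits.isColimitOfPreserves F hX.isColimit)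
        hX.prop_diag_obj
    · exact hF
  intro p q hp hq
  have hp' : S.colimitsCardinalClosure κ p := by rw [← eq]; exact hp
  have hq' : S.colimitsCardinalClosure κ q := by rw [← eq]; exact hq
  -- Closure induction in one variable at a time: over `q` with `p` fixed, and, for `q` a generator
  -- `s`, over `p`.
  refine key (tensorLeft p) (fun s hs => ?_) q hq'
  exact key (tensorRight s) (fun t ht => h₃ (Sum.inl (⟨t, ht⟩, ⟨s, hs⟩))) p hp'

end Cardinal

/-! ### Limits and colimits in a product category -/

section Prod

open Limits

universe w' w v₁ v₂ u₁ u₂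

variable {J : Type w} [Category.{w'} J] {C : Type u₁} [Category.{v₁} C] {D : Type u₂}
  [Category.{v₂} D]

/-- A cocone in a product category is colimit if both its components are. -/
def prodIsColimit {F : J ⥤ C × D} {c : Cocone F} (h₁ : IsColimit ((CategoryTheory.Prod.fst C D).mapCocone c))
    (h₂ : IsColimit ((CategoryTheory.Prod.snd C D).mapCocone c)) : IsColimit c where
  desc s := CategoryTheory.Prod.mkHom (h₁.desc ((CategoryTheory.Prod.fst C D).mapCocone s)) (h₂.desc ((CategoryTheory.Prod.snd C D).mapCocone s))
  fac s j := Prod.ext (h₁.fac ((CategoryTheory.Prod.fst C D).mapCocone s) j)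
    (h₂.fac ((CategoryTheory.Prod.snd C D).mapCocone s) j)
  uniq s _ hm := Prod.ext
    (h₁.uniq ((CategoryTheory.Prod.fst C D).mapCocone s) _ fun j => congrArg Prod.fst (hm j))
    (h₂.uniq ((CategoryTheory.Prod.snd C D).mapCocone s) _ fun j => congrArg Prod.snd (hm j))

/-- A cone in a product category is limit if both its components are. -/
def prodIsLimit {F : J ⥤ C × D} {c : Cone F} (h₁ : IsLimit ((CategoryTheory.Prod.fst C D).mapCone c))
    (h₂ : IsLimit ((CategoryTheory.Prod.snd C D).mapCone c)) : IsLimit c where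
  lift s := CategoryTheory.Prod.mkHom (h₁.lift ((CategoryTheory.Prod.fst C D).mapCone s)) (h₂.lift ((CategoryTheory.Prod.snd C D).mapCone s))
  fac s j := Prod.ext (h₁.fac ((CategoryTheory.Prod.fst C D).mapCone s) j)
    (h₂.fac ((CategoryTheory.Prod.snd C D).mapCone s) j)
  uniq s _ hm := Prod.ext
    (h₁.uniq ((CategoryTheory.Prod.fst C D).mapCone s) _ fun j => congrArg Prod.fst (hm j))
    (h₂.uniq ((CategoryTheory.Prod.snd C D).mapCone s) _ fun j => congrArg Prod.snd (hm j))

/-- The cocone in a product category with given components. -/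
abbrev prodCocone {F : J ⥤ C × D} (c₁ : Cocone (F ⋙ CategoryTheory.Prod.fst C D))
    (c₂ : Cocone (F ⋙ CategoryTheory.Prod.snd C D)) : Cocone F :=
  ⟨(c₁.pt, c₂.pt), { app := fun j => CategoryTheory.Prod.mkHom (c₁.ι.app j) (c₂.ι.app j)
                     naturality := fun _ _ f =>
                      Prod.ext (c₁.ι.naturality f) (c₂.ι.naturality f) }⟩

/-- The cone in a product category with given components. -/
abbrev prodCone {F : J ⥤ C × D} (c₁ : Cone (F ⋙ CategoryTheory.Prod.fst C D))
    (c₂ : Cone (F ⋙ CategoryTheory.Prod.snd C D)) : Cone F :=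
  ⟨(c₁.pt, c₂.pt), { app := fun j => CategoryTheory.Prod.mkHom (c₁.π.app j) (c₂.π.app j)
                     naturality := fun _ _ f =>
                      Prod.ext (c₁.π.naturality f) (c₂.π.naturality f) }⟩

instance prod_hasColimitsOfShape [HasColimitsOfShape J C] [HasColimitsOfShape J D] :
    HasColimitsOfShape J (C × D) where
  has_colimit F := ⟨⟨⟨prodCocone (colimit.cocone _) (colimit.cocone _),
    prodIsColimit (c := prodCocone (colimit.cocone _) (colimit.cocone _))
      (colimit.isColimit (F ⋙ CategoryTheory.Prod.fst C D))
      (colimit.isColimit (F ⋙ CategoryTheory.Prod.snd C D))⟩⟩⟩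

instance prod_hasLimitsOfShape [HasLimitsOfShape J C] [HasLimitsOfShape J D] :
    HasLimitsOfShape J (C × D) where
  has_limit F := ⟨⟨⟨prodCone (limit.cone _) (limit.cone _),
    prodIsLimit (c := prodCone (limit.cone _) (limit.cone _))
      (limit.isLimit (F ⋙ CategoryTheory.Prod.fst C D)) (limit.isLimit (F ⋙ CategoryTheory.Prod.snd C D))⟩⟩⟩

instance preservesColimitsOfShape_fst [HasColimitsOfShape J C] [HasColimitsOfShape J D] :
    PreservesColimitsOfShape J (CategoryTheory.Prod.fst C D) where
  preservesColimit {F} := preservesColimit_of_preserves_colimit_cocone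
    (prodIsColimit (c := prodCocone (colimit.cocone _) (colimit.cocone _))
      (colimit.isColimit (F ⋙ CategoryTheory.Prod.fst C D)) (colimit.isColimit (F ⋙ CategoryTheory.Prod.snd C D)))
    (colimit.isColimit (F ⋙ CategoryTheory.Prod.fst C D))

instance preservesColimitsOfShape_snd [HasColimitsOfShape J C] [HasColimitsOfShape J D] :
    PreservesColimitsOfShape J (CategoryTheory.Prod.snd C D) where
  preservesColimit {F} := preservesColimit_of_preserves_colimit_cocone
    (prodIsColimit (c := prodCocone (colimit.cocone _) (colimit.cocone _))
      (colimit.isColimit (F ⋙ CategoryTheory.Prod.fst C D)) (colimit.isColimit (F ⋙ CategoryTheory.Prod.snd C D)))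
    (colimit.isColimit (F ⋙ CategoryTheory.Prod.snd C D))

instance preservesLimitsOfShape_fst [HasLimitsOfShape J C] [HasLimitsOfShape J D] :
    PreservesLimitsOfShape J (CategoryTheory.Prod.fst C D) where
  preservesLimit {F} := preservesLimit_of_preserves_limit_cone
    (prodIsLimit (c := prodCone (limit.cone _) (limit.cone _))
      (limit.isLimit (F ⋙ CategoryTheory.Prod.fst C D)) (limit.isLimit (F ⋙ CategoryTheory.Prod.snd C D)))
    (limit.isLimit (F ⋙ CategoryTheory.Prod.fst C D))

instance preservesLimitsOfShape_snd [HasLimitsOfShape J C] [HasLimitsOfShape J D] :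
    PreservesLimitsOfShape J (CategoryTheory.Prod.snd C D) where
  preservesLimit {F} := preservesLimit_of_preserves_limit_cone
    (prodIsLimit (c := prodCone (limit.cone _) (limit.cone _))
      (limit.isLimit (F ⋙ CategoryTheory.Prod.fst C D)) (limit.isLimit (F ⋙ CategoryTheory.Prod.snd C D)))
    (limit.isLimit (F ⋙ CategoryTheory.Prod.snd C D))

end Prod

/-! ### Dialgebras, their limits and colimits, and equations between operations -/

section Dialgebra

open Limits

universe w' w v₁ u₁

variable {W : Type u₁} [Category.{v₁} W] {V : Type u} [Category.{v} V] {I : Type}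

/-- A dialgebra for two families of functors `F i` and `G i`: an object with structure morphisms
`F i X ⟶ G i X`. -/
structure Dialg (F G : I → W ⥤ V) where
  /-- The underlying object. -/
  X : W
  /-- The structure morphisms. -/
  str (i : I) : (F i).obj X ⟶ (G i).obj X

namespace Dialg

variable {F G : I → W ⥤ V}

/-- A morphism of dialgebras. -/
@[ext]
structure Hom (D E : Dialg F G) where
  /-- The underlying morphism. -/
  hom : D.X ⟶ E.X
  comm (i : I) : (F i).map hom ≫ E.str i = D.str i ≫ (G i).map hom

instance : Category (Dialg F G) where
  Hom := Hom
  id D := { hom := 𝟙 _, comm := by simp }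
  comp f g := { hom := f.hom ≫ g.hom
                comm := fun i => by
                  simp only [Functor.map_comp, Category.assoc]
                  rw [g.comm, ← Category.assoc, f.comm, Category.assoc] }

@[ext]
lemma hom_ext {D E : Dialg F G} {f g : D ⟶ E} (h : f.hom = g.hom) : f = g := Hom.ext h

@[simp] lemma id_hom (D : Dialg F G) : Hom.hom (𝟙 D) = 𝟙 D.X := rfl
@[simp] lemma comp_hom {D E E' : Dialg F G} (f : D ⟶ E) (g : E ⟶ E') :
    (f ≫ g).hom = f.hom ≫ g.hom := rfl

variable (F G) in
/-- The forgetful functor from dialgebras. -/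
abbrev forget : Dialg F G ⥤ W where
  obj D := D.X
  map f := f.hom

/-- Isomorphisms of dialgebras from isomorphisms of the underlying objects. -/
def mkIso {D E : Dialg F G} (e : D.X ≅ E.X)
    (h : ∀ i, (F i).map e.hom ≫ E.str i = D.str i ≫ (G i).map e.hom) : D ≅ E where
  hom := ⟨e.hom, h⟩
  inv := ⟨e.inv, fun i => by
    rw [← cancel_epi ((F i).map e.hom), ← Functor.map_comp_assoc, e.hom_inv_id, reassoc_of% (h i),
      ← Functor.map_comp, e.hom_inv_id]
    simp⟩
  hom_inv_id := by ext; simp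
  inv_hom_id := by ext; simp

instance : (forget F G).ReflectsIsomorphisms where
  reflects {D E} f hf := by
    have : IsIso f.hom := hf
    have h : f = (mkIso (asIso f.hom) f.comm).hom := rfl
    rw [h]
    infer_instance

section Colimit

variable {J : Type w} [Category.{w'} J] [∀ i, PreservesColimitsOfShape J (F i)]
  (D : J ⥤ Dialg F G) {c : Cocone (D ⋙ forget F G)} (hc : IsColimit c)

/-- The cocone defining the structure morphisms of a colimit of dialgebras. -/
def strCocone (D : J ⥤ Dialg F G) (c : Cocone (D ⋙ forget F G)) (i : I) :
    Cocone ((D ⋙ forget F G) ⋙ F i) :=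
  ⟨(G i).obj c.pt,
    { app := fun j => (D.obj j).str i ≫ (G i).map (c.ι.app j)
      naturality := fun j k f => by
        have h₁ := (D.map f).comm i
        have h₂ : (D.map f).hom ≫ c.ι.app k = c.ι.app j := c.w f
        refine Eq.trans ?_ (Category.comp_id _).symm
        change (F i).map (D.map f).hom ≫ (D.obj k).str i ≫ (G i).map (c.ι.app k) = _
        rw [reassoc_of% h₁, ← Functor.map_comp, h₂] }⟩

/-- The colimit of a diagram of dialgebras. -/
noncomputable abbrev colimitObj : Dialg F G where
  X := c.pt
  str i := (isColimitOfPreserves (F i) hc).desc (strCocone D c i)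

lemma map_comp_colimitObj_str (j : J) (i : I) :
    (F i).map (c.ι.app j) ≫ (colimitObj D hc).str i = (D.obj j).str i ≫ (G i).map (c.ι.app j) :=
  (isColimitOfPreserves (F i) hc).fac (strCocone D c i) j

/-- The colimit cocone of a diagram of dialgebras. -/
noncomputable abbrev colimitCocone : Cocone D :=
  ⟨colimitObj D hc,
    { app := fun j => ⟨c.ι.app j, map_comp_colimitObj_str D hc j⟩
      naturality := fun j k f => by ext; exact c.ι.naturality f }⟩

/-- The colimit cocone of a diagram of dialgebras is a colimit. -/
noncomputable def colimitCoconeIsColimit : IsColimit (colimitCocone D hc) where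
  desc s := ⟨hc.desc ((forget F G).mapCocone s), fun i =>
    (isColimitOfPreserves (F i) hc).hom_ext fun j => by
      have h := (s.ι.app j).comm i
      obtain ⟨d, hd⟩ : ∃ d : c.pt ⟶ s.pt.X, d = hc.desc ((forget F G).mapCocone s) := ⟨_, rfl⟩
      have h₁ : c.ι.app j ≫ d = (s.ι.app j).hom := by
        rw [hd]; exact hc.fac ((forget F G).mapCocone s) j
      have h₂ := map_comp_colimitObj_str D hc j i
      change (F i).map (c.ι.app j) ≫ (F i).map (hc.desc ((forget F G).mapCocone s)) ≫ s.pt.str i =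
        (F i).map (c.ι.app j) ≫ (colimitObj D hc).str i ≫
          (G i).map (hc.desc ((forget F G).mapCocone s))
      rw [← hd, ← Functor.map_comp_assoc, h₁]
      exact h.trans ((congrArg (_ ≫ ·) (by rw [← Functor.map_comp, h₁])).trans
        ((Category.assoc _ _ _).symm.trans ((congrArg (· ≫ (G i).map d) h₂.symm).trans
          (Category.assoc _ _ _))))⟩
  fac s j := by ext; exact hc.fac ((forget F G).mapCocone s) j
  uniq s m hm := by
    ext
    exact hc.uniq ((forget F G).mapCocone s) m.hom fun j => congrArg Hom.hom (hm j)

instance [HasColimitsOfShape J W] : HasColimitsOfShape J (Dialg F G) where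
  has_colimit D := ⟨⟨⟨_, colimitCoconeIsColimit D (colimit.isColimit _)⟩⟩⟩

instance [HasColimitsOfShape J W] : PreservesColimitsOfShape J (forget F G) where
  preservesColimit {D} := preservesColimit_of_preserves_colimit_cocone
    (colimitCoconeIsColimit D (colimit.isColimit _)) (colimit.isColimit (D ⋙ forget F G))

end Colimit

section Limit

variable {J : Type w} [Category.{w'} J] [∀ i, PreservesLimitsOfShape J (G i)]
  (D : J ⥤ Dialg F G) {c : Cone (D ⋙ forget F G)} (hc : IsLimit c)

/-- The cone defining the structure morphisms of a limit of dialgebras. -/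
def strCone (D : J ⥤ Dialg F G) (c : Cone (D ⋙ forget F G)) (i : I) :
    Cone ((D ⋙ forget F G) ⋙ G i) :=
  ⟨(F i).obj c.pt,
    { app := fun j => (F i).map (c.π.app j) ≫ (D.obj j).str i
      naturality := fun j k f => by
        have h₁ := (D.map f).comm i
        have h₂ : c.π.app j ≫ (D.map f).hom = c.π.app k := c.w f
        refine (Category.id_comp _).trans ?_
        change _ = ((F i).map (c.π.app j) ≫ (D.obj j).str i) ≫ (G i).map (D.map f).hom
        rw [Category.assoc, ← h₁, ← Functor.map_comp_assoc, h₂] }⟩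

/-- The limit of a diagram of dialgebras. -/
noncomputable abbrev limitObj : Dialg F G where
  X := c.pt
  str i := (isLimitOfPreserves (G i) hc).lift (strCone D c i)

lemma limitObj_str_comp_map (j : J) (i : I) :
    (limitObj D hc).str i ≫ (G i).map (c.π.app j) = (F i).map (c.π.app j) ≫ (D.obj j).str i :=
  (isLimitOfPreserves (G i) hc).fac (strCone D c i) j

/-- The limit cone of a diagram of dialgebras. -/
noncomputable abbrev limitCone : Cone D :=
  ⟨limitObj D hc,
    { app := fun j => ⟨c.π.app j, fun i => (limitObj_str_comp_map D hc j i).symm⟩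
      naturality := fun j k f => by ext; exact c.π.naturality f }⟩

/-- The limit cone of a diagram of dialgebras is a limit. -/
noncomputable def limitConeIsLimit : IsLimit (limitCone D hc) where
  lift s := ⟨hc.lift ((forget F G).mapCone s), fun i =>
    (isLimitOfPreserves (G i) hc).hom_ext fun j => by
      have h := (s.π.app j).comm i
      obtain ⟨d, hd⟩ : ∃ d : s.pt.X ⟶ c.pt, d = hc.lift ((forget F G).mapCone s) := ⟨_, rfl⟩
      have h₁ : d ≫ c.π.app j = (s.π.app j).hom := by
        rw [hd]; exact hc.fac ((forget F G).mapCone s) j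
      have h₂ := limitObj_str_comp_map D hc j i
      change ((F i).map (hc.lift ((forget F G).mapCone s)) ≫ (limitObj D hc).str i) ≫
        (G i).map (c.π.app j) =
          (s.pt.str i ≫ (G i).map (hc.lift ((forget F G).mapCone s))) ≫ (G i).map (c.π.app j)
      rw [← hd, Category.assoc, Category.assoc, h₂, ← Functor.map_comp, ← Functor.map_comp_assoc, h₁, h]
      rfl⟩
  fac s j := by ext; exact hc.fac ((forget F G).mapCone s) j
  uniq s m hm := by
    ext
    exact hc.uniq ((forget F G).mapCone s) m.hom fun j => congrArg Hom.hom (hm j)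

instance [HasLimitsOfShape J W] : HasLimitsOfShape J (Dialg F G) where
  has_limit D := ⟨⟨⟨_, limitConeIsLimit D (limit.isLimit _)⟩⟩⟩

instance [HasLimitsOfShape J W] : PreservesLimitsOfShape J (forget F G) where
  preservesLimit {D} := preservesLimit_of_preserves_limit_cone
    (limitConeIsLimit D (limit.isLimit _)) (limit.isLimit (D ⋙ forget F G))

end Limit

section Equations

variable {I' : Type} {F' G' : I' → W ⥤ V}

/-- The dialgebras that satisfy a family of equations between natural operations. -/
def Satisfies (s t : ∀ e, forget F G ⋙ F' e ⟶ forget F G ⋙ G' e) :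
    ObjectProperty (Dialg F G) :=
  fun D => ∀ e, (s e).app D = (t e).app D

variable (s t : ∀ e, forget F G ⋙ F' e ⟶ forget F G ⋙ G' e)

instance satisfies_isClosedUnderIsomorphisms :
    (Satisfies s t).IsClosedUnderIsomorphisms where
  of_iso {D E} i hD e := by
    rw [← cancel_epi ((forget F G ⋙ F' e).map i.hom), (s e).naturality, (t e).naturality, hD e]

/-- The two sides of an equation are maps out of `F' e` of the colimit, hence are tested on the
legs, where naturality reduces them to the equations in the diagram. Only the sources have to
preserve the colimit. -/
lemma satisfies_isClosedUnderColimitsOfShape {J : Type w} [Category.{w'} J]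
    [HasColimitsOfShape J W] [∀ i, PreservesColimitsOfShape J (F i)]
    [∀ e, PreservesColimitsOfShape J (F' e)] :
    (Satisfies s t).IsClosedUnderColimitsOfShape J where
  colimitsOfShape_le := by
    rintro D ⟨hD⟩ e
    apply (isColimitOfPreserves (forget F G ⋙ F' e) hD.isColimit).hom_ext
    intro j
    exact ((s e).naturality _).trans ((congrArg (· ≫ _) (hD.prop_diag_obj j e)).trans
      ((t e).naturality (hD.ι.app j)).symm)

/-- Dually, the equations are tested on the projections of the limit, so only the targets have to
preserve it. -/
lemma satisfies_isClosedUnderLimitsOfShape {J : Type w} [Category.{w'} J]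
    [HasLimitsOfShape J W] [∀ i, PreservesLimitsOfShape J (G i)]
    [∀ e, PreservesLimitsOfShape J (G' e)] :
    (Satisfies s t).IsClosedUnderLimitsOfShape J where
  limitsOfShape_le := by
    rintro D ⟨hD⟩ e
    apply (isLimitOfPreserves (forget F G ⋙ G' e) hD.isLimit).hom_ext
    intro j
    exact ((s e).naturality _).symm.trans ((congrArg (_ ≫ ·) (hD.prop_diag_obj j e)).trans
      ((t e).naturality (hD.π.app j)))

/-- The dialgebras satisfying given equations whose underlying objects lie in an essentially small
class form an essentially small class. -/
lemma essentiallySmall_satisfies {W : Type u₁} [Category.{v} W] {F G : I → W ⥤ V}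
    (Q : ObjectProperty (Dialg F G)) [Q.IsClosedUnderIsomorphisms] (P : ObjectProperty W)
    [ObjectProperty.EssentiallySmall.{v} P] :
    ObjectProperty.EssentiallySmall.{v} (P.inverseImage (Q.ι ⋙ forget F G)) := by
  obtain ⟨P₀, _, h₁, h₂⟩ := ObjectProperty.EssentiallySmall.exists_small_le.{v} P
  have : Small.{v} (Subtype P₀) := inferInstanceAs (ObjectProperty.Small.{v} P₀)
  -- A small set of carriers and, on each, a small set of structures, as the hom-sets of `V` lie in
  -- universe `v`.
  let T := Σ w : Subtype P₀, { a : ∀ i, (F i).obj w.1 ⟶ (G i).obj w.1 // Q ⟨w.1, a⟩ }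
  refine ⟨ObjectProperty.ofObj (fun t : T => (⟨⟨t.1.1, t.2.1⟩, t.2.2⟩ : Q.FullSubcategory)),
    inferInstance, ?_⟩
  rintro ⟨D, hD⟩ hP
  obtain ⟨w, hw, ⟨e⟩⟩ := h₂ _ hP
  let E : Dialg F G := ⟨w, fun i => (F i).map e.inv ≫ D.str i ≫ (G i).map e.hom⟩
  let e' : D ≅ E := mkIso e fun i => by
    simp only [E]
    rw [← Functor.map_comp_assoc, e.hom_inv_id]
    exact (congrArg (· ≫ _) (CategoryTheory.Functor.map_id _ _)).trans (Category.id_comp _)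
  have hE : Q E := Q.prop_of_iso e' hD
  exact ⟨_, ⟨⟨⟨w, hw⟩, ⟨E.str, hE⟩⟩⟩, ⟨Q.isoMk e'⟩⟩

end Equations

end Dialg

end Dialgebra

/-! ### Factoring maps out of small objects through small stages -/

section Stagewise

open Limits

universe w v₁ u₁

variable {W : Type u₁} [Category.{v₁} W] {V : Type u} [Category.{v} V]

/-- Any two objects over `x` that satisfy `P` map to a third one. -/
def IsUpwardDirected (P : ObjectProperty W) : Prop :=
  ∀ ⦃x c c' : W⦄, P c → P c' → ∀ (u : c ⟶ x) (u' : c' ⟶ x),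
    ∃ (d : W) (_ : P d) (a : c ⟶ d) (a' : c' ⟶ d) (w : d ⟶ x), a ≫ w = u ∧ a' ≫ w = u'

lemma isUpwardDirected_of_isClosedUnder [HasBinaryCoproducts W] (P : ObjectProperty W)
    [P.IsClosedUnderColimitsOfShape (Discrete WalkingPair)] : IsUpwardDirected P :=
  fun _ c c' hc hc' u u' => ⟨c ⨿ c', P.prop_colimit _ (by rintro ⟨_ | _⟩ <;> assumption),
    coprod.inl, coprod.inr, coprod.desc u u',
    coprod.inl_desc _ _, coprod.inr_desc _ _⟩

/-- The functor `H` takes the canonical diagram of the objects over `x` that satisfy `P` to a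
diagram through which morphisms from objects satisfying `Q` to `H x` factor, essentially
uniquely. -/
structure IsStagewise (P : ObjectProperty W) (Q : ObjectProperty V) (H : W ⥤ V) : Prop where
  exists_hom {x : W} {p : V} (hp : Q p) (f : p ⟶ H.obj x) :
    ∃ (c : W) (_ : P c) (u : c ⟶ x) (g : p ⟶ H.obj c), g ≫ H.map u = f
  exists_eq {x c : W} (hc : P c) (u : c ⟶ x) {p : V} (hp : Q p) (g g' : p ⟶ H.obj c)
    (h : g ≫ H.map u = g' ≫ H.map u) :
    ∃ (d : W) (_ : P d) (a : c ⟶ d) (w : d ⟶ x), a ≫ w = u ∧ g ≫ H.map a = g' ≫ H.map a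

namespace IsStagewise

variable {P : ObjectProperty W} {Q : ObjectProperty V} {H : W ⥤ V}

lemma exists_hom_over (h : IsStagewise P Q H) (hP : IsUpwardDirected P) {x c : W} (hc : P c)
    (u : c ⟶ x) {p : V} (hp : Q p) (f : p ⟶ H.obj x) :
    ∃ (d : W) (_ : P d) (a : c ⟶ d) (w : d ⟶ x) (g : p ⟶ H.obj d),
      a ≫ w = u ∧ g ≫ H.map w = f := by
  obtain ⟨c', hc', u', g, rfl⟩ := h.exists_hom hp f
  obtain ⟨d, hd, a, a', w, rfl, rfl⟩ := hP hc hc' u u'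
  exact ⟨d, hd, a, w, g ≫ H.map a', rfl, by simp⟩

/-- Realizes a factorization of `H.map (f ≫ u)` through an object `q` of `V` at a stage coming from
`W`: `exists_hom` moves `q ⟶ H x` to a stage, and `exists_eq` then forces the triangle to commute.
-/
lemma exists_refinement (h : IsStagewise P Q H) (hP : IsUpwardDirected P) {x c c₁ : W}
    (hc : Q (H.obj c)) (hc₁ : P c₁) (f : c ⟶ c₁) (u : c₁ ⟶ x) {q : V} (hq : Q q)
    (a : H.obj c ⟶ q) (w : q ⟶ H.obj x) (haw : a ≫ w = H.map (f ≫ u)) :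
    ∃ (d : W) (_ : P d) (b : c₁ ⟶ d) (w' : d ⟶ x) (k : q ⟶ H.obj d),
      b ≫ w' = u ∧ a ≫ k = H.map (f ≫ b) := by
  obtain ⟨d, hd, b, w', g, rfl, rfl⟩ := h.exists_hom_over hP hc₁ u hq w
  obtain ⟨d', hd', b', w'', rfl, e⟩ := h.exists_eq hd w' hc (a ≫ g) (H.map (f ≫ b)) (by
    rw [Category.assoc, haw, ← H.map_comp, Category.assoc])
  exact ⟨d', hd', b ≫ b', w'', g ≫ H.map b', by simp, by
    rw [← Category.assoc, e, ← H.map_comp, Category.assoc]⟩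

lemma const (hP : ∀ x : W, ∃ (c : W) (_ : P c), Nonempty (c ⟶ x)) (p : V) :
    IsStagewise P Q ((Functor.const W).obj p) where
  exists_hom {x} _ _ f := by
    obtain ⟨c, hc, ⟨u⟩⟩ := hP x
    exact ⟨c, hc, u, f, Category.comp_id _⟩
  exists_eq {x c} hc u _ _ _ _ e := ⟨c, hc, 𝟙 c, u, Category.id_comp _, e⟩

/-- The canonical diagram of presentable objects over `y` is `κ`-filtered and `T` preserves its
colimit, so the two properties are those of a presentable object mapping to a filtered colimit. -/
lemma of_preservesColimits {V : Type u} [Category.{v} V] {V' : Type*} [Category.{v} V']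
    (κ : Cardinal.{v})
    [Fact κ.IsRegular] [IsCardinalLocallyPresentable V κ] (T : V ⥤ V')
    [PreservesColimitsOfSize.{v, v} T] :
    IsStagewise (isCardinalPresentable V κ) (isCardinalPresentable V' κ) T := by
  let P := isCardinalPresentable V κ
  have (y : V) : PreservesColimitsOfShape (CostructuredArrow P.ι y) T :=
    preservesColimitsOfShape_of_equiv (equivSmallModel.{v} (CostructuredArrow P.ι y)).symm T
  have hc (y : V) : IsColimit (T.mapCocone (canonicalCocone P y)) :=
    isColimitOfPreserves T ((IsDenseProperty.of_isDense P).nonempty_isColimit y).some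
  constructor
  · intro y p hp f
    have : IsCardinalPresentable p κ := hp
    obtain ⟨j, g, hg⟩ := IsCardinalPresentable.exists_hom_of_isColimit κ (hc y) f
    exact ⟨_, j.left.property, j.hom, g, hg⟩
  · intro y q hq u p hp g g' e
    have : IsCardinalPresentable p κ := hp
    obtain ⟨j, a, ha⟩ := IsCardinalPresentable.exists_eq_of_isColimit' κ (hc y)
      (i := canonicalArrow q hq u) g g' e
    exact ⟨_, j.left.property, a.left.hom, j.hom, CostructuredArrow.w a, ha⟩

/-- The two tensor factors are treated one after the other, since stages are known for the tensor
product in each variable separately. Directedness then merges the stages found for `H` and `H'` into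
one. -/
lemma tensor [MonoidalCategory V] (h : IsStagewise P Q H) {H' : W ⥤ V} (h' : IsStagewise P Q H')
    (hP : IsUpwardDirected P) (hH : P ≤ Q.inverseImage H) (hH' : P ≤ Q.inverseImage H')
    (hl : ∀ y, IsStagewise Q Q (tensorLeft y)) (hr : ∀ y, IsStagewise Q Q (tensorRight y)) :
    IsStagewise P Q (H ⊗ H') where
  exists_hom {x} p hp f := by
    obtain ⟨q, hq, u, g, rfl⟩ := (hr (H'.obj x)).exists_hom hp f
    obtain ⟨q', hq', u', g', rfl⟩ := (hl q).exists_hom hp g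
    obtain ⟨c, hc, a, k, rfl⟩ := h.exists_hom hq u
    obtain ⟨d, hd, b, w, k', rfl, rfl⟩ := h'.exists_hom_over hP hc a hq' u'
    refine ⟨d, hd, w, g' ≫ ((k ≫ H.map b) ⊗ₘ k'), ?_⟩
    change (g' ≫ ((k ≫ H.map b) ⊗ₘ k')) ≫ (H.map w ⊗ₘ H'.map w) =
      (g' ≫ q ◁ (k' ≫ H'.map w)) ≫ (k ≫ H.map (b ≫ w)) ▷ _
    rw [Category.assoc, tensorHom_comp_tensorHom, Category.assoc, Category.assoc, ← H.map_comp,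
      tensorHom_def']
  exists_eq {x c} hc u p hp g g' e := by
    change p ⟶ H.obj c ⊗ H'.obj c at g g'
    change g ≫ (H.map u ⊗ₘ H'.map u) = g' ≫ (H.map u ⊗ₘ H'.map u) at e
    -- The equality is first achieved in `V`, after maps `a : H c ⟶ q` and `a' : H' c ⟶ q'` that
    -- need not come from `W`; the refinements below dominate both by one map of `W`.
    obtain ⟨q, hq, a, w, haw, e₁⟩ := (hr (H'.obj x)).exists_eq (hH _ hc) (H.map u) hp
      (g ≫ H.obj c ◁ H'.map u) (g' ≫ H.obj c ◁ H'.map u) (by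
        change (g ≫ H.obj c ◁ H'.map u) ≫ H.map u ▷ _ = (g' ≫ H.obj c ◁ H'.map u) ≫ H.map u ▷ _
        rw [Category.assoc, Category.assoc, ← tensorHom_def', e])
    change (g ≫ H.obj c ◁ H'.map u) ≫ a ▷ _ = (g' ≫ H.obj c ◁ H'.map u) ≫ a ▷ _ at e₁
    simp only [Category.assoc, whisker_exchange] at e₁
    obtain ⟨q', hq', a', w', haw', e₂⟩ := (hl q).exists_eq (hH' _ hc) (H'.map u) hp
      (g ≫ a ▷ _) (g' ≫ a ▷ _) (by simpa using e₁)
    change (g ≫ a ▷ _) ≫ q ◁ a' = (g' ≫ a ▷ _) ≫ q ◁ a' at e₂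
    obtain ⟨d, hd, b, z, k, rfl, hk⟩ := h.exists_refinement hP (hH _ hc) hc (𝟙 c) u hq a w
      (by simpa using haw)
    obtain ⟨d', hd', b', z', k', rfl, hk'⟩ :=
      h'.exists_refinement hP (hH' _ hc) hd b z hq' a' w' haw'
    rw [Category.id_comp] at hk
    refine ⟨d', hd', b ≫ b', z', Category.assoc _ _ _, ?_⟩
    have key : (H ⊗ H').map (b ≫ b') = a ▷ _ ≫ q ◁ a' ≫ ((k ≫ H.map b') ⊗ₘ k') := by
      change H.map (b ≫ b') ⊗ₘ H'.map (b ≫ b') = _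
      rw [← hk', H.map_comp, ← hk, ← id_tensorHom, tensorHom_comp_tensorHom, ← tensorHom_id,
        tensorHom_comp_tensorHom]
      simp
    rw [key]
    simpa using e₂ =≫ ((k ≫ H.map b') ⊗ₘ k')

end IsStagewise

/-- Conditions that can each be met by enlarging the stage, and persist under further enlargement,
can be met simultaneously when there are finitely many. -/
lemma exists_over_forall {P : ObjectProperty W} {I : Type*} [Finite I] {x c : W}
    (u : c ⟶ x) (hc : P c) (Φ : I → ∀ d : W, (c ⟶ d) → (d ⟶ x) → Prop)
    (mono : ∀ i d a w, Φ i d a w → ∀ d' (b : d ⟶ d') w', b ≫ w' = w → Φ i d' (a ≫ b) w')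
    (h : ∀ i d, P d → ∀ (a : c ⟶ d) (w : d ⟶ x), a ≫ w = u →
      ∃ (d' : W) (_ : P d') (b : d ⟶ d') (w' : d' ⟶ x), b ≫ w' = w ∧ Φ i d' (a ≫ b) w') :
    ∃ (d : W) (_ : P d) (a : c ⟶ d) (w : d ⟶ x), a ≫ w = u ∧ ∀ i, Φ i d a w := by
  classical
  have := Fintype.ofFinite I
  suffices ∀ s : Finset I, ∃ (d : W) (_ : P d) (a : c ⟶ d) (w : d ⟶ x),
      a ≫ w = u ∧ ∀ i ∈ s, Φ i d a w by
    obtain ⟨d, hd, a, w, e, hi⟩ := this Finset.univ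
    exact ⟨d, hd, a, w, e, fun i => hi i (Finset.mem_univ i)⟩
  intro s
  induction s using Finset.induction_on with
  | empty => exact ⟨c, hc, 𝟙 c, u, Category.id_comp _, by simp⟩
  | insert i s _ ih =>
    obtain ⟨d, hd, a, w, e, hi⟩ := ih
    obtain ⟨d', hd', b, w', e', hb⟩ := h i d hd a w e
    refine ⟨d', hd', a ≫ b, w', by rw [Category.assoc, e', e], fun j hj => ?_⟩
    obtain rfl | hj := Finset.mem_insert.1 hj
    · exact hb
    · exact mono j d a w (hi j hj) d' b w' e'

end Stagewise

/-! ### Colimits of sequences in elementary terms -/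

section Sequential

open Limits

universe v₁ u₁ v₂ u₂

variable {W : Type u₁} [Category.{v₁} W]

/-- The morphisms `j n` exhibit `X` as colimit of the sequence of the morphisms `m n`. -/
structure IsSeqColimit {c : ℕ → W} (m : ∀ n, c n ⟶ c (n + 1)) {X : W} (j : ∀ n, c n ⟶ X) :
    Prop where
  w (n : ℕ) : m n ≫ j (n + 1) = j n
  hom_ext {T : W} {f g : X ⟶ T} (h : ∀ n, j n ≫ f = j n ≫ g) : f = g
  exists_desc {T : W} (φ : ∀ n, c n ⟶ T) (hφ : ∀ n, m n ≫ φ (n + 1) = φ n) :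
    ∃ f : X ⟶ T, ∀ n, j n ≫ f = φ n

namespace IsSeqColimit

lemma of_isColimit {F : ℕ ⥤ W} {c : Cocone F} (hc : IsColimit c) :
    IsSeqColimit (fun n => F.map (homOfLE n.le_succ)) c.ι.app where
  w n := c.w _
  hom_ext := hc.hom_ext
  exists_desc {T} φ hφ :=
    ⟨hc.desc ⟨T, NatTrans.ofSequence φ fun n => by
      rw [Functor.const_obj_map]; exact (hφ n).trans (Category.comp_id _).symm⟩,
      fun n => hc.fac _ n⟩

variable {c : ℕ → W} {m : ∀ n, c n ⟶ c (n + 1)} {X : W} {j : ∀ n, c n ⟶ X}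

/-- The identification of the apex is an equation, so that it can be substituted away and the
general results on `IsColimit` become available. -/
lemma exists_isColimit (h : IsSeqColimit m j) :
    ∃ t : Cocone (Functor.ofSequence m), ∃ e : t.pt = X, Nonempty (IsColimit t) ∧
      ∀ n, t.ι.app n ≫ eqToHom e = j n := by
  let t : Cocone (Functor.ofSequence m) := ⟨X, NatTrans.ofSequence j fun n => by
    rw [Functor.ofSequence_map_homOfLE_succ, Functor.const_obj_map]
    exact (h.w n).trans (Category.comp_id _).symm⟩
  have hd (s : Cocone (Functor.ofSequence m)) := h.exists_desc s.ι.app fun n => by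
    rw [← Functor.ofSequence_map_homOfLE_succ m n]; exact s.w _
  choose d hd using hd
  exact ⟨t, rfl, ⟨⟨d, hd, fun s f hf => h.hom_ext fun n => (hf n).trans (hd s n).symm⟩⟩,
    fun n => Category.comp_id _⟩

lemma map {W' : Type u₂} [Category.{v₂} W'] (h : IsSeqColimit m j) (H : W ⥤ W')
    [PreservesColimitsOfShape ℕ H] :
    IsSeqColimit (fun n => H.map (m n)) (fun n => H.map (j n)) := by
  obtain ⟨t, rfl, ⟨ht⟩, hj⟩ := h.exists_isColimit
  obtain rfl : t.ι.app = j := funext fun n => (Category.comp_id _).symm.trans (hj n)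
  have h' := of_isColimit (isColimitOfPreserves H ht)
  have e : (fun n => (Functor.ofSequence m ⋙ H).map (homOfLE n.le_succ)) = fun n => H.map (m n) :=
    funext fun n => congrArg H.map (Functor.ofSequence_map_homOfLE_succ m n)
  rw [e] at h'
  exact h'

lemma prop (h : IsSeqColimit m j) (P : ObjectProperty W) [P.IsClosedUnderColimitsOfShape ℕ]
    (hc : ∀ n, P (c n)) : P X := by
  obtain ⟨t, rfl, ⟨ht⟩, -⟩ := h.exists_isColimit
  exact P.prop_of_isColimit ht hc

lemma exists_of_hasColimit [HasColimitsOfShape ℕ W] (m : ∀ n, c n ⟶ c (n + 1)) :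
    ∃ (X : W) (j : ∀ n, c n ⟶ X), IsSeqColimit m j := by
  have h' := of_isColimit (colimit.isColimit (Functor.ofSequence m))
  have e : (fun n => (Functor.ofSequence m).map (homOfLE n.le_succ)) = m :=
    funext fun n => Functor.ofSequence_map_homOfLE_succ m n
  rw [e] at h'
  exact ⟨_, _, h'⟩

end IsSeqColimit

end Sequential

/-! ### Small dialgebras over a given one -/

section Stage

open Limits

universe v₁ u₁

variable {W : Type u₁} [Category.{v₁} W] {V : Type u} [Category.{v} V] {I : Type}

namespace Dialg

variable {F G : I → W ⥤ V}

/-- An approximation of a dialgebra by two objects of `W` over it and by structure morphisms from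
the first one to the second one. -/
structure Stage (P : ObjectProperty W) (x : Dialg F G) where
  /-- The source. -/
  c₀ : W
  /-- The target. -/
  c₁ : W
  prop₁ : P c₁
  /-- The transition. -/
  m : c₀ ⟶ c₁
  /-- The morphism to `x`. -/
  u : c₁ ⟶ x.X
  /-- The structure morphisms. -/
  a (i : I) : (F i).obj c₀ ⟶ (G i).obj c₁
  a_map (i : I) : a i ≫ (G i).map u = (F i).map (m ≫ u) ≫ x.str i

namespace Stage

variable {P : ObjectProperty W} {Q : ObjectProperty V} {x : Dialg F G}

/-- The operations of `x` restricted to `F i c₁` factor through a later stage. They agree there with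
the operations already chosen on `c₀` only after mapping to `x`; since `F i c₀` is small, one more
enlargement makes them agree. -/
lemma exists_next [Finite I] (hP : IsUpwardDirected P) (hF : ∀ i, P ≤ Q.inverseImage (F i))
    (hG : ∀ i, IsStagewise P Q (G i)) (S : Stage P x) (h₀ : P S.c₀) :
    ∃ (d : W) (_ : P d) (b : S.c₁ ⟶ d) (w : d ⟶ x.X), b ≫ w = S.u ∧
      ∀ i, ∃ a : (F i).obj S.c₁ ⟶ (G i).obj d, a ≫ (G i).map w = (F i).map S.u ≫ x.str i ∧
        (F i).map S.m ≫ a = S.a i ≫ (G i).map b := by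
  refine exists_over_forall S.u S.prop₁ (fun i d b w => ∃ a : (F i).obj S.c₁ ⟶ (G i).obj d,
    a ≫ (G i).map w = (F i).map S.u ≫ x.str i ∧ (F i).map S.m ≫ a = S.a i ≫ (G i).map b) ?_ ?_
  · rintro i d b w ⟨a, h₁, h₂⟩ d' b' w' rfl
    exact ⟨a ≫ (G i).map b', by simpa using h₁, by simp [reassoc_of% h₂]⟩
  · intro i d hd b w hb
    obtain ⟨d', hd', b', w', g, rfl, hg⟩ :=
      (hG i).exists_hom_over hP hd w (hF i _ S.prop₁) ((F i).map S.u ≫ x.str i)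
    obtain ⟨d'', hd'', b'', w'', rfl, e⟩ := (hG i).exists_eq hd' w' (hF i _ h₀)
      ((F i).map S.m ≫ g) (S.a i ≫ (G i).map (b ≫ b')) (by
        rw [Category.assoc, hg, Category.assoc, ← Functor.map_comp, Category.assoc, hb,
          S.a_map, Functor.map_comp, Category.assoc])
    refine ⟨d'', hd'', b' ≫ b'', w'', Category.assoc _ _ _, g ≫ (G i).map b'', ?_, ?_⟩
    · rw [← hg, Functor.map_comp, Category.assoc]
    · rw [← Category.assoc, e, Category.assoc, ← Functor.map_comp, Category.assoc]

/-- Repeating the enlargement gives a chain whose operations go from each stage to the next. In the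
colimit the shift disappears, because `F i` preserves sequential colimits. -/
lemma exists_dialg [Finite I] [HasColimitsOfShape ℕ W] [P.IsClosedUnderColimitsOfShape ℕ]
    [∀ i, PreservesColimitsOfShape ℕ (F i)]
    (hP : IsUpwardDirected P) (hF : ∀ i, P ≤ Q.inverseImage (F i))
    (hG : ∀ i, IsStagewise P Q (G i)) (S : Stage P x) (h₀ : P S.c₀) :
    ∃ (D : Dialg F G) (_ : P D.X) (f : D ⟶ x) (w : S.c₁ ⟶ D.X), w ≫ f.hom = S.u ∧
      ∀ i, S.a i ≫ (G i).map w = (F i).map (S.m ≫ w) ≫ D.str i := by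
  have H (S : { S : Stage P x // P S.c₀ }) := exists_next hP hF hG S.1 S.2
  choose d hd b w hbw a ha₁ ha₂ using H
  let next (S : { S : Stage P x // P S.c₀ }) : { S : Stage P x // P S.c₀ } :=
    ⟨⟨S.1.c₁, d S, hd S, b S, w S, a S, fun i => by rw [hbw S]; exact ha₁ S i⟩, S.1.prop₁⟩
  let T (n : ℕ) : { S : Stage P x // P S.c₀ } := Nat.rec ⟨S, h₀⟩ (fun _ => next) n
  let c (n : ℕ) : W := (T n).1.c₁
  let m (n : ℕ) : c n ⟶ c (n + 1) := b (T n)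
  have hu (n : ℕ) : m n ≫ (T (n + 1)).1.u = (T n).1.u := hbw (T n)
  let α (n : ℕ) (i : I) : (F i).obj (c n) ⟶ (G i).obj (c (n + 1)) := a (T n) i
  have hα₁ (n : ℕ) (i : I) : α n i ≫ (G i).map (T (n + 1)).1.u =
    (F i).map (T n).1.u ≫ x.str i := ha₁ (T n) i
  have hα₂ (n : ℕ) (i : I) : (F i).map (m n) ≫ α (n + 1) i = α n i ≫ (G i).map (m (n + 1)) :=
    ha₂ (T (n + 1)) i
  have hα₀ (i : I) : (F i).map S.m ≫ α 0 i = S.a i ≫ (G i).map (m 0) := ha₂ (T 0) i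
  obtain ⟨X, j, hX⟩ := IsSeqColimit.exists_of_hasColimit m
  -- The operation `α n` lands in stage `n + 1`, hence the shifted leg. The `G i` need not preserve
  -- the colimit.
  have hs (i : I) := (hX.map (F i)).exists_desc (fun n => α n i ≫ (G i).map (j (n + 1)))
    fun n => by
      rw [reassoc_of% (hα₂ n i), ← Functor.map_comp]
      exact congrArg (fun k => α n i ≫ (G i).map k) (hX.w (n + 1))
  choose s hs using hs
  obtain ⟨f, hf⟩ := hX.exists_desc (fun n => (T n).1.u) hu
  refine ⟨⟨X, s⟩, hX.prop P fun n => (T n).1.prop₁, ⟨f, fun i => ?_⟩, j 0, hf 0, fun i => ?_⟩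
  · refine (hX.map (F i)).hom_ext fun n => ?_
    change _ = (F i).map (j n) ≫ s i ≫ (G i).map f
    rw [reassoc_of% (hs i n), ← Functor.map_comp_assoc, ← Functor.map_comp, hf, hf, hα₁]
  · change _ = (F i).map (S.m ≫ j 0) ≫ s i
    rw [Functor.map_comp, Category.assoc, hs, reassoc_of% hα₀, ← Functor.map_comp]
    exact congrArg (fun k => S.a i ≫ (G i).map k) (hX.w 0).symm

end Stage

variable {P : ObjectProperty W} {Q : ObjectProperty V} {x : Dialg F G}

section

variable [Finite I] [HasColimitsOfShape ℕ W] [P.IsClosedUnderColimitsOfShape ℕ]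
    [∀ i, PreservesColimitsOfShape ℕ (F i)]
    (hP : IsUpwardDirected P) (hF : ∀ i, P ≤ Q.inverseImage (F i))
    (hG : ∀ i, IsStagewise P Q (G i))

include hP hF hG

/-- The chain is started from the operations of `D`, so that the colimit extends `D` as a dialgebra.
With `c` a quotient of `D.X`, this imposes on `D` identifications valid in `x`. -/
lemma exists_dialg_of_hom {D : Dialg F G} (hD : P D.X) (f : D ⟶ x) {c : W} (hc : P c)
    (b : D.X ⟶ c) (u : c ⟶ x.X) (hbu : b ≫ u = f.hom) :
    ∃ (D' : Dialg F G) (_ : P D'.X) (g : D ⟶ D') (f' : D' ⟶ x) (w : c ⟶ D'.X),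
      w ≫ f'.hom = u ∧ b ≫ w = g.hom ∧ g ≫ f' = f := by
  let S : Stage P x := ⟨D.X, c, hc, b, u, fun i => D.str i ≫ (G i).map b, fun i => by
    rw [Category.assoc, ← Functor.map_comp, hbu, f.comm]⟩
  obtain ⟨D', hD', f', w, hw, h⟩ := S.exists_dialg hP hF hG hD
  refine ⟨D', hD', ⟨b ≫ w, fun i => ?_⟩, f', w, hw, rfl, ?_⟩
  · rw [Functor.map_comp (G i), ← Category.assoc]; exact (h i).symm
  · ext
    change (b ≫ w) ≫ f'.hom = _
    rw [Category.assoc, hw]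
    exact hbu

lemma exists_dialg_of_obj {c : W} (hc : P c) (u : c ⟶ x.X) :
    ∃ (D' : Dialg F G) (_ : P D'.X) (f' : D' ⟶ x) (w : c ⟶ D'.X), w ≫ f'.hom = u := by
  obtain ⟨d, hd, b, w, hb, h⟩ : ∃ (d : W) (_ : P d) (b : c ⟶ d) (w : d ⟶ x.X), b ≫ w = u ∧
      ∀ i, ∃ a : (F i).obj c ⟶ (G i).obj d, a ≫ (G i).map w = (F i).map u ≫ x.str i := by
    refine exists_over_forall u hc (fun i d b w => ∃ a : (F i).obj c ⟶ (G i).obj d,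
      a ≫ (G i).map w = (F i).map u ≫ x.str i) ?_ ?_
    · rintro i d b w ⟨a, h₁⟩ d' b' w' rfl
      exact ⟨a ≫ (G i).map b', by simpa using h₁⟩
    · intro i d hd b w hb
      obtain ⟨d', hd', b', w', g, rfl, hg⟩ :=
        (hG i).exists_hom_over hP hd w (hF i _ hc) ((F i).map u ≫ x.str i)
      exact ⟨d', hd', b', w', rfl, g, hg⟩
  choose a ha using h
  obtain ⟨D', hD', f', w', hw', -⟩ := Stage.exists_dialg hP hF hG
    (⟨c, d, hd, b, w, a, fun i => by rw [ha, hb]⟩ : Stage P x) hc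
  exact ⟨D', hD', f', b ≫ w', by rw [Category.assoc, hw', hb]⟩

variable {I' : Type} [Finite I'] {F' G' : I' → W ⥤ V}
  (hF' : ∀ e, P ≤ Q.inverseImage (F' e)) (hG' : ∀ e, IsStagewise P Q (G' e))
  {s t : ∀ e, forget F G ⋙ F' e ⟶ forget F G ⋙ G' e} (hx : Satisfies s t x)

include hF' hG' hx

/-- By naturality both sides of an equation on `D` agree after mapping to `x`, which satisfies it.
As `F' e` of `D.X` is small, they already agree at some stage, and that stage is completed to a
dialgebra under `D`. -/
lemma exists_equalizing {D : Dialg F G} (hD : P D.X) (f : D ⟶ x) :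
    ∃ (D' : Dialg F G) (_ : P D'.X) (g : D ⟶ D') (f' : D' ⟶ x),
      g ≫ f' = f ∧ ∀ e, (s e).app D ≫ (G' e).map g.hom = (t e).app D ≫ (G' e).map g.hom := by
  obtain ⟨d, hd, b, w, hb, h⟩ : ∃ (d : W) (_ : P d) (b : D.X ⟶ d) (w : d ⟶ x.X), b ≫ w = f.hom ∧
      ∀ e, (s e).app D ≫ (G' e).map b = (t e).app D ≫ (G' e).map b := by
    refine exists_over_forall f.hom hD
      (fun e d b w => (s e).app D ≫ (G' e).map b = (t e).app D ≫ (G' e).map b) ?_ ?_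
    · rintro e d b w h d' b' w' rfl
      change (s e).app D ≫ (G' e).map (b ≫ b') = (t e).app D ≫ (G' e).map (b ≫ b')
      rw [Functor.map_comp]
      exact (Category.assoc _ _ _).symm.trans ((congrArg (· ≫ _) h).trans (Category.assoc _ _ _))
    · intro e d hd b w hb
      have h : (s e).app D ≫ (G' e).map f.hom = (t e).app D ≫ (G' e).map f.hom :=
        ((s e).naturality f).symm.trans ((congrArg (_ ≫ ·) (hx e)).trans ((t e).naturality f))
      obtain ⟨d', hd', b', w', rfl, h'⟩ := (hG' e).exists_eq hd w (hF' e _ hD)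
        ((s e).app D ≫ (G' e).map b) ((t e).app D ≫ (G' e).map b) (by
          refine (Category.assoc _ _ _).trans (Eq.trans ?_ (Category.assoc _ _ _).symm)
          rw [← Functor.map_comp, hb]
          exact h)
      refine ⟨d', hd', b', w', rfl, ?_⟩
      rw [Functor.map_comp]
      exact (Category.assoc _ _ _).symm.trans (h'.trans (Category.assoc _ _ _))
  obtain ⟨D', hD', g, f', w', hw', hg, hf⟩ := exists_dialg_of_hom hP hF hG hD f hd b w hb
  refine ⟨D', hD', g, f', hf, fun e => ?_⟩
  rw [← hg, Functor.map_comp]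
  exact (Category.assoc _ _ _).symm.trans ((congrArg (· ≫ _) (h e)).trans (Category.assoc _ _ _))

variable [∀ e, PreservesColimitsOfShape ℕ (F' e)]

/-- One equalizing step enforces the equations only on elements coming from the previous dialgebra;
in the colimit of infinitely many steps every element comes from some stage. -/
lemma exists_satisfies {D : Dialg F G} (hD : P D.X) (f : D ⟶ x) :
    ∃ (D' : Dialg F G) (_ : P D'.X) (_ : Satisfies s t D') (g : D ⟶ D') (f' : D' ⟶ x),
      g ≫ f' = f := by
  have H (S : Σ D : { D : Dialg F G // P D.X }, (D.1 ⟶ x)) :=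
    exists_equalizing hP hF hG hF' hG' hx S.1.2 S.2
  choose d hd g w hgw h using H
  let T (n : ℕ) : Σ D : { D : Dialg F G // P D.X }, (D.1 ⟶ x) :=
    Nat.rec ⟨⟨D, hD⟩, f⟩ (fun _ S => ⟨⟨d S, hd S⟩, w S⟩) n
  let c (n : ℕ) : Dialg F G := (T n).1.1
  let m (n : ℕ) : c n ⟶ c (n + 1) := g (T n)
  obtain ⟨X, j, hX⟩ := IsSeqColimit.exists_of_hasColimit m
  obtain ⟨f', hf'⟩ := hX.exists_desc (fun n => (T n).2) fun n => hgw (T n)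
  have hX' := hX.map (forget F G)
  refine ⟨X, hX'.prop P fun n => (T n).1.2, fun e => (hX'.map (F' e)).hom_ext fun n => ?_,
    j 0, f', hf' 0⟩
  have h₁ : (s e).app (c n) ≫ (G' e).map (m n).hom = (t e).app (c n) ≫ (G' e).map (m n).hom :=
    h (T n) e
  -- The leg `j n` factors through `m n`, after which the two sides agree by construction.
  have h₂ : (s e).app (c n) ≫ (G' e).map (j n).hom = (t e).app (c n) ≫ (G' e).map (j n).hom := by
    have e' : (j n).hom = (m n).hom ≫ (j (n + 1)).hom := by rw [← hX.w n]; rfl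
    rw [e', Functor.map_comp]
    exact (Category.assoc _ _ _).symm.trans ((congrArg (· ≫ _) h₁).trans (Category.assoc _ _ _))
  exact ((s e).naturality (j n)).trans (h₂.trans ((t e).naturality (j n)).symm)

/-- An object of an essentially small class over a dialgebra satisfying the equations
factors through a dialgebra satisfying the equations whose underlying object is in the class. -/
theorem exists_satisfies_of_obj {c : W} (hc : P c) (u : c ⟶ x.X) :
    ∃ (D' : Dialg F G) (_ : P D'.X) (_ : Satisfies s t D') (f' : D' ⟶ x) (w : c ⟶ D'.X),
      w ≫ f'.hom = u := by
  obtain ⟨D, hD, f, w, rfl⟩ := exists_dialg_of_obj hP hF hG hc u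
  obtain ⟨D', hD', h, g, f', rfl⟩ := exists_satisfies hP hF hG hF' hG' hx hD f
  exact ⟨D', hD', h, f', w ≫ g.hom, Category.assoc _ _ _⟩

/-- A relative version of `exists_satisfies_of_obj`. -/
theorem exists_satisfies_of_hom {D : Dialg F G} (hD : P D.X) (f : D ⟶ x) {c : W} (hc : P c)
    (b : D.X ⟶ c) (u : c ⟶ x.X) (hbu : b ≫ u = f.hom) :
    ∃ (D' : Dialg F G) (_ : P D'.X) (_ : Satisfies s t D') (g : D ⟶ D') (f' : D' ⟶ x)
      (w : c ⟶ D'.X), w ≫ f'.hom = u ∧ b ≫ w = g.hom ∧ g ≫ f' = f := by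
  obtain ⟨D', hD', g, f', w, rfl, hg, rfl⟩ := exists_dialg_of_hom hP hF hG hD f hc b u hbu
  obtain ⟨D'', hD'', h, g', f'', rfl⟩ := exists_satisfies hP hF hG hF' hG' hx hD' f'
  refine ⟨D'', hD'', h, g ≫ g', f'', w ≫ g'.hom, Category.assoc _ _ _, ?_, Category.assoc _ _ _⟩
  rw [← Category.assoc, hg]
  rfl

end

end Dialg

end Stage

/-! ### Density of the dialgebras with small carrier -/

section Density

open Limits

universe u₁

variable {W : Type u₁} [Category.{v} W] {V : Type u} [Category.{v} V] {I I' : Type}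

namespace Dialg

variable {F G : I → W ⥤ V} {F' G' : I' → W ⥤ V}
  (s t : ∀ e, forget F G ⋙ F' e ⟶ forget F G ⋙ G' e) (P : ObjectProperty W)

/-- The dialgebras satisfying the equations whose underlying object has the property `P`. -/
abbrev underlying : ObjectProperty (Satisfies s t).FullSubcategory :=
  P.inverseImage ((Satisfies s t).ι ⋙ forget F G)

/-- Coproducts of dialgebras are formed on carriers and satisfy the equations, so the coproduct of
two small dialgebras is a small upper bound. -/
lemma isUpwardDirected_underlying [HasColimitsOfShape (Discrete WalkingPair) W]
    [∀ i, PreservesColimitsOfShape (Discrete WalkingPair) (F i)]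
    [∀ e, PreservesColimitsOfShape (Discrete WalkingPair) (F' e)]
    [P.IsClosedUnderColimitsOfShape (Discrete WalkingPair)] :
    IsUpwardDirected (underlying s t P) := by
  rintro ⟨x, hx⟩ ⟨c, hc⟩ ⟨c', hc'⟩ (h : P c.X) (h' : P c'.X) f f'
  have := satisfies_isClosedUnderColimitsOfShape s t (J := Discrete WalkingPair)
  have hd : Satisfies s t (c ⨿ c') :=
    (Satisfies s t).prop_colimit _ (by rintro ⟨_ | _⟩ <;> assumption)
  refine ⟨⟨c ⨿ c', hd⟩, ?_, ObjectProperty.homMk coprod.inl, ObjectProperty.homMk coprod.inr,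
    ObjectProperty.homMk (coprod.desc f.hom f'.hom), ?_, ?_⟩
  · exact P.prop_of_isColimit (isColimitOfPreserves (forget F G) (colimit.isColimit (pair c c')))
      (by rintro ⟨_ | _⟩ <;> assumption)
  · ext1; exact coprod.inl_desc _ _
  · ext1; exact coprod.inr_desc _ _

variable {s t P}

/-- Every map from a small object to the carrier of `x` extends to a small dialgebra over `x`. A
compatible family on small dialgebras thus determines one on small objects, and density in `W` glues
it. The hypothesis `hFP` lets compatibility of the glued map with the operations be checked on small
objects. -/
theorem isDenseProperty_underlying [Finite I] [Finite I'] {Q : ObjectProperty V}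
    [HasColimitsOfShape (Discrete WalkingPair) W] [HasColimitsOfShape WalkingParallelPair W]
    [HasColimitsOfShape ℕ W]
    [∀ i, PreservesColimitsOfShape (Discrete WalkingPair) (F i)]
    [∀ e, PreservesColimitsOfShape (Discrete WalkingPair) (F' e)]
    [∀ i, PreservesColimitsOfShape ℕ (F i)]
    [∀ e, PreservesColimitsOfShape ℕ (F' e)]
    [P.IsClosedUnderColimitsOfShape (Discrete WalkingPair)]
    [P.IsClosedUnderColimitsOfShape WalkingParallelPair]
    [P.IsClosedUnderColimitsOfShape ℕ]
    (hF : ∀ i, P ≤ Q.inverseImage (F i)) (hG : ∀ i, IsStagewise P Q (G i))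
    (hF' : ∀ e, P ≤ Q.inverseImage (F' e)) (hG' : ∀ e, IsStagewise P Q (G' e))
    (hP : IsDenseProperty P)
    (hFP : ∀ i {x : W} {T : V} {f g : (F i).obj x ⟶ T},
      (∀ c, P c → ∀ u : c ⟶ x, (F i).map u ≫ f = (F i).map u ≫ g) → f = g) :
    IsDenseProperty (underlying s t P) := by
  have hP' : IsUpwardDirected P := isUpwardDirected_of_isClosedUnder P
  have hfac (x : (Satisfies s t).FullSubcategory) {c : W} (hc : P c) (u : c ⟶ x.obj.X) :
      ∃ (D : (Satisfies s t).FullSubcategory) (_ : underlying s t P D) (f : D ⟶ x)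
        (w : c ⟶ D.obj.X), w ≫ f.hom.hom = u := by
    obtain ⟨D, hD, hs, f, w, rfl⟩ := exists_satisfies_of_obj hP' hF hG hF' hG' x.property hc u
    exact ⟨⟨D, hs⟩, hD, ObjectProperty.homMk f, w, rfl⟩
  refine ⟨fun {x T f g} h => ?_, fun {x T} φ hφ => ?_⟩
  · ext
    refine hP.hom_ext fun c hc u => ?_
    obtain ⟨D, hD, f', w, rfl⟩ := hfac x hc u
    have h' := congrArg (fun k => k.hom.hom) (h D hD f')
    exact (Category.assoc _ _ _).trans ((congrArg (w ≫ ·) h').trans (Category.assoc _ _ _).symm)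
  -- Independence of the chosen extension: two maps from `c` to small dialgebras that agree in `x`
  -- receive the same value under `φ`.
  · have key {c : W} (hc : P c) {D D' : (Satisfies s t).FullSubcategory}
        (hD : underlying s t P D) (hD' : underlying s t P D') (f : D ⟶ x) (f' : D' ⟶ x)
        (w : c ⟶ D.obj.X) (w' : c ⟶ D'.obj.X) (h : w ≫ f.hom.hom = w' ≫ f'.hom.hom) :
        w ≫ (φ D hD f).hom.hom = w' ≫ (φ D' hD' f').hom.hom := by
      obtain ⟨E, hE, a, a', k, rfl, rfl⟩ := isUpwardDirected_underlying s t P hD hD' f f'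
      obtain ⟨p, hp⟩ : ∃ p, p = w ≫ a.hom.hom := ⟨_, rfl⟩
      obtain ⟨p', hp'⟩ : ∃ p', p' = w' ≫ a'.hom.hom := ⟨_, rfl⟩
      have hk : p ≫ k.hom.hom = p' ≫ k.hom.hom := by
        rw [hp, hp']
        exact (Category.assoc _ _ _).trans (h.trans (Category.assoc _ _ _).symm)
      -- In a common upper bound `E` the two maps `p` and `p'` agree only over `x`. Their
      -- coequalizer is small and lies over `x`, so `E` maps to a small dialgebra over `x` in which
      -- they become equal.
      have hq : P (coequalizer p p') :=
        P.prop_colimit _ (by rintro (_ | _) <;> assumption)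
      obtain ⟨E', hE', hs, g, z, y, hy, hg, hz⟩ := exists_satisfies_of_hom hP' hF hG hF' hG'
        x.property hE k.hom hq (coequalizer.π p p') (coequalizer.desc k.hom.hom hk)
        (coequalizer.π_desc _ _)
      let E'' : (Satisfies s t).FullSubcategory := ⟨E', hs⟩
      let g' : E ⟶ E'' := ObjectProperty.homMk g
      let z' : E'' ⟶ x := ObjectProperty.homMk z
      have e₀ : g' ≫ z' = k := by ext1; exact hz
      have e (b : E.obj.X ⟶ E'.X) (hb : b = g.hom) : p ≫ b = p' ≫ b := by
        rw [hb, ← hg, coequalizer.condition_assoc]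
      have hE'' : underlying s t P E'' := hE'
      have e₁ : φ E hE k = g' ≫ φ E'' hE'' z' :=
        (congrArg (φ E hE) e₀.symm).trans (hφ _ _ hE hE'' g' z')
      rw [hφ _ _ hD hE, hφ _ _ hD' hE, e₁]
      change w ≫ a.hom.hom ≫ g.hom ≫ (φ E'' hE'' z').hom.hom =
        w' ≫ a'.hom.hom ≫ g.hom ≫ (φ E'' hE'' z').hom.hom
      have := e _ rfl
      rw [hp, hp', Category.assoc, Category.assoc] at this
      rw [reassoc_of% this]
    choose D hD f w hw using fun (c : Subtype P) (u : c.1 ⟶ x.obj.X) => hfac x c.2 u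
    obtain ⟨h, hh⟩ := hP.exists_desc (X := x.obj.X) (T := T.obj.X)
      (fun c hc u => w ⟨c, hc⟩ u ≫ (φ _ (hD ⟨c, hc⟩ u) (f ⟨c, hc⟩ u)).hom.hom)
      (fun c c' hc hc' a u => by
        rw [← Category.assoc]
        refine key hc _ _ _ _ _ _ ?_
        rw [hw, Category.assoc, hw])
    have hφh (E : (Satisfies s t).FullSubcategory) (hE : underlying s t P E) (k : E ⟶ x) :
        k.hom.hom ≫ h = (φ E hE k).hom.hom := by
      rw [hh _ hE]
      refine (key hE _ hE _ k _ (𝟙 _) ?_).trans (Category.id_comp _)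
      rw [hw]
      exact (Category.id_comp _).symm
    refine ⟨ObjectProperty.homMk ⟨h, fun i => hFP i fun c hc u => ?_⟩, fun E hE k => ?_⟩
    · obtain ⟨E, hE, k, w, rfl⟩ := hfac x hc u
      have h₁ : (F i).map k.hom.hom ≫ (F i).map h ≫ T.obj.str i =
          (F i).map k.hom.hom ≫ x.obj.str i ≫ (G i).map h := by
        rw [← Functor.map_comp_assoc, reassoc_of% k.hom.comm i, ← Functor.map_comp, hφh E hE]
        exact (φ E hE k).hom.comm i
      rw [Functor.map_comp, Category.assoc, Category.assoc, h₁]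
    · ext
      exact hφh E hE k

end Dialg

end Density

/-! ### Pairs of presentable objects -/

section Pairs

open Limits

variable {V : Type u} [Category.{v} V]

/-- The pairs of objects that satisfy `Q`. -/
def pairs (Q : ObjectProperty V) : ObjectProperty (V × V) := fun c => Q c.1 ∧ Q c.2

instance pairs_isClosedUnderColimitsOfShape (Q : ObjectProperty V) (J : Type*) [Category* J]
    [HasColimitsOfShape J V] [Q.IsClosedUnderColimitsOfShape J] :
    (pairs Q).IsClosedUnderColimitsOfShape J where
  colimitsOfShape_le := by
    rintro x ⟨hx⟩
    exact ⟨Q.prop_of_isColimit (isColimitOfPreserves (CategoryTheory.Prod.fst V V) hx.isColimit)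
        fun j => (hx.prop_diag_obj j).1,
      Q.prop_of_isColimit (isColimitOfPreserves (CategoryTheory.Prod.snd V V) hx.isColimit)
        fun j => (hx.prop_diag_obj j).2⟩

instance pairs_essentiallySmall (Q : ObjectProperty V) [ObjectProperty.EssentiallySmall.{v} Q] :
    ObjectProperty.EssentiallySmall.{v} (pairs Q) := by
  obtain ⟨Q₀, _, h₁, h₂⟩ := ObjectProperty.EssentiallySmall.exists_small_le.{v} Q
  have : Small.{v} (Subtype Q₀) := inferInstanceAs (ObjectProperty.Small.{v} Q₀)
  refine ⟨ObjectProperty.ofObj (fun t : Subtype Q₀ × Subtype Q₀ => (t.1.1, t.2.1)),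
    inferInstance, ?_⟩
  rintro ⟨c, d⟩ ⟨hc, hd⟩
  obtain ⟨c', hc', ⟨e⟩⟩ := h₂ _ hc
  obtain ⟨d', hd', ⟨e'⟩⟩ := h₂ _ hd
  exact ⟨_, ⟨⟨⟨c', hc'⟩, ⟨d', hd'⟩⟩⟩, ⟨Iso.prod e e'⟩⟩

section

variable {Q : ObjectProperty V} {z : V} (hz : Q z) (h : IsInitial z)
include hz h

/-- A map from `(c, z)` with `z` initial is a map from `c` to the first component, so each component
is recovered from the pairs having `z` in the other slot. -/
lemma isDenseProperty_pairs (hQ : IsDenseProperty Q) : IsDenseProperty (pairs Q) where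
  hom_ext e := by
    refine Prod.ext (hQ.hom_ext fun c hc u => ?_) (hQ.hom_ext fun c hc u => ?_)
    · exact congrArg Prod.fst (e (c, z) ⟨hc, hz⟩ (CategoryTheory.Prod.mkHom u (h.to _)))
    · exact congrArg Prod.snd (e (z, c) ⟨hz, hc⟩ (CategoryTheory.Prod.mkHom (h.to _) u))
  exists_desc {x T} φ hφ := by
    obtain ⟨k, hk⟩ := hQ.exists_desc (X := x.1) (T := T.1)
      (fun c hc u => (φ (c, z) ⟨hc, hz⟩ (CategoryTheory.Prod.mkHom u (h.to _))).1)
      (fun c c' hc hc' a u => by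
        have := hφ (c, z) (c', z) ⟨hc, hz⟩ ⟨hc', hz⟩ (CategoryTheory.Prod.mkHom a (𝟙 z))
          (CategoryTheory.Prod.mkHom u (h.to _))
        refine Eq.trans ?_ (congrArg Prod.fst this)
        congr 2
        exact Prod.ext rfl (h.hom_ext _ _))
    obtain ⟨l, hl⟩ := hQ.exists_desc (X := x.2) (T := T.2)
      (fun c hc u => (φ (z, c) ⟨hz, hc⟩ (CategoryTheory.Prod.mkHom (h.to _) u)).2)
      (fun c c' hc hc' a u => by
        have := hφ (z, c) (z, c') ⟨hz, hc⟩ ⟨hz, hc'⟩ (CategoryTheory.Prod.mkHom (𝟙 z) a)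
          (CategoryTheory.Prod.mkHom (h.to _) u)
        refine Eq.trans ?_ (congrArg Prod.snd this)
        congr 2
        exact Prod.ext (h.hom_ext _ _) rfl)
    refine ⟨CategoryTheory.Prod.mkHom k l, fun c hc u => ?_⟩
    have h₁ := hφ (c.1, z) c ⟨hc.1, hz⟩ hc (CategoryTheory.Prod.mkHom (𝟙 _) (h.to _)) u
    have h₂ := hφ (z, c.2) c ⟨hz, hc.2⟩ hc (CategoryTheory.Prod.mkHom (h.to _) (𝟙 _)) u
    refine Prod.ext ((hk _ hc.1 u.1).trans (Eq.trans ?_ ((congrArg Prod.fst h₁).trans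
      (Category.id_comp _)))) ((hl _ hc.2 u.2).trans (Eq.trans ?_ ((congrArg Prod.snd h₂).trans
      (Category.id_comp _))))
    · congr 2
      exact Prod.ext (Category.id_comp _).symm (h.hom_ext _ _)
    · congr 2
      exact Prod.ext (h.hom_ext _ _) (Category.id_comp _).symm

lemma isStagewise_fst (hQ : IsStagewise Q Q (𝟭 V)) :
    IsStagewise (pairs Q) Q (CategoryTheory.Prod.fst V V) where
  exists_hom {_ p} hp f := ⟨(p, z), ⟨hp, hz⟩, CategoryTheory.Prod.mkHom f (h.to _), 𝟙 p,
    Category.id_comp _⟩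
  exists_eq {_ c} hc u p hp g g' e := by
    obtain ⟨d, hd, a, w, haw, e'⟩ := hQ.exists_eq hc.1 u.1 hp g g' e
    exact ⟨(d, c.2), ⟨hd, hc.2⟩, CategoryTheory.Prod.mkHom a (𝟙 _), CategoryTheory.Prod.mkHom w u.2,
      Prod.ext haw (Category.id_comp _), e'⟩

lemma isStagewise_snd (hQ : IsStagewise Q Q (𝟭 V)) :
    IsStagewise (pairs Q) Q (CategoryTheory.Prod.snd V V) where
  exists_hom {_ p} hp f := ⟨(z, p), ⟨hz, hp⟩, CategoryTheory.Prod.mkHom (h.to _) f, 𝟙 p,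
    Category.id_comp _⟩
  exists_eq {_ c} hc u p hp g g' e := by
    obtain ⟨d, hd, a, w, haw, e'⟩ := hQ.exists_eq hc.2 u.2 hp g g' e
    exact ⟨(c.1, d), ⟨hc.1, hd⟩, CategoryTheory.Prod.mkHom (𝟙 _) a, CategoryTheory.Prod.mkHom u.1 w,
      Prod.ext (Category.id_comp _) haw, e'⟩

lemma isStagewise_const (p : V) :
    IsStagewise (pairs Q) Q ((Functor.const (V × V)).obj p) :=
  IsStagewise.const (fun _ => ⟨(z, z), ⟨hz, hz⟩,
    ⟨CategoryTheory.Prod.mkHom (h.to _) (h.to _)⟩⟩) p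

end

/-- The class of objects `Q` is closed under the colimits and tensor products, and the cocontinuous
functors are compatible with it in the way needed in order to build dialgebras in stages. -/
structure IsTensorClosed [MonoidalCategory V] (Q : ObjectProperty V) : Prop where
  essentiallySmall : ObjectProperty.EssentiallySmall.{v} Q
  dense : IsDenseProperty Q
  unit : Q (𝟙_ V)
  tensor (p q : V) : Q p → Q q → Q (p ⊗ q)
  closed (J : Type) [SmallCategory J] [CountableCategory J] : Q.IsClosedUnderColimitsOfShape J
  stagewise (T : V ⥤ V) [PreservesColimitsOfSize.{v, v} T] : IsStagewise Q Q T

/-- The class is that of `κ`-presentable objects for a suitable `κ`. Uncountability of `κ` makes all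
countable shapes `κ`-small, which covers binary coproducts, coequalizers and sequences. The family
`Y` lets given objects be included. -/
lemma exists_isTensorClosed [MonoidalCategory V]
    [IsLocallyPresentable.{v} V] [∀ X : V, PreservesColimitsOfSize.{v, v} (tensorLeft X)]
    [∀ X : V, PreservesColimitsOfSize.{v, v} (tensorRight X)]
    {I : Type*} [Small.{v} I] (Y : I → V) :
    ∃ Q : ObjectProperty V, IsTensorClosed Q ∧ ∀ i, Q (Y i) := by
  have : Small.{v} (Option I) := small_map (Equiv.optionCongr (equivShrink.{v} I))
  obtain ⟨κ, _, _, h₀, h₁, h₂⟩ := exists_cardinal_tensor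
    (fun i : Option I => i.elim (𝟙_ V) Y)
  refine ⟨isCardinalPresentable V κ, ⟨inferInstance, .of_isDense _, h₁ none, h₂, ?_,
    fun T _ => .of_preservesColimits κ T⟩, fun i => h₁ (some i)⟩
  intro J _ _
  have : Countable (Arrow J) := by
    let f : Arrow J → Σ (x : J × J), (x.1 ⟶ x.2) := fun a => ⟨(a.left, a.right), a.hom⟩
    have hf : Function.Injective f := by
      rintro ⟨a, b, k⟩ ⟨a', b', k'⟩ h
      cases h
      rfl
    exact hf.countable
  have : HasLimitsOfShape Jᵒᵖ (Type v) := inferInstance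
  refine isClosedUnderColimitsOfShape_isCardinalPresentable V ?_
  have h₃ : Cardinal.lift.{v} (Cardinal.mk (Arrow J)) ≤ Cardinal.aleph0 := by simp
  have h₄ : Cardinal.aleph0 < Cardinal.lift.{0} κ := by simpa using h₀
  exact h₃.trans_lt h₄

end Pairs

/-! ### Sifted colimits of pointwise tensor products -/

section Tensor

open Limits

variable {V : Type u} [Category.{v} V] [MonoidalCategory V] {J : Type*} [Category* J]
  [IsSifted J] [HasColimitsOfShape J V] [∀ X : V, PreservesColimitsOfShape J (tensorLeft X)]
  [∀ X : V, PreservesColimitsOfShape J (tensorRight X)]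

/-- The tensor product preserves colimits in each variable, so that of two colimits is a colimit
over `J × J`; siftedness restricts it to the diagonal. For modules this is needed with `J = ℕ`. -/
instance preservesColimitsOfShape_tensor {W : Type*} [Category* W] [HasColimitsOfShape J W]
    (H H' : W ⥤ V) [PreservesColimitsOfShape J H] [PreservesColimitsOfShape J H'] :
    PreservesColimitsOfShape J (H ⊗ H') where
  preservesColimit {K} := by
    have (X : V) : PreservesColimitsOfShape J ((curriedTensor V).obj X) :=
      inferInstanceAs (PreservesColimitsOfShape J (tensorLeft X))
    have (X : V) : PreservesColimitsOfShape J ((curriedTensor V).flip.obj X) :=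
      inferInstanceAs (PreservesColimitsOfShape J (tensorRight X))
    have : PreservesColimit₂ (K ⋙ H) (K ⋙ H') (curriedTensor V) :=
      PreservesColimit₂.of_preservesColimits_in_each_variable _
    constructor
    intro c hc
    exact ⟨IsColimit.ofIsoColimit (IsColimit.tensor (isColimitOfPreserves H hc) (isColimitOfPreserves H' hc))
      (Cocone.ext (Iso.refl _) fun j => Category.comp_id _)⟩

end Tensor

/-- The structure morphisms of a dialgebra are natural. -/
def Dialg.strNat {W : Type*} [Category* W] {V : Type u} [Category.{v} V] {I : Type}
    (F G : I → W ⥤ V) (i : I) : forget F G ⋙ F i ⟶ forget F G ⋙ G i where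
  app D := D.str i
  naturality _ _ f := f.comm i

/-! ### Comodules as dialgebras on pairs -/

section Comodules

variable (V : Type u) [Category.{v} V] [MonoidalCategory V]

/-- The operations of a comonoid and of a comodule over it. -/
inductive ComodOp
  | counit
  | comul
  | coact

/-- The laws of a comonoid and of a comodule over it. -/
inductive ComodLaw
  | counit_comul
  | comul_counit
  | comul_assoc
  | counit_coact
  | comul_coact

instance : Finite ComodOp :=
  Finite.of_surjective (fun i : Fin 3 => match i with
    | 0 => ComodOp.counit | 1 => .comul | 2 => .coact)
    (by rintro (_ | _ | _) <;> [exact ⟨0, rfl⟩; exact ⟨1, rfl⟩; exact ⟨2, rfl⟩])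

instance : Finite ComodLaw :=
  Finite.of_surjective (fun i : Fin 5 => match i with
    | 0 => ComodLaw.counit_comul | 1 => .comul_counit | 2 => .comul_assoc | 3 => .counit_coact
    | 4 => .comul_coact)
    (by rintro (_ | _ | _ | _ | _) <;>
      [exact ⟨0, rfl⟩; exact ⟨1, rfl⟩; exact ⟨2, rfl⟩; exact ⟨3, rfl⟩; exact ⟨4, rfl⟩])

/-- The first object of a pair. -/
abbrev fstObj : V × V ⥤ V := CategoryTheory.Prod.fst V V

/-- The second object of a pair. -/
abbrev sndObj : V × V ⥤ V := CategoryTheory.Prod.snd V V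

/-- The sources of the operations of a comodule. -/
def ComodOp.src : ComodOp → V × V ⥤ V
  | counit => fstObj V
  | comul => fstObj V
  | coact => sndObj V

/-- The targets of the operations of a comodule. -/
def ComodOp.tgt : ComodOp → V × V ⥤ V
  | counit => (Functor.const _).obj (𝟙_ V)
  | comul => fstObj V ⊗ fstObj V
  | coact => fstObj V ⊗ sndObj V

/-- The sources of the laws of a comodule. -/
def ComodLaw.src : ComodLaw → V × V ⥤ V
  | counit_comul => fstObj V
  | comul_counit => fstObj V
  | comul_assoc => fstObj V
  | counit_coact => sndObj V
  | comul_coact => sndObj V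

/-- The targets of the laws of a comodule. -/
def ComodLaw.tgt : ComodLaw → V × V ⥤ V
  | counit_comul => fstObj V
  | comul_counit => fstObj V
  | comul_assoc => fstObj V ⊗ (fstObj V ⊗ fstObj V)
  | counit_coact => sndObj V
  | comul_coact => fstObj V ⊗ (fstObj V ⊗ sndObj V)

namespace ComodDialg

open ComodOp

/-- The comonoid part of the dialgebra. -/
abbrev c : Dialg (src V) (tgt V) ⥤ V := Dialg.forget _ _ ⋙ fstObj V

/-- The comodule part of the dialgebra. -/
abbrev x : Dialg (src V) (tgt V) ⥤ V := Dialg.forget _ _ ⋙ sndObj V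

/-- The counit. -/
abbrev ε' : c V ⟶ 𝟙_ (Dialg (src V) (tgt V) ⥤ V) := Dialg.strNat (src V) (tgt V) .counit

/-- The comultiplication. -/
abbrev Δ' : c V ⟶ c V ⊗ c V := Dialg.strNat (src V) (tgt V) .comul

/-- The coaction. -/
abbrev δ' : x V ⟶ c V ⊗ x V := Dialg.strNat (src V) (tgt V) .coact

/-- The left hand sides of the laws of a comodule. -/
def lhs : ∀ e, Dialg.forget (src V) (tgt V) ⋙ ComodLaw.src V e ⟶
    Dialg.forget (src V) (tgt V) ⋙ ComodLaw.tgt V e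
  -- Working in the monoidal category of functors makes each side of a law automatically natural;
  -- evaluating at an object gives the usual law definitionally.
  | .counit_comul => (Δ' V ≫ ε' V ▷ c V ≫ (λ_ (c V)).hom : c V ⟶ c V)
  | .comul_counit => (Δ' V ≫ c V ◁ ε' V ≫ (ρ_ (c V)).hom : c V ⟶ c V)
  | .comul_assoc => (Δ' V ≫ c V ◁ Δ' V : c V ⟶ c V ⊗ (c V ⊗ c V))
  | .counit_coact => (δ' V ≫ ε' V ▷ x V ≫ (λ_ (x V)).hom : x V ⟶ x V)
  | .comul_coact => (δ' V ≫ c V ◁ δ' V : x V ⟶ c V ⊗ (c V ⊗ x V))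

/-- The right hand sides of the laws of a comodule. -/
def rhs : ∀ e, Dialg.forget (src V) (tgt V) ⋙ ComodLaw.src V e ⟶
    Dialg.forget (src V) (tgt V) ⋙ ComodLaw.tgt V e
  | .counit_comul => 𝟙 (c V)
  | .comul_counit => 𝟙 (c V)
  | .comul_assoc => (Δ' V ≫ Δ' V ▷ c V ≫ (α_ _ _ _).hom : c V ⟶ c V ⊗ (c V ⊗ c V))
  | .counit_coact => 𝟙 (x V)
  | .comul_coact => (δ' V ≫ Δ' V ▷ x V ≫ (α_ _ _ _).hom : x V ⟶ c V ⊗ (c V ⊗ x V))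

variable {V} in
/-- The dialgebra of a comodule. -/
abbrev of (Y : GlobalComod V) : Dialg (src V) (tgt V) where
  X := (Y.base.X, Y.X)
  str
    | .counit => ε[Y.base.X]
    | .comul => Δ[Y.base.X]
    | .coact => Y.coact

variable {V} in
lemma satisfies_of (Y : GlobalComod V) : Dialg.Satisfies (lhs V) (rhs V) (of Y) := by
  rintro (_ | _ | _ | _ | _)
  · change Δ[Y.base.X] ≫ ε[Y.base.X] ▷ Y.base.X ≫ (λ_ _).hom = 𝟙 _
    rw [ComonObj.counit_comul_assoc, Iso.inv_hom_id]
  · change Δ[Y.base.X] ≫ Y.base.X ◁ ε[Y.base.X] ≫ (ρ_ _).hom = 𝟙 _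
    rw [ComonObj.comul_counit_assoc, Iso.inv_hom_id]
  · change Δ[Y.base.X] ≫ Y.base.X ◁ Δ[Y.base.X] = Δ[Y.base.X] ≫ Δ[Y.base.X] ▷ _ ≫ (α_ _ _ _).hom
    rw [ComonObj.comul_assoc]
  · change Y.coact ≫ ε[Y.base.X] ▷ Y.X ≫ (λ_ _).hom = 𝟙 _
    rw [← Category.assoc, ComodObj.counit_coact, Iso.inv_hom_id]
  · change Y.coact ≫ Y.base.X ◁ Y.coact = Y.coact ≫ Δ[Y.base.X] ▷ _ ≫ (α_ _ _ _).hom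
    rw [← Category.assoc, ComodObj.comul_coact]
    simp

/-- Comodules are dialgebras. -/
abbrev functor : GlobalComod V ⥤ (Dialg.Satisfies (lhs V) (rhs V)).FullSubcategory where
  obj Y := ⟨of Y, satisfies_of Y⟩
  map {Y Z} f := ObjectProperty.homMk ⟨CategoryTheory.Prod.mkHom f.base.hom f.hom, fun i =>
    match i with
    | .counit => (IsComonHom.hom_counit f.base.hom).trans (Category.comp_id _).symm
    | .comul => IsComonHom.hom_comul f.base.hom
    | .coact => (GlobalComod.coact_tensorHom f).symm⟩

instance : (functor V).Faithful where
  map_injective {Y Z f g} h := by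
    have h' := congrArg (fun k => k.hom.hom) h
    ext
    · exact congrArg Prod.fst h'
    · exact congrArg Prod.snd h'

instance : (functor V).Full where
  map_surjective {Y Z} f :=
    ⟨{ base := { hom := f.hom.hom.1
                 isComonHom_hom :=
                  { hom_counit := (f.hom.comm .counit).trans (Category.comp_id _)
                    hom_comul := f.hom.comm .comul } }
       hom := f.hom.hom.2
       coact_hom := by
        rw [← MonoidalCategory.tensorHom_def]
        exact (f.hom.comm .coact).symm }, rfl⟩

variable {V} in
/-- A comodule from structure morphisms that satisfy the laws. -/
abbrev ofStr {C X : V} (e : C ⟶ 𝟙_ V) (d : C ⟶ C ⊗ C) (k : X ⟶ C ⊗ X)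
    (h₁ : d ≫ e ▷ C ≫ (λ_ C).hom = 𝟙 C) (h₂ : d ≫ C ◁ e ≫ (ρ_ C).hom = 𝟙 C)
    (h₃ : d ≫ C ◁ d = d ≫ d ▷ C ≫ (α_ C C C).hom)
    (h₄ : k ≫ e ▷ X ≫ (λ_ X).hom = 𝟙 X)
    (h₅ : k ≫ C ◁ k = k ≫ d ▷ X ≫ (α_ C C X).hom) : GlobalComod V :=
  letI : ComonObj C :=
    { counit := e
      comul := d
      counit_comul := by rw [← cancel_mono (λ_ C).hom, Category.assoc, h₁, Iso.inv_hom_id]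
      comul_counit := by rw [← cancel_mono (ρ_ C).hom, Category.assoc, h₂, Iso.inv_hom_id]
      comul_assoc := h₃ }
  letI : ComodObj C X :=
    { coact := k
      counit_coact := by
        change k ≫ e ▷ X = _
        rw [← cancel_mono (λ_ X).hom, Category.assoc, h₄, Iso.inv_hom_id]
      comul_coact := by
        change k ≫ d ▷ X = _
        rw [← Category.assoc k (C ◁ k), h₅]
        simp }
  ⟨⟨C⟩, ⟨X⟩⟩

instance : (functor V).EssSurj where
  mem_essImage D := by
    let Y : GlobalComod V := ofStr (D.obj.str .counit) (D.obj.str .comul) (D.obj.str .coact)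
      (D.property .counit_comul) (D.property .comul_counit) (D.property .comul_assoc)
      (D.property .counit_coact) (D.property .comul_coact)
    have h : of Y = D.obj := congrArg (Dialg.mk D.obj.X) (funext fun i => by cases i <;> rfl)
    exact ⟨Y, ⟨(Dialg.Satisfies (lhs V) (rhs V)).isoMk (eqToIso h)⟩⟩

instance : (functor V).IsEquivalence where

end ComodDialg

end Comodules

/-! ### Modules as dialgebras on pairs -/

section Modules

variable (V : Type u) [Category.{v} V] [MonoidalCategory V]

/-- The operations of a monoid and of a module over it. -/
inductive ModOp
  | unit
  | mul
  | act

/-- The laws of a monoid and of a module over it. -/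
inductive ModLaw
  | one_mul
  | mul_one
  | mul_assoc
  | one_act
  | mul_act

instance : Finite ModOp :=
  Finite.of_surjective (fun i : Fin 3 => match i with
    | 0 => ModOp.unit | 1 => .mul | 2 => .act)
    (by rintro (_ | _ | _) <;> [exact ⟨0, rfl⟩; exact ⟨1, rfl⟩; exact ⟨2, rfl⟩])

instance : Finite ModLaw :=
  Finite.of_surjective (fun i : Fin 5 => match i with
    | 0 => ModLaw.one_mul | 1 => .mul_one | 2 => .mul_assoc | 3 => .one_act
    | 4 => .mul_act)
    (by rintro (_ | _ | _ | _ | _) <;>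
      [exact ⟨0, rfl⟩; exact ⟨1, rfl⟩; exact ⟨2, rfl⟩; exact ⟨3, rfl⟩; exact ⟨4, rfl⟩])

/-- The sources of the operations of a module. -/
def ModOp.src : ModOp → V × V ⥤ V
  | unit => (Functor.const _).obj (𝟙_ V)
  | mul => fstObj V ⊗ fstObj V
  | act => fstObj V ⊗ sndObj V

/-- The targets of the operations of a module. -/
def ModOp.tgt : ModOp → V × V ⥤ V
  | unit => fstObj V
  | mul => fstObj V
  | act => sndObj V

/-- The sources of the laws of a module. -/
def ModLaw.src : ModLaw → V × V ⥤ V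
  | one_mul => fstObj V
  | mul_one => fstObj V
  | mul_assoc => (fstObj V ⊗ fstObj V) ⊗ fstObj V
  | one_act => sndObj V
  | mul_act => (fstObj V ⊗ fstObj V) ⊗ sndObj V

/-- The targets of the laws of a module. -/
def ModLaw.tgt : ModLaw → V × V ⥤ V
  | one_mul => fstObj V
  | mul_one => fstObj V
  | mul_assoc => fstObj V
  | one_act => sndObj V
  | mul_act => sndObj V

namespace ModDialg

open ModOp

/-- The monoid part of the dialgebra. -/
abbrev a : Dialg (src V) (tgt V) ⥤ V := Dialg.forget _ _ ⋙ fstObj V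

/-- The module part of the dialgebra. -/
abbrev m : Dialg (src V) (tgt V) ⥤ V := Dialg.forget _ _ ⋙ sndObj V

/-- The unit. -/
abbrev η' : 𝟙_ (Dialg (src V) (tgt V) ⥤ V) ⟶ a V := Dialg.strNat (src V) (tgt V) .unit

/-- The multiplication. -/
abbrev μ' : a V ⊗ a V ⟶ a V := Dialg.strNat (src V) (tgt V) .mul

/-- The action. -/
abbrev γ' : a V ⊗ m V ⟶ m V := Dialg.strNat (src V) (tgt V) .act

/-- The left hand sides of the laws of a module. -/
def lhs : ∀ e, Dialg.forget (src V) (tgt V) ⋙ ModLaw.src V e ⟶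
    Dialg.forget (src V) (tgt V) ⋙ ModLaw.tgt V e
  | .one_mul => ((λ_ (a V)).inv ≫ η' V ▷ a V ≫ μ' V : a V ⟶ a V)
  | .mul_one => ((ρ_ (a V)).inv ≫ a V ◁ η' V ≫ μ' V : a V ⟶ a V)
  | .mul_assoc => (μ' V ▷ a V ≫ μ' V : (a V ⊗ a V) ⊗ a V ⟶ a V)
  | .one_act => ((λ_ (m V)).inv ≫ η' V ▷ m V ≫ γ' V : m V ⟶ m V)
  | .mul_act => (μ' V ▷ m V ≫ γ' V : (a V ⊗ a V) ⊗ m V ⟶ m V)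

/-- The right hand sides of the laws of a module. -/
def rhs : ∀ e, Dialg.forget (src V) (tgt V) ⋙ ModLaw.src V e ⟶
    Dialg.forget (src V) (tgt V) ⋙ ModLaw.tgt V e
  | .one_mul => 𝟙 (a V)
  | .mul_one => 𝟙 (a V)
  | .mul_assoc => ((α_ _ _ _).hom ≫ a V ◁ μ' V ≫ μ' V : (a V ⊗ a V) ⊗ a V ⟶ a V)
  | .one_act => 𝟙 (m V)
  | .mul_act => ((α_ _ _ _).hom ≫ a V ◁ γ' V ≫ γ' V : (a V ⊗ a V) ⊗ m V ⟶ m V)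

variable {V} in
/-- The dialgebra of a module. -/
abbrev of (Y : GlobalMod V) : Dialg (src V) (tgt V) where
  X := (Y.base.X, Y.X)
  str
    | .unit => η[Y.base.X]
    | .mul => μ[Y.base.X]
    | .act => Y.act

variable {V} in
lemma satisfies_of (Y : GlobalMod V) : Dialg.Satisfies (lhs V) (rhs V) (of Y) := by
  rintro (_ | _ | _ | _ | _)
  · change (λ_ _).inv ≫ η[Y.base.X] ▷ Y.base.X ≫ μ[Y.base.X] = 𝟙 _
    rw [MonObj.one_mul, Iso.inv_hom_id]
  · change (ρ_ _).inv ≫ Y.base.X ◁ η[Y.base.X] ≫ μ[Y.base.X] = 𝟙 _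
    rw [MonObj.mul_one, Iso.inv_hom_id]
  · exact MonObj.mul_assoc Y.base.X
  · change (λ_ _).inv ≫ η[Y.base.X] ▷ Y.X ≫ Y.act = 𝟙 _
    have h : η[Y.base.X] ▷ Y.X ≫ Y.act = (λ_ Y.X).hom :=
      ModObj.one_smul_self (M := Y.base.X) Y.X
    rw [h, Iso.inv_hom_id]
  · exact ModObj.mul_smul_self (M := Y.base.X) Y.X

/-- Modules are dialgebras. -/
abbrev functor : GlobalMod V ⥤ (Dialg.Satisfies (lhs V) (rhs V)).FullSubcategory where
  obj Y := ⟨of Y, satisfies_of Y⟩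
  map {Y Z} f := ObjectProperty.homMk ⟨CategoryTheory.Prod.mkHom f.base.hom f.hom, fun i =>
    match i with
    | .unit => (Category.id_comp _).trans (IsMonHom.one_hom f.base.hom).symm
    | .mul => (IsMonHom.mul_hom f.base.hom).symm
    | .act => (GlobalMod.act_tensorHom f).symm⟩

instance : (functor V).Faithful where
  map_injective {Y Z f g} h := by
    have h' := congrArg (fun k => k.hom.hom) h
    ext
    · exact congrArg Prod.fst h'
    · exact congrArg Prod.snd h'

instance : (functor V).Full where
  map_surjective {Y Z} f :=
    ⟨{ base := { hom := f.hom.hom.1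
                 isMonHom_hom :=
                  { one_hom := (f.hom.comm .unit).symm.trans (Category.id_comp _)
                    mul_hom := (f.hom.comm .mul).symm } }
       hom := f.hom.hom.2
       act_hom := by
        rw [← Category.assoc, ← tensorHom_def']
        exact (f.hom.comm .act).symm }, rfl⟩

variable {V} in
/-- A module from structure morphisms that satisfy the laws. -/
abbrev ofStr {A M : V} (e : 𝟙_ V ⟶ A) (d : A ⊗ A ⟶ A) (k : A ⊗ M ⟶ M)
    (h₁ : (λ_ A).inv ≫ e ▷ A ≫ d = 𝟙 A) (h₂ : (ρ_ A).inv ≫ A ◁ e ≫ d = 𝟙 A)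
    (h₃ : d ▷ A ≫ d = (α_ A A A).hom ≫ A ◁ d ≫ d)
    (h₄ : (λ_ M).inv ≫ e ▷ M ≫ k = 𝟙 M)
    (h₅ : d ▷ M ≫ k = (α_ A A M).hom ≫ A ◁ k ≫ k) : GlobalMod V :=
  letI : MonObj A :=
    { one := e
      mul := d
      one_mul := by rw [← cancel_epi (λ_ A).inv, h₁, Iso.inv_hom_id]
      mul_one := by rw [← cancel_epi (ρ_ A).inv, h₂, Iso.inv_hom_id]
      mul_assoc := h₃ }
  letI : ModObj A M :=
    { smul := k
      one_smul := by
        change e ▷ M ≫ k = (λ_ M).hom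
        rw [← cancel_epi (λ_ M).inv, h₄, Iso.inv_hom_id]
      mul_smul := h₅ }
  ⟨⟨A⟩, ⟨M⟩⟩

-- An equation rather than an isomorphism, so that a dialgebra obtained from the general
-- construction can be replaced by a module through substitution.
variable {V} in
lemma exists_of_eq {D : Dialg (src V) (tgt V)} (h : Dialg.Satisfies (lhs V) (rhs V) D) :
    ∃ Y : GlobalMod V, of Y = D := by
  refine ⟨ofStr (D.str .unit) (D.str .mul) (D.str .act)
      (h .one_mul) (h .mul_one) (h .mul_assoc) (h .one_act) (h .mul_act), ?_⟩
  refine congrArg (Dialg.mk D.X) (funext fun i => ?_)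
  cases i <;> rfl

instance : (functor V).EssSurj where
  mem_essImage := by
    rintro ⟨D, hD⟩
    obtain ⟨Y, rfl⟩ := exists_of_eq hD
    exact ⟨Y, ⟨Iso.refl _⟩⟩

instance : (functor V).IsEquivalence where

end ModDialg

end Modules

/-! ### Colimits of comodules, limits of modules, and cocontinuous functors on comodules -/

section Comodules

open Limits

variable (V : Type u) [Category.{v} V] [MonoidalCategory V]

/-- The forgetful functor from comodules to pairs of objects. -/
abbrev GlobalComod.forget : GlobalComod V ⥤ V × V where
  obj X := (X.base.X, X.X)
  map f := CategoryTheory.Prod.mkHom f.base.hom f.hom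

/-- The forgetful functor is definitionally the equivalence with dialgebras followed by inclusion
and forgetting. Reflection of isomorphisms and preservation of colimits later give reflection of
colimits. -/
instance : (GlobalComod.forget V).ReflectsIsomorphisms :=
  inferInstanceAs (ComodDialg.functor V ⋙ (Dialg.Satisfies _ _).ι ⋙
    Dialg.forget _ _).ReflectsIsomorphisms

/-- The forgetful functor from modules to pairs of objects. -/
abbrev GlobalMod.forget : GlobalMod V ⥤ V × V where
  obj X := (X.base.X, X.X)
  map f := CategoryTheory.Prod.mkHom f.base.hom f.hom

instance : (GlobalMod.forget V).ReflectsIsomorphisms :=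
  inferInstanceAs (ModDialg.functor V ⋙ (Dialg.Satisfies _ _).ι ⋙
    Dialg.forget _ _).ReflectsIsomorphisms

section

variable (J : Type*) [Category* J]

instance [HasColimitsOfShape J V] (i : ComodOp) :
    PreservesColimitsOfShape J (ComodOp.src V i) := by
  cases i <;> (dsimp only [ComodOp.src]; infer_instance)

instance [HasColimitsOfShape J V] (e : ComodLaw) :
    PreservesColimitsOfShape J (ComodLaw.src V e) := by
  cases e <;> (dsimp only [ComodLaw.src]; infer_instance)

instance [HasLimitsOfShape J V] (i : ModOp) :
    PreservesLimitsOfShape J (ModOp.tgt V i) := by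
  cases i <;> (dsimp only [ModOp.tgt]; infer_instance)

instance [HasLimitsOfShape J V] (e : ModLaw) :
    PreservesLimitsOfShape J (ModLaw.tgt V e) := by
  cases e <;> (dsimp only [ModLaw.tgt]; infer_instance)

instance [HasColimitsOfShape J V] :
    (Dialg.Satisfies (ComodDialg.lhs V) (ComodDialg.rhs V)).IsClosedUnderColimitsOfShape J :=
  Dialg.satisfies_isClosedUnderColimitsOfShape _ _

instance [HasLimitsOfShape J V] :
    (Dialg.Satisfies (ModDialg.lhs V) (ModDialg.rhs V)).IsClosedUnderLimitsOfShape J :=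
  Dialg.satisfies_isClosedUnderLimitsOfShape _ _

instance [HasColimitsOfShape J V] : HasColimitsOfShape J
    (Dialg.Satisfies (ComodDialg.lhs V) (ComodDialg.rhs V)).FullSubcategory :=
  hasColimitsOfShape_of_hasColimitsOfShape_createsColimitsOfShape
    (Dialg.Satisfies (ComodDialg.lhs V) (ComodDialg.rhs V)).ι

instance [HasLimitsOfShape J V] : HasLimitsOfShape J
    (Dialg.Satisfies (ModDialg.lhs V) (ModDialg.rhs V)).FullSubcategory :=
  hasLimitsOfShape_of_hasLimitsOfShape_createsLimitsOfShape
    (Dialg.Satisfies (ModDialg.lhs V) (ModDialg.rhs V)).ι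

instance [HasColimitsOfShape J V] : HasColimitsOfShape J (GlobalComod V) :=
  Adjunction.hasColimitsOfShape_of_equivalence (ComodDialg.functor V)

instance [HasLimitsOfShape J V] : HasLimitsOfShape J (GlobalMod V) :=
  Adjunction.hasLimitsOfShape_of_equivalence (ModDialg.functor V)

instance [HasColimitsOfShape J V] : PreservesColimitsOfShape J (GlobalComod.forget V) :=
  inferInstanceAs (PreservesColimitsOfShape J (ComodDialg.functor V ⋙
    (Dialg.Satisfies (ComodDialg.lhs V) (ComodDialg.rhs V)).ι ⋙ Dialg.forget _ _))

instance [HasLimitsOfShape J V] : PreservesLimitsOfShape J (GlobalMod.forget V) :=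
  inferInstanceAs (PreservesLimitsOfShape J (ModDialg.functor V ⋙
    (Dialg.Satisfies (ModDialg.lhs V) (ModDialg.rhs V)).ι ⋙ Dialg.forget _ _))

instance [HasColimitsOfShape J V] : ReflectsColimitsOfShape J (GlobalComod.forget V) :=
  reflectsColimitsOfShape_of_reflectsIsomorphisms

instance [HasLimitsOfShape J V] : ReflectsLimitsOfShape J (GlobalMod.forget V) :=
  reflectsLimitsOfShape_of_reflectsIsomorphisms

end

namespace IsTensorClosed

variable {V} {Q : ObjectProperty V} (h : IsTensorClosed Q)
include h

lemma exists_isInitial [HasColimitsOfShape (Discrete PEmpty.{1}) V] :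
    ∃ z : V, Q z ∧ Nonempty (IsInitial z) := by
  have := h.closed (Discrete PEmpty.{1})
  exact ⟨_, Q.prop_colimit (Functor.empty V) (fun j => j.as.elim), ⟨initialIsInitial⟩⟩

variable [HasColimitsOfSize.{v, v} V]

lemma isStagewise_pairs_fst : IsStagewise (pairs Q) Q (fstObj V) := by
  have : HasColimitsOfSize.{0, 0} V := hasColimitsOfSizeShrink.{0, 0, v, v} V
  obtain ⟨z, hz, ⟨hz'⟩⟩ := h.exists_isInitial
  exact isStagewise_fst hz hz' (h.stagewise _)

lemma isStagewise_pairs_snd : IsStagewise (pairs Q) Q (sndObj V) := by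
  have : HasColimitsOfSize.{0, 0} V := hasColimitsOfSizeShrink.{0, 0, v, v} V
  obtain ⟨z, hz, ⟨hz'⟩⟩ := h.exists_isInitial
  exact isStagewise_snd hz hz' (h.stagewise _)

lemma isStagewise_pairs_const (p : V) :
    IsStagewise (pairs Q) Q ((Functor.const (V × V)).obj p) := by
  have : HasColimitsOfSize.{0, 0} V := hasColimitsOfSizeShrink.{0, 0, v, v} V
  obtain ⟨z, hz, ⟨hz'⟩⟩ := h.exists_isInitial
  exact isStagewise_const hz hz' p

lemma isDenseProperty_pairs : IsDenseProperty (pairs Q) := by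
  have : HasColimitsOfSize.{0, 0} V := hasColimitsOfSizeShrink.{0, 0, v, v} V
  obtain ⟨z, hz, ⟨hz'⟩⟩ := h.exists_isInitial
  exact MeasuringComodule.isDenseProperty_pairs hz hz' h.dense

lemma isUpwardDirected_pairs : IsUpwardDirected (pairs Q) := by
  have : HasColimitsOfSize.{0, 0} V := hasColimitsOfSizeShrink.{0, 0, v, v} V
  have := h.closed (Discrete WalkingPair)
  exact isUpwardDirected_of_isClosedUnder _

omit [HasColimitsOfSize.{v, v} V] in
lemma pairs_le_tensor {H H' : V × V ⥤ V} (h₁ : pairs Q ≤ Q.inverseImage H)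
    (h₂ : pairs Q ≤ Q.inverseImage H') : pairs Q ≤ Q.inverseImage (H ⊗ H') :=
  fun c hc => h.tensor _ _ (h₁ c hc) (h₂ c hc)

lemma isStagewise_pairs_tensor [∀ X : V, PreservesColimitsOfSize.{v, v} (tensorLeft X)]
    [∀ X : V, PreservesColimitsOfSize.{v, v} (tensorRight X)] {H H' : V × V ⥤ V}
    (h₁ : pairs Q ≤ Q.inverseImage H) (h₂ : pairs Q ≤ Q.inverseImage H')
    (h₃ : IsStagewise (pairs Q) Q H) (h₄ : IsStagewise (pairs Q) Q H') :
    IsStagewise (pairs Q) Q (H ⊗ H') :=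
  h₃.tensor h₄ h.isUpwardDirected_pairs h₁ h₂ (fun _ => h.stagewise _) (fun _ => h.stagewise _)

end IsTensorClosed

omit [MonoidalCategory V] in
lemma pairs_le_fst (Q : ObjectProperty V) : pairs Q ≤ Q.inverseImage (fstObj V) :=
  fun _ h => h.1

omit [MonoidalCategory V] in
lemma pairs_le_snd (Q : ObjectProperty V) : pairs Q ≤ Q.inverseImage (sndObj V) :=
  fun _ h => h.2

omit [MonoidalCategory V] in
lemma hasColimits_of_isLocallyPresentable [IsLocallyPresentable.{v} V] :
    HasColimitsOfSize.{v, v} V := by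
  obtain ⟨κ, _, _⟩ := IsLocallyPresentable.exists_cardinal.{v} V
  infer_instance

-- A cocontinuous `H` keeps the canonical cocone a colimit, so maps out of `H x` are tested on small
-- pairs. This supplies the last hypothesis of the density theorem.
variable {V} in
omit [MonoidalCategory V] in
lemma pairs_hom_ext {Q : ObjectProperty V} (hQ : IsDenseProperty (pairs Q)) (H : V × V ⥤ V)
    [ObjectProperty.EssentiallySmall.{v} Q]
    [PreservesColimitsOfSize.{v, v} H] {x : V × V} {T : V} {f g : H.obj x ⟶ T}
    (h : ∀ c, pairs Q c → ∀ u : c ⟶ x, H.map u ≫ f = H.map u ≫ g) : f = g := by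
  have : PreservesColimitsOfShape (CostructuredArrow (pairs Q).ι x) H :=
    preservesColimitsOfShape_of_equiv (equivSmallModel.{v} _).symm H
  exact (isColimitOfPreserves H (hQ.nonempty_isColimit x).some).hom_ext fun j =>
    h _ j.left.property j.hom

variable {V} in
/-- A cocontinuous functor on the global category of comodules is a left adjoint. -/
theorem GlobalComod.isLeftAdjoint_of_preservesColimits [IsLocallyPresentable.{v} V]
    [∀ X : V, PreservesColimitsOfSize.{v, v} (tensorLeft X)]
    [∀ X : V, PreservesColimitsOfSize.{v, v} (tensorRight X)]
    {L : Type*} [Category.{v} L] (Ψ : GlobalComod V ⥤ L) [PreservesColimitsOfSize.{v, v} Ψ] :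
    Ψ.IsLeftAdjoint := by
  obtain ⟨Q, h, -⟩ := exists_isTensorClosed (fun i : PEmpty.{1} => i.elim (C := V))
  have := hasColimits_of_isLocallyPresentable V
  have : HasColimitsOfSize.{0, 0} V := hasColimitsOfSizeShrink.{0, 0, v, v} V
  have := h.essentiallySmall
  have := h.closed (Discrete WalkingPair)
  have := h.closed WalkingParallelPair
  have := h.closed ℕ
  let K := (Dialg.Satisfies (ComodDialg.lhs V) (ComodDialg.rhs V)).FullSubcategory
  have hs := Dialg.essentiallySmall_satisfies
    (Dialg.Satisfies (ComodDialg.lhs V) (ComodDialg.rhs V)) (pairs Q)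
  have hd : IsDenseProperty (Dialg.underlying (ComodDialg.lhs V) (ComodDialg.rhs V) (pairs Q)) := by
    have h₁ := h.isStagewise_pairs_fst
    have h₂ := h.isStagewise_pairs_snd
    have l₁ := pairs_le_fst V Q
    have l₂ := pairs_le_snd V Q
    have h₁₁ := h.isStagewise_pairs_tensor l₁ l₁ h₁ h₁
    have h₁₂ := h.isStagewise_pairs_tensor l₁ l₂ h₁ h₂
    have l₁₁ := h.pairs_le_tensor l₁ l₁
    have l₁₂ := h.pairs_le_tensor l₁ l₂
    -- The sources of operations and laws are projections; only the targets involve tensor products,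
    -- and these are handled by stages.
    refine Dialg.isDenseProperty_underlying (Q := Q) ?_ ?_ ?_ ?_ h.isDenseProperty_pairs ?_
    · rintro (_ | _ | _) <;> assumption
    · rintro (_ | _ | _)
      · exact h.isStagewise_pairs_const _
      · exact h₁₁
      · exact h₁₂
    · rintro (_ | _ | _ | _ | _) <;> assumption
    · rintro (_ | _ | _ | _ | _)
      · exact h₁
      · exact h₁
      · exact h.isStagewise_pairs_tensor l₁ l₁₁ h₁ h₁₁
      · exact h₂
      · exact h.isStagewise_pairs_tensor l₁ l₁₂ h₁ h₁₂
    · intro i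
      have : PreservesColimitsOfSize.{v, v} (ComodOp.src V i) := ⟨inferInstance⟩
      exact fun {x T f g} => pairs_hom_ext h.isDenseProperty_pairs (ComodOp.src V i)
  have : HasColimitsOfSize.{v, v} K := ⟨fun _ _ => inferInstance⟩
  let e := (ComodDialg.functor V).asEquivalence
  have := hd.isLeftAdjoint (e.inverse ⋙ Ψ)
  exact Functor.isLeftAdjoint_of_iso (e.funInvIdAssoc Ψ)

end Comodules

/-! ### Coherence for composites of measurings -/

section MeasuringAux

variable {V : Type u} [Category.{v} V] [MonoidalCategory V] [SymmetricCategory V]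

/-- Independent objects allow one computation to serve both the multiplication law and the action
law of a composite. The essential input is `tensor_associativity`, which reconciles the two ways of
shuffling three pairs of factors. -/
lemma measuring_comp_aux {A M B N E L C X D Y : V} (d : X ⟶ C ⊗ X) (d' : Y ⟶ D ⊗ Y)
    (a' : B ⊗ N ⟶ N) (a'' : E ⊗ L ⟶ L) (f : A ⊗ C ⟶ B) (g : M ⊗ X ⟶ N) (f' : B ⊗ D ⟶ E)
    (g' : N ⊗ Y ⟶ L)
    (h : a' ▷ Y ≫ g' = (B ⊗ N) ◁ d' ≫ tensorμ B N D Y ≫ (f' ⊗ₘ g') ≫ a'') :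
    ((A ⊗ M) ◁ d ≫ tensorμ A M C X ≫ (f ⊗ₘ g) ≫ a') ▷ Y ≫ g' =
      (α_ (A ⊗ M) X Y).hom ≫ (A ⊗ M) ◁ ((d ⊗ₘ d') ≫ tensorμ C X D Y) ≫
        tensorμ A M (C ⊗ D) (X ⊗ Y) ≫
          (((α_ A C D).inv ≫ f ▷ D ≫ f') ⊗ₘ ((α_ M X Y).inv ≫ g ▷ Y ≫ g')) ≫ a'' := by
  have e₁ := tensor_associativity A M C X D Y
  have e₂ : (((α_ A C D).inv ≫ f ▷ D ≫ f') ⊗ₘ ((α_ M X Y).inv ≫ g ▷ Y ≫ g')) =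
      ((α_ A C D).inv ⊗ₘ (α_ M X Y).inv) ≫ (f ▷ D ⊗ₘ g ▷ Y) ≫ (f' ⊗ₘ g') := by
    rw [tensorHom_comp_tensorHom, tensorHom_comp_tensorHom]
  have e₃ : ((α_ A C D).hom ⊗ₘ (α_ M X Y).hom) ≫ ((α_ A C D).inv ⊗ₘ (α_ M X Y).inv) = 𝟙 _ := by
    rw [tensorHom_comp_tensorHom, Iso.hom_inv_id, Iso.hom_inv_id, id_tensorHom_id]
  have e₄ : ((A ⊗ M) ◁ d) ▷ Y ≫ ((A ⊗ M) ⊗ (C ⊗ X)) ◁ d' ≫ (α_ _ _ _).hom =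
      (α_ (A ⊗ M) X Y).hom ≫ (A ⊗ M) ◁ (d ⊗ₘ d') := by
    rw [MonoidalCategory.tensorHom_def]
    simp
  simp only [comp_whiskerRight, Category.assoc, MonoidalCategory.whiskerLeft_comp]
  rw [h, ← whisker_exchange_assoc, tensorμ_natural_left_assoc, ← whisker_exchange_assoc, e₂,
    ← reassoc_of% e₄]
  simp only [Category.assoc]
  rw [← reassoc_of% e₁, reassoc_of% e₃]

omit [SymmetricCategory V] in
lemma measuring_one_aux {B E C D : V} (e : C ⟶ 𝟙_ V) (e' : D ⟶ 𝟙_ V) (i' : 𝟙_ V ⟶ B)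
    (i'' : 𝟙_ V ⟶ E) (f' : B ⊗ D ⟶ E)
    (h : i' ▷ D ≫ f' = (λ_ D).hom ≫ e' ≫ i'') :
    ((λ_ C).hom ≫ e ≫ i') ▷ D ≫ f' =
      (α_ (𝟙_ V) C D).hom ≫ (λ_ (C ⊗ D)).hom ≫ ((e ⊗ₘ e') ≫ (λ_ (𝟙_ V)).hom) ≫ i'' := by
  simp only [comp_whiskerRight, Category.assoc, h]
  rw [MonoidalCategory.tensorHom_def]
  simp

end MeasuringAux

/-! ### Measurings, restriction and composition -/

section Measuring

variable {V : Type u} [Category.{v} V] [MonoidalCategory V] [SymmetricCategory V]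

/-- A measuring of `M` to `N` by the comodule `X`: morphisms `A ⊗ C ⟶ B` and `M ⊗ X ⟶ N` that are
compatible with the monoid and module structures in the sense of Sweedler. -/
@[ext]
structure Measuring (X : GlobalComod V) (M N : GlobalMod V) where
  /-- The pairing with the comonoid. -/
  base : M.base.X ⊗ X.base.X ⟶ N.base.X
  /-- The pairing with the comodule. -/
  hom : M.X ⊗ X.X ⟶ N.X
  one : η[M.base.X] ▷ X.base.X ≫ base = (λ_ X.base.X).hom ≫ ε[X.base.X] ≫ η[N.base.X]
  mul : μ[M.base.X] ▷ X.base.X ≫ base = (M.base.X ⊗ M.base.X) ◁ Δ[X.base.X] ≫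
    tensorμ M.base.X M.base.X X.base.X X.base.X ≫ (base ⊗ₘ base) ≫ μ[N.base.X]
  act : M.act ▷ X.X ≫ hom = (M.base.X ⊗ M.X) ◁ X.coact ≫
    tensorμ M.base.X M.X X.base.X X.X ≫ (base ⊗ₘ hom) ≫ N.act

namespace Measuring

lemma counit_tensor (X Y : GlobalComod V) :
    ε[(X ⊗ Y).base.X] = (ε[X.base.X] ⊗ₘ ε[Y.base.X]) ≫ (λ_ (𝟙_ V)).hom :=
  Comon.tensorObj_counit X.base.X Y.base.X

lemma comul_tensor (X Y : GlobalComod V) :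
    Δ[(X ⊗ Y).base.X] = (Δ[X.base.X] ⊗ₘ Δ[Y.base.X]) ≫
      tensorμ X.base.X X.base.X Y.base.X Y.base.X :=
  Comon.tensorObj_comul X.base.X Y.base.X

variable {X X' Y Y' Z : GlobalComod V} {K L L' M M' N N' : GlobalMod V}

/-- Restriction of a measuring along a morphism of comodules. -/
@[simps]
def restrict (m : Measuring X M N) (f : X' ⟶ X) : Measuring X' M N where
  base := M.base.X ◁ f.base.hom ≫ m.base
  hom := M.X ◁ f.hom ≫ m.hom
  one := by
    rw [← whisker_exchange_assoc, m.one]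
    simp
  mul := by
    rw [← whisker_exchange_assoc, m.mul, ← MonoidalCategory.whiskerLeft_comp_assoc,
      IsComonHom.hom_comul, MonoidalCategory.whiskerLeft_comp_assoc, tensorμ_natural_right_assoc,
      tensorHom_comp_tensorHom_assoc]
  act := by
    rw [← whisker_exchange_assoc, m.act, ← MonoidalCategory.whiskerLeft_comp_assoc,
      ← GlobalComod.coact_tensorHom, MonoidalCategory.whiskerLeft_comp_assoc,
      tensorμ_natural_right_assoc, tensorHom_comp_tensorHom_assoc]

/-- Composition of a measuring with a morphism of modules on the left. -/
@[simps]
def precomp (g : L ⟶ M) (m : Measuring X M N) : Measuring X L N where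
  base := g.base.hom ▷ X.base.X ≫ m.base
  hom := g.hom ▷ X.X ≫ m.hom
  one := by rw [← comp_whiskerRight_assoc, IsMonHom.one_hom, m.one]
  mul := by
    rw [← comp_whiskerRight_assoc, IsMonHom.mul_hom, comp_whiskerRight_assoc, m.mul,
      ← whisker_exchange_assoc, tensorμ_natural_left_assoc, tensorHom_comp_tensorHom_assoc]
  act := by
    rw [← comp_whiskerRight_assoc, GlobalMod.act_tensorHom, comp_whiskerRight_assoc, m.act,
      ← whisker_exchange_assoc, tensorμ_natural_left_assoc, tensorHom_comp_tensorHom_assoc]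

/-- Composition of a measuring with a morphism of modules on the right. -/
@[simps]
def postcomp (m : Measuring X M N) (g : N ⟶ L) : Measuring X M L where
  base := m.base ≫ g.base.hom
  hom := m.hom ≫ g.hom
  one := by rw [← Category.assoc, m.one]; simp
  mul := by
    rw [← Category.assoc, m.mul]
    simp only [Category.assoc, IsMonHom.mul_hom]
    rw [tensorHom_comp_tensorHom_assoc]
  act := by
    rw [← Category.assoc, m.act]
    simp only [Category.assoc]
    rw [GlobalMod.act_tensorHom, tensorHom_comp_tensorHom_assoc]

/-- The composite of two measurings. -/
@[simps]
def comp (m : Measuring X L M) (n : Measuring Y M N) : Measuring (X ⊗ Y) L N where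
  base := (α_ L.base.X X.base.X Y.base.X).inv ≫ m.base ▷ Y.base.X ≫ n.base
  hom := (α_ L.X X.X Y.X).inv ≫ m.hom ▷ Y.X ≫ n.hom
  one := by
    have h := measuring_one_aux ε[X.base.X] ε[Y.base.X] η[M.base.X] η[N.base.X] n.base n.one
    rw [← m.one, comp_whiskerRight, Category.assoc, ← counit_tensor] at h
    exact (associator_inv_naturality_left_assoc _ _ _ _).trans ((Iso.inv_comp_eq _).2 h)
  mul := by
    have h := measuring_comp_aux Δ[X.base.X] Δ[Y.base.X] μ[M.base.X] μ[N.base.X] m.base m.base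
      n.base n.base n.mul
    rw [← m.mul, comp_whiskerRight, Category.assoc, ← comul_tensor] at h
    exact (associator_inv_naturality_left_assoc _ _ _ _).trans ((Iso.inv_comp_eq _).2 h)
  act := by
    have h := measuring_comp_aux X.coact Y.coact M.act N.act m.base m.hom
      n.base n.hom n.act
    rw [← m.act, comp_whiskerRight, Category.assoc] at h
    exact (associator_inv_naturality_left_assoc _ _ _ _).trans ((Iso.inv_comp_eq _).2 h)

end Measuring

end Measuring

/-! ### Unit and associativity laws for measurings -/

section

variable {V : Type u} [Category.{v} V] [MonoidalCategory V] [SymmetricCategory V]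

lemma comon_associator_inv (C D E : Comon V) : (α_ C D E).inv.hom = (α_ C.X D.X E.X).inv := by
  have h : (Comon.forget V).mapIso (α_ C D E) = α_ C.X D.X E.X := Iso.ext (comon_associator C D E)
  exact congrArg Iso.inv h

lemma comon_leftUnitor_inv (C : Comon V) : (λ_ C).inv.hom = (λ_ C.X).inv := by
  have h : (Comon.forget V).mapIso (λ_ C) = λ_ C.X := Iso.ext (comon_leftUnitor C)
  exact congrArg Iso.inv h

lemma comon_rightUnitor_inv (C : Comon V) : (ρ_ C).inv.hom = (ρ_ C.X).inv := by
  have h : (Comon.forget V).mapIso (ρ_ C) = ρ_ C.X := Iso.ext (comon_rightUnitor C)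
  exact congrArg Iso.inv h

omit [SymmetricCategory V] in
lemma pairing_assoc {K L M N X Y Z : V} (f : K ⊗ X ⟶ L) (g : L ⊗ Y ⟶ M) (h : M ⊗ Z ⟶ N) :
    K ◁ (α_ X Y Z).inv ≫ (α_ K (X ⊗ Y) Z).inv ≫ ((α_ K X Y).inv ≫ f ▷ Y ≫ g) ▷ Z ≫ h =
      (α_ K X (Y ⊗ Z)).inv ≫ f ▷ (Y ⊗ Z) ≫ (α_ L Y Z).inv ≫ g ▷ Z ≫ h := by
  simp

omit [SymmetricCategory V] in
lemma pairing_rightUnitor {K L M X : V} (f : K ⊗ X ⟶ L) (g : L ⟶ M) :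
    K ◁ (ρ_ X).inv ≫ (α_ K X (𝟙_ V)).inv ≫ f ▷ 𝟙_ V ≫ (ρ_ L).hom ≫ g = f ≫ g := by
  simp

omit [SymmetricCategory V] in
lemma pairing_leftUnitor {K L M X : V} (f : L ⊗ X ⟶ M) (g : K ⟶ L) :
    K ◁ (λ_ X).inv ≫ (α_ K (𝟙_ V) X).inv ≫ ((ρ_ K).hom ≫ g) ▷ X ≫ f = g ▷ X ≫ f := by
  simp

/-- For the unit comodule the shuffle collapses to unitors by `tensor_right_unitality`. Hence
measurings by the unit are exactly morphisms of modules, which identifies the underlying category of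
the enrichment. -/
lemma pairing_unit_iff {A M B N : V} (a : A ⊗ M ⟶ M) (a' : B ⊗ N ⟶ N) (f : A ⟶ B) (g : M ⟶ N) :
    a ▷ 𝟙_ V ≫ (ρ_ M).hom ≫ g = (A ⊗ M) ◁ (λ_ (𝟙_ V)).inv ≫ tensorμ A M (𝟙_ V) (𝟙_ V) ≫
        (((ρ_ A).hom ≫ f) ⊗ₘ ((ρ_ M).hom ≫ g)) ≫ a' ↔ a ≫ g = (f ⊗ₘ g) ≫ a' := by
  rw [← tensorHom_comp_tensorHom_assoc, ← reassoc_of% (tensor_right_unitality A M),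
    rightUnitor_naturality_assoc, cancel_epi]

omit [SymmetricCategory V] in
lemma pairing_unit_one_iff {A B : V} (i : 𝟙_ V ⟶ A) (i' : 𝟙_ V ⟶ B) (f : A ⟶ B) :
    i ▷ 𝟙_ V ≫ (ρ_ A).hom ≫ f = (λ_ (𝟙_ V)).hom ≫ 𝟙 (𝟙_ V) ≫ i' ↔ i ≫ f = i' := by
  rw [rightUnitor_naturality_assoc, unitors_equal, cancel_epi, Category.id_comp]

namespace Measuring

variable {W X X' Y Y' Z : GlobalComod V} {K L L' M M' N N' : GlobalMod V}

lemma restrict_comp_restrict (m : Measuring X L M) (n : Measuring Y M N) (f : X' ⟶ X)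
    (g : Y' ⟶ Y) : (m.restrict f).comp (n.restrict g) = (m.comp n).restrict (f ⊗ₘ g) := by
  ext
  · change (α_ _ _ _).inv ≫ (L.base.X ◁ f.base.hom ≫ m.base) ▷ Y'.base.X ≫
      M.base.X ◁ g.base.hom ≫ n.base = L.base.X ◁ (f.base.hom ⊗ₘ g.base.hom) ≫
        (α_ _ _ _).inv ≫ m.base ▷ _ ≫ n.base
    rw [MonoidalCategory.tensorHom_def, comp_whiskerRight_assoc, ← whisker_exchange_assoc]
    simp
  · change (α_ _ _ _).inv ≫ (L.X ◁ f.hom ≫ m.hom) ▷ Y'.X ≫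
      M.X ◁ g.hom ≫ n.hom = L.X ◁ (f.hom ⊗ₘ g.hom) ≫ (α_ _ _ _).inv ≫ m.hom ▷ _ ≫ n.hom
    rw [MonoidalCategory.tensorHom_def, comp_whiskerRight_assoc, ← whisker_exchange_assoc]
    simp

lemma restrict_precomp (m : Measuring X M N) (f : Y ⟶ X) (g : L ⟶ M) :
    (m.restrict f).precomp g = (m.precomp g).restrict f := by
  ext
  · simp [whisker_exchange_assoc]
  · simp [whisker_exchange_assoc]

lemma restrict_postcomp (m : Measuring X M N) (f : Y ⟶ X) (g : N ⟶ L) :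
    (m.restrict f).postcomp g = (m.postcomp g).restrict f := by
  ext <;> simp

lemma postcomp_comp (m : Measuring X L M) (n : Measuring Y M' N) (g : M ⟶ M') :
    (m.postcomp g).comp n = m.comp (n.precomp g) := by
  ext <;> simp

lemma comp_assoc (m : Measuring X K L) (n : Measuring Y L M) (p : Measuring Z M N) :
    ((m.comp n).comp p).restrict (α_ X Y Z).inv = m.comp (n.comp p) := by
  ext
  · refine Eq.trans ?_ (pairing_assoc m.base n.base p.base)
    exact congrArg (fun k => K.base.X ◁ k ≫ _) (comon_associator_inv X.base Y.base Z.base)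
  · exact pairing_assoc m.hom n.hom p.hom

/-- The measuring by the unit that corresponds to a morphism of modules. -/
def ofMod (f : M ⟶ N) : Measuring (𝟙_ (GlobalComod V)) M N where
  base := (ρ_ M.base.X).hom ≫ f.base.hom
  hom := (ρ_ M.X).hom ≫ f.hom
  one := (pairing_unit_one_iff _ _ _).2 (IsMonHom.one_hom f.base.hom)
  mul := (pairing_unit_iff _ _ _ _).2 (IsMonHom.mul_hom f.base.hom)
  act := (pairing_unit_iff _ _ _ _).2 (GlobalMod.act_tensorHom f)

lemma ofMod_injective : Function.Injective (ofMod : (M ⟶ N) → _) := by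
  intro f g h
  ext
  · exact (cancel_epi (ρ_ M.base.X).hom).1 (congrArg Measuring.base h)
  · exact (cancel_epi (ρ_ M.X).hom).1 (congrArg Measuring.hom h)

lemma ofMod_surjective (m : Measuring (𝟙_ (GlobalComod V)) M N) : ∃ f, ofMod f = m := by
  have e {A B : V} (k : A ⊗ 𝟙_ V ⟶ B) : (ρ_ A).hom ≫ (ρ_ A).inv ≫ k = k := by simp
  have hb : (ρ_ M.base.X).hom ≫ (ρ_ M.base.X).inv ≫ m.base = m.base := e _
  have hk : (ρ_ M.X).hom ≫ (ρ_ M.X).inv ≫ m.hom = m.hom := e _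
  refine ⟨⟨{ hom := (ρ_ M.base.X).inv ≫ m.base, isMonHom_hom :=
    ⟨(pairing_unit_one_iff _ _ _).1 ?_, (pairing_unit_iff _ _ _ _).1 ?_⟩ },
    (ρ_ M.X).inv ≫ m.hom, ?_⟩, Measuring.ext hb hk⟩
  · rw [hb]
    exact m.one
  · rw [hb]
    exact m.mul
  · have h := m.act
    rw [← hb, ← hk] at h
    exact ((pairing_unit_iff _ _ _ _).1 h).trans (by rw [tensorHom_def', Category.assoc])

lemma comp_ofMod (m : Measuring X L M) (f : M ⟶ N) :
    (m.comp (ofMod f)).restrict (ρ_ X).inv = m.postcomp f := by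
  ext
  · refine Eq.trans ?_ (pairing_rightUnitor m.base f.base.hom)
    exact congrArg (fun k => L.base.X ◁ k ≫ _) (comon_rightUnitor_inv X.base)
  · exact pairing_rightUnitor m.hom f.hom

lemma ofMod_comp (m : Measuring X M N) (f : L ⟶ M) :
    ((ofMod f).comp m).restrict (λ_ X).inv = m.precomp f := by
  ext
  · refine Eq.trans ?_ (pairing_leftUnitor m.base f.base.hom)
    exact congrArg (fun k => L.base.X ◁ k ≫ _) (comon_leftUnitor_inv X.base)
  · exact pairing_leftUnitor m.hom f.hom

lemma postcomp_id (m : Measuring X M N) : m.postcomp (𝟙 N) = m := by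
  ext <;> simp

lemma precomp_id (m : Measuring X M N) : m.precomp (𝟙 M) = m := by
  ext <;> simp

end Measuring

end

/-! ### Measurings as morphisms to convolution modules -/

section Closed

variable {V : Type u} [Category.{v} V] [MonoidalCategory V] [SymmetricCategory V]
  [MonoidalClosed V]

open MonoidalClosed

lemma pairing_ev_eq {A B D : V} (f : A ⟶ (ihom D).obj B) :
    f ▷ D ≫ (β_ _ _).hom ≫ uncurry (𝟙 ((ihom D).obj B)) = (β_ _ _).hom ≫ uncurry f := by
  rw [BraidedCategory.braiding_naturality_left_assoc, ← uncurry_natural_left, Category.comp_id]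

lemma pairing_ev_injective {A B D : V} {f g : A ⟶ (ihom D).obj B}
    (h : f ▷ D ≫ (β_ _ _).hom ≫ uncurry (𝟙 ((ihom D).obj B)) =
      g ▷ D ≫ (β_ _ _).hom ≫ uncurry (𝟙 ((ihom D).obj B))) : f = g := by
  rw [pairing_ev_eq, pairing_ev_eq, cancel_epi] at h
  exact uncurry_injective h

lemma exists_pairing_ev {A B D : V} (k : A ⊗ D ⟶ B) : ∃ f : A ⟶ (ihom D).obj B,
    f ▷ D ≫ (β_ _ _).hom ≫ uncurry (𝟙 ((ihom D).obj B)) = k :=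
  ⟨curry ((β_ D A).hom ≫ k), by
    rw [pairing_ev_eq, uncurry_curry, SymmetricCategory.symmetry_assoc]⟩

-- If the second pairing and the composite obey their laws, then the law of the first pairing holds
-- after composing with the second. Taking evaluation as the second pairing, this last composition
-- can be cancelled.
omit [MonoidalClosed V] in
lemma measuring_of_comp {A M B N E L C X D Y : V} (d : X ⟶ C ⊗ X) (d' : Y ⟶ D ⊗ Y)
    (a : A ⊗ M ⟶ M) (a' : B ⊗ N ⟶ N) (a'' : E ⊗ L ⟶ L) (f : A ⊗ C ⟶ B) (g : M ⊗ X ⟶ N)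
    (f' : B ⊗ D ⟶ E) (g' : N ⊗ Y ⟶ L)
    (h : a' ▷ Y ≫ g' = (B ⊗ N) ◁ d' ≫ tensorμ B N D Y ≫ (f' ⊗ₘ g') ≫ a'')
    (q₁ : A ⊗ (C ⊗ D) ⟶ E) (q₂ : M ⊗ (X ⊗ Y) ⟶ L) (hf : f ▷ D ≫ f' = (α_ A C D).hom ≫ q₁)
    (hg : g ▷ Y ≫ g' = (α_ M X Y).hom ≫ q₂)
    (hq : a ▷ (X ⊗ Y) ≫ q₂ = (A ⊗ M) ◁ ((d ⊗ₘ d') ≫ tensorμ C X D Y) ≫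
      tensorμ A M (C ⊗ D) (X ⊗ Y) ≫ (q₁ ⊗ₘ q₂) ≫ a'') :
    (a ▷ X ≫ g) ▷ Y ≫ g' =
      ((A ⊗ M) ◁ d ≫ tensorμ A M C X ≫ (f ⊗ₘ g) ≫ a') ▷ Y ≫ g' := by
  rw [measuring_comp_aux d d' a' a'' f g f' g' h, hf, hg, Iso.inv_hom_id_assoc,
    Iso.inv_hom_id_assoc, ← hq, comp_whiskerRight, Category.assoc, hg,
    associator_naturality_left_assoc]

omit [SymmetricCategory V] [MonoidalClosed V] in
lemma measuring_one_of_comp {A B E C D : V} (e : C ⟶ 𝟙_ V) (e' : D ⟶ 𝟙_ V) (i : 𝟙_ V ⟶ A)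
    (i' : 𝟙_ V ⟶ B) (i'' : 𝟙_ V ⟶ E) (f : A ⊗ C ⟶ B) (f' : B ⊗ D ⟶ E)
    (h : i' ▷ D ≫ f' = (λ_ D).hom ≫ e' ≫ i'') (q : A ⊗ (C ⊗ D) ⟶ E)
    (hf : f ▷ D ≫ f' = (α_ A C D).hom ≫ q)
    (hq : i ▷ (C ⊗ D) ≫ q = (λ_ (C ⊗ D)).hom ≫ ((e ⊗ₘ e') ≫ (λ_ (𝟙_ V)).hom) ≫ i'') :
    (i ▷ C ≫ f) ▷ D ≫ f' = ((λ_ C).hom ≫ e ≫ i') ▷ D ≫ f' := by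
  rw [measuring_one_aux e e' i' i'' f' h, ← hq, comp_whiskerRight, Category.assoc, hf,
    associator_naturality_left_assoc]

/-- Transposing removes the internal homs, and `tensorμ_braiding` accounts for the exchange of the
two sides: pairings have `X` on the right, whereas evaluation has it on the left. -/
lemma convolution_iff {A M B N C X : V} (a : A ⊗ M ⟶ M) (d : X ⟶ C ⊗ X) (a' : B ⊗ N ⟶ N)
    (f : A ⊗ C ⟶ B) (g : M ⊗ X ⟶ N) :
    a ≫ curry ((β_ X M).hom ≫ g) =
        (curry ((β_ C A).hom ≫ f) ⊗ₘ curry ((β_ X M).hom ≫ g)) ≫ convolution d a' ↔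
      a ▷ X ≫ g = (A ⊗ M) ◁ d ≫ tensorμ A M C X ≫ (f ⊗ₘ g) ≫ a' := by
  rw [← uncurry_injective.eq_iff, uncurry_convolution, uncurry_natural_left, uncurry_curry,
    uncurry_curry, ← tensorHom_comp_tensorHom_assoc, reassoc_of% (tensorμ_braiding C X A M),
    BraidedCategory.braiding_naturality_right_assoc,
    BraidedCategory.braiding_naturality_left_assoc, cancel_epi]

lemma convolutionUnit_iff {A B C : V} (i : 𝟙_ V ⟶ A) (e : C ⟶ 𝟙_ V) (i' : 𝟙_ V ⟶ B)
    (f : A ⊗ C ⟶ B) :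
    i ≫ curry ((β_ C A).hom ≫ f) = convolutionUnit e i' ↔
      i ▷ C ≫ f = (λ_ C).hom ≫ e ≫ i' := by
  rw [← uncurry_injective.eq_iff, convolutionUnit, uncurry_natural_left, uncurry_curry,
    uncurry_curry, BraidedCategory.braiding_naturality_right_assoc,
    ← braiding_leftUnitor C, Category.assoc, cancel_epi]

namespace Measuring

variable {W X X' Y Y' Z : GlobalComod V} {K L L' M M' N N' : GlobalMod V}

/-- The morphism to the convolution module that corresponds to a measuring. -/
@[simps]
def toHom (m : Measuring X M N) : M ⟶ homMod X N where
  base :=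
    { hom := curry ((β_ X.base.X M.base.X).hom ≫ m.base)
      isMonHom_hom :=
        { one_hom := (convolutionUnit_iff _ _ _ _).2 m.one
          mul_hom := (convolution_iff _ _ _ _ _).2 m.mul } }
  hom := curry ((β_ X.X M.X).hom ≫ m.hom)
  act_hom := by
    rw [← Category.assoc, ← tensorHom_def']
    exact (convolution_iff _ _ _ _ _).2 m.act

lemma braiding_uncurry_aux {A B C : V} (f : A ⟶ (ihom C).obj B) :
    curry ((β_ C A).hom ≫ (β_ A C).hom ≫ uncurry f) = f := by
  rw [SymmetricCategory.symmetry_assoc, curry_uncurry]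

/-- The measuring that corresponds to a morphism to the convolution module. -/
@[simps]
def ofHom (f : M ⟶ homMod X N) : Measuring X M N where
  base := (β_ M.base.X X.base.X).hom ≫ uncurry f.base.hom
  hom := (β_ M.X X.X).hom ≫ uncurry f.hom
  one := (convolutionUnit_iff _ _ _ _).1 (by
    rw [braiding_uncurry_aux]; exact IsMonHom.one_hom f.base.hom)
  mul := (convolution_iff _ _ _ _ _).1 (by
    rw [braiding_uncurry_aux]; exact IsMonHom.mul_hom f.base.hom)
  act := (convolution_iff _ _ _ _ _).1 (by
    rw [braiding_uncurry_aux, braiding_uncurry_aux]; exact GlobalMod.act_tensorHom f)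

/-- Measurings by `X` are morphisms to the convolution module. -/
def equivHom : Measuring X M N ≃ (M ⟶ homMod X N) where
  toFun := toHom
  invFun := ofHom
  left_inv m := by
    ext
    · simp
    · simp
  right_inv f := by
    ext
    · exact braiding_uncurry_aux _
    · exact braiding_uncurry_aux _

lemma ofHom_comp (g : L ⟶ M) (f : M ⟶ homMod X N) : ofHom (g ≫ f) = (ofHom f).precomp g := by
  ext
  · simp [uncurry_natural_left]
  · simp [uncurry_natural_left]

lemma ofHom_comp_map (f : M ⟶ homMod X N) (g : N ⟶ L) :
    ofHom (f ≫ ((homFunctor V).obj (op X)).map g) = (ofHom f).postcomp g := by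
  have e {A B C D : V} (f : A ⟶ (ihom C).obj B) (g : B ⟶ D) :
      uncurry (f ≫ ihomMap (𝟙 C) g) = uncurry f ≫ g := by
    rw [uncurry_natural_left, uncurry_ihomMap]
    simp [uncurry_eq]
  ext
  · exact (congrArg (_ ≫ ·) (e _ _)).trans (Category.assoc _ _ _).symm
  · exact (congrArg (_ ≫ ·) (e _ _)).trans (Category.assoc _ _ _).symm

lemma ofHom_comp_app (f : M ⟶ homMod X N) (g : Y ⟶ X) :
    ofHom (f ≫ ((homFunctor V).map g.op).app N) = (ofHom f).restrict g := by
  have e {A B C D : V} (f : A ⟶ (ihom C).obj B) (g : D ⟶ C) :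
      (β_ A D).hom ≫ uncurry (f ≫ ihomMap g (𝟙 B)) = A ◁ g ≫ (β_ A C).hom ≫ uncurry f := by
    rw [uncurry_natural_left, uncurry_ihomMap]
    refine (congrArg (fun k => (β_ A D).hom ≫ D ◁ f ≫ g ▷ _ ≫ k) (Category.comp_id _)).trans ?_
    rw [whisker_exchange_assoc,
      BraidedCategory.braiding_naturality_right_assoc, uncurry_eq]
  ext
  · exact e _ _
  · exact e _ _

variable (X N) in
/-- The universal measuring by `X` with values in `N`. -/
abbrev ev : Measuring X (homMod X N) N := ofHom (𝟙 _)

lemma ofHom_eq (f : M ⟶ homMod X N) : ofHom f = (ev X N).precomp f := by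
  rw [← ofHom_comp, Category.comp_id]

/-- This is currying, and the laws come along: pairing with evaluation is injective, so the laws of
the curried maps can be deduced from those of the composite. Both the tensors and the cotensors rest
on this bijection. -/
lemma comp_ev_bijective :
    Function.Bijective (fun m : Measuring X M (homMod Y N) => m.comp (ev Y N)) := by
  constructor
  · intro m m' h
    ext
    · exact pairing_ev_injective ((cancel_epi (α_ _ _ _).inv).1 (congrArg Measuring.base h))
    · exact pairing_ev_injective ((cancel_epi (α_ _ _ _).inv).1 (congrArg Measuring.hom h))
  · intro q
    obtain ⟨f, hf⟩ := exists_pairing_ev ((α_ M.base.X X.base.X Y.base.X).hom ≫ q.base)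
    obtain ⟨g, hg⟩ := exists_pairing_ev ((α_ M.X X.X Y.X).hom ≫ q.hom)
    let m : Measuring X M (homMod Y N) :=
      { base := f
        hom := g
        one := pairing_ev_injective (by
          have h := q.one
          rw [counit_tensor] at h
          exact measuring_one_of_comp _ _ _ _ _ _ _ (ev Y N).one _ hf h)
        mul := pairing_ev_injective (by
          have h := q.mul
          rw [comul_tensor] at h
          exact measuring_of_comp _ _ _ _ _ _ _ _ _ (ev Y N).mul _ _ hf hf h)
        act := pairing_ev_injective
          (measuring_of_comp _ _ _ _ _ _ _ _ _ (ev Y N).act _ _ hf hg q.act) }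
    exact ⟨m, Measuring.ext ((Iso.inv_comp_eq _).2 hf) ((Iso.inv_comp_eq _).2 hg)⟩

end Measuring

end Closed

/-! ### Small modules over a given module -/

section Modules

open Limits

/-- Since `ℕ` has the least element `0`, a cocone on a constant diagram is determined by its leg
there. The constant functor occurs as the source of the unit operation. -/
lemma preservesColimitsOfShape_nat_const {W V : Type*} [Category* W] [Category* V] (p : V) :
    PreservesColimitsOfShape ℕ ((Functor.const W).obj p) where
  preservesColimit {K} := ⟨fun {c} _ => ⟨{
    desc := fun s => s.ι.app 0
    fac := fun s n => by
      have h := s.ι.naturality (homOfLE (Nat.zero_le n))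
      have h' : 𝟙 p ≫ s.ι.app n = s.ι.app 0 ≫ 𝟙 _ := h
      rw [Category.id_comp, Category.comp_id] at h'
      exact (Category.id_comp _).trans h'.symm
    uniq := fun s m hm => (Category.id_comp _).symm.trans (hm 0) }⟩⟩

variable {V : Type u} [Category.{v} V] [MonoidalCategory V]

namespace IsTensorClosed

variable [HasColimitsOfSize.{v, v} V] {Q : ObjectProperty V} (h : IsTensorClosed Q)
include h

omit [HasColimitsOfSize.{v, v} V] in
lemma pairs_le_modOp_src (i : ModOp) : pairs Q ≤ Q.inverseImage (i.src V) := by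
  have l₁ := pairs_le_fst V Q
  have l₂ := pairs_le_snd V Q
  rcases i with _ | _ | _
  · exact fun _ _ => h.unit
  · exact h.pairs_le_tensor l₁ l₁
  · exact h.pairs_le_tensor l₁ l₂

omit [HasColimitsOfSize.{v, v} V] in
lemma pairs_le_modLaw_src (e : ModLaw) : pairs Q ≤ Q.inverseImage (e.src V) := by
  have l₁ := pairs_le_fst V Q
  have l₂ := pairs_le_snd V Q
  have l₁₁ := h.pairs_le_tensor l₁ l₁
  rcases e with _ | _ | _ | _ | _
  · exact l₁
  · exact l₁
  · exact h.pairs_le_tensor l₁₁ l₁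
  · exact l₂
  · exact h.pairs_le_tensor l₁₁ l₂

lemma isStagewise_modOp_tgt (i : ModOp) : IsStagewise (pairs Q) Q (i.tgt V) := by
  have h₁ := h.isStagewise_pairs_fst
  have h₂ := h.isStagewise_pairs_snd
  rcases i with _ | _ | _ <;> assumption

lemma isStagewise_modLaw_tgt (e : ModLaw) : IsStagewise (pairs Q) Q (e.tgt V) := by
  have h₁ := h.isStagewise_pairs_fst
  have h₂ := h.isStagewise_pairs_snd
  rcases e with _ | _ | _ | _ | _ <;> assumption

end IsTensorClosed

section

variable [HasColimitsOfShape ℕ V] [∀ X : V, PreservesColimitsOfShape ℕ (tensorLeft X)]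
  [∀ X : V, PreservesColimitsOfShape ℕ (tensorRight X)]

instance (i : ModOp) : PreservesColimitsOfShape ℕ (i.src V) := by
  rcases i with _ | _ | _
  · exact preservesColimitsOfShape_nat_const _
  · dsimp only [ModOp.src]; infer_instance
  · dsimp only [ModOp.src]; infer_instance

instance (e : ModLaw) : PreservesColimitsOfShape ℕ (e.src V) := by
  rcases e with _ | _ | _ | _ | _ <;> (dsimp only [ModLaw.src]; infer_instance)

end

variable [HasColimitsOfSize.{v, v} V] {Q : ObjectProperty V} (h : IsTensorClosed Q)
  [∀ X : V, PreservesColimitsOfSize.{v, v} (tensorLeft X)]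
  [∀ X : V, PreservesColimitsOfSize.{v, v} (tensorRight X)]
include h

lemma GlobalMod.exists_of_obj {N : GlobalMod V} {c : V × V} (hc : pairs Q c)
    (u : c ⟶ (GlobalMod.forget V).obj N) :
    ∃ (N' : GlobalMod V) (_ : pairs Q ((GlobalMod.forget V).obj N')) (f : N' ⟶ N)
      (w : c ⟶ (GlobalMod.forget V).obj N'), w ≫ (GlobalMod.forget V).map f = u := by
  have : HasColimitsOfSize.{0, 0} V := hasColimitsOfSizeShrink.{0, 0, v, v} V
  have (X : V) : PreservesColimitsOfSize.{0, 0} (tensorLeft X) :=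
    preservesColimitsOfSize_shrink.{0, v, 0, v} _
  have (X : V) : PreservesColimitsOfSize.{0, 0} (tensorRight X) :=
    preservesColimitsOfSize_shrink.{0, v, 0, v} _
  have := h.closed ℕ
  obtain ⟨D, hD, hs, f, w, hw⟩ := Dialg.exists_satisfies_of_obj h.isUpwardDirected_pairs
    h.pairs_le_modOp_src h.isStagewise_modOp_tgt h.pairs_le_modLaw_src h.isStagewise_modLaw_tgt
    (ModDialg.satisfies_of N) hc u
  obtain ⟨N', rfl⟩ := ModDialg.exists_of_eq hs
  obtain ⟨f', hf'⟩ := (ModDialg.functor V).map_surjective (X := N') (Y := N)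
    (ObjectProperty.homMk f)
  obtain rfl : ((ModDialg.functor V).map f').hom = f := congrArg (fun k => k.hom) hf'
  exact ⟨N', hD, f', w, hw⟩

/-- The coequalizer of `p` and `p'` on carriers is not a module, but it is small and lies over `N`,
so it is completed to a small module under `N'`. -/
lemma GlobalMod.exists_of_hom {N N' : GlobalMod V} (hN' : pairs Q ((GlobalMod.forget V).obj N'))
    (f : N' ⟶ N) {c : V × V} (hc : pairs Q c) (p p' : c ⟶ (GlobalMod.forget V).obj N')
    (hp : p ≫ (GlobalMod.forget V).map f = p' ≫ (GlobalMod.forget V).map f) :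
    ∃ (N'' : GlobalMod V) (_ : pairs Q ((GlobalMod.forget V).obj N'')) (g : N' ⟶ N'')
      (f' : N'' ⟶ N), g ≫ f' = f ∧
        p ≫ (GlobalMod.forget V).map g = p' ≫ (GlobalMod.forget V).map g := by
  have : HasColimitsOfSize.{0, 0} V := hasColimitsOfSizeShrink.{0, 0, v, v} V
  have (X : V) : PreservesColimitsOfSize.{0, 0} (tensorLeft X) :=
    preservesColimitsOfSize_shrink.{0, v, 0, v} _
  have (X : V) : PreservesColimitsOfSize.{0, 0} (tensorRight X) :=
    preservesColimitsOfSize_shrink.{0, v, 0, v} _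
  have := h.closed ℕ
  have := h.closed WalkingParallelPair
  have hq : pairs Q (coequalizer p p') :=
    (pairs Q).prop_colimit _ (by rintro (_ | _) <;> assumption)
  obtain ⟨D, hD, hs, g, f₁, w, -, hg, hf⟩ := Dialg.exists_satisfies_of_hom
    h.isUpwardDirected_pairs h.pairs_le_modOp_src h.isStagewise_modOp_tgt h.pairs_le_modLaw_src
    h.isStagewise_modLaw_tgt (ModDialg.satisfies_of N) (D := ModDialg.of N') hN'
    ((ModDialg.functor V).map f).hom hq (coequalizer.π p p') (coequalizer.desc _ hp)
    (coequalizer.π_desc _ _)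
  obtain ⟨N'', rfl⟩ := ModDialg.exists_of_eq hs
  obtain ⟨f', hf'⟩ := (ModDialg.functor V).map_surjective (X := N'') (Y := N)
    (ObjectProperty.homMk f₁)
  obtain ⟨g', hg'⟩ := (ModDialg.functor V).map_surjective (X := N') (Y := N'')
    (ObjectProperty.homMk g)
  obtain rfl : ((ModDialg.functor V).map f').hom = f₁ := congrArg (fun k => k.hom) hf'
  obtain rfl : ((ModDialg.functor V).map g').hom = g := congrArg (fun k => k.hom) hg'
  refine ⟨N'', hD, g', f', (ModDialg.functor V).map_injective ?_, ?_⟩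
  · ext1
    exact hf
  · have e : coequalizer.π p p' ≫ w = (GlobalMod.forget V).map g' := hg
    rw [← e, coequalizer.condition_assoc]

end Modules

/-! ### Factoring a measuring through a small module -/

section Measuring

open Limits

variable {V : Type u} [Category.{v} V] [MonoidalCategory V] [SymmetricCategory V]

lemma measuring_postcomp_aux {A M B N B' N' C X : V} (d : X ⟶ C ⊗ X) (a : B ⊗ N ⟶ N)
    (a' : B' ⊗ N' ⟶ N') (b : A ⊗ C ⟶ B) (k : M ⊗ X ⟶ N) (f : B ⟶ B') (g : N ⟶ N')
    (h : a ≫ g = (f ⊗ₘ g) ≫ a') :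
    ((A ⊗ M) ◁ d ≫ tensorμ A M C X ≫ (b ⊗ₘ k) ≫ a) ≫ g =
      (A ⊗ M) ◁ d ≫ tensorμ A M C X ≫ (b ≫ f ⊗ₘ k ≫ g) ≫ a' := by
  rw [← tensorHom_comp_tensorHom]
  simp only [Category.assoc, h]

variable [HasColimitsOfSize.{v, v} V] {Q : ObjectProperty V} (h : IsTensorClosed Q)
  [∀ X : V, PreservesColimitsOfSize.{v, v} (tensorLeft X)]
  [∀ X : V, PreservesColimitsOfSize.{v, v} (tensorRight X)]
include h

/-- A small module first captures the two pairings as bare maps. The measuring laws hold there only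
after mapping to `N`, but their sources are small, so they can be enforced by enlarging the module.
-/
lemma Measuring.exists_factorization {X : GlobalComod V} {M N : GlobalMod V}
    (hX : pairs Q ((GlobalComod.forget V).obj X)) (hM : pairs Q ((GlobalMod.forget V).obj M))
    (m : Measuring X M N) :
    ∃ (N' : GlobalMod V) (_ : pairs Q ((GlobalMod.forget V).obj N')) (f : N' ⟶ N)
      (m' : Measuring X M N'), m'.postcomp f = m := by
  have hAC := h.tensor _ _ hM.1 hX.1
  have hMX := h.tensor _ _ hM.2 hX.2
  obtain ⟨N₁, hN₁, f₁, w, hw⟩ := GlobalMod.exists_of_obj h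
    (c := (M.base.X ⊗ X.base.X, M.X ⊗ X.X)) ⟨hAC, hMX⟩
    (u := CategoryTheory.Prod.mkHom m.base m.hom)
  have hw₁ : w.1 ≫ f₁.base.hom = m.base := congrArg Prod.fst hw
  have hw₂ : w.2 ≫ f₁.hom = m.hom := congrArg Prod.snd hw
  -- A pair has one slot for each component, so the unit law and the action law are enforced
  -- together; the multiplication law has values in the monoid again and needs a second round.
  obtain ⟨N₂, hN₂, g₁, f₂, rfl, hg₁⟩ := GlobalMod.exists_of_hom h hN₁ f₁
    (c := (𝟙_ V ⊗ X.base.X, (M.base.X ⊗ M.X) ⊗ X.X))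
    ⟨h.tensor _ _ h.unit hX.1, h.tensor _ _ (h.tensor _ _ hM.1 hM.2) hX.2⟩
    (CategoryTheory.Prod.mkHom (η[M.base.X] ▷ X.base.X ≫ w.1) (M.act ▷ X.X ≫ w.2))
    (CategoryTheory.Prod.mkHom ((λ_ X.base.X).hom ≫ ε[X.base.X] ≫ η[N₁.base.X])
      ((M.base.X ⊗ M.X) ◁ X.coact ≫ tensorμ M.base.X M.X X.base.X X.X ≫ (w.1 ⊗ₘ w.2) ≫ N₁.act))
    (Prod.ext (by
      change (η[M.base.X] ▷ X.base.X ≫ w.1) ≫ f₁.base.hom =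
        ((λ_ X.base.X).hom ≫ ε[X.base.X] ≫ η[N₁.base.X]) ≫ f₁.base.hom
      simp only [Category.assoc]
      rw [IsMonHom.one_hom, hw₁]
      exact m.one) (by
      change (M.act ▷ X.X ≫ w.2) ≫ f₁.hom = (_ ≫ _ ≫ _ ≫ _) ≫ f₁.hom
      rw [measuring_postcomp_aux _ _ _ _ _ _ _ (GlobalMod.act_tensorHom f₁), Category.assoc,
        hw₁, hw₂]
      exact m.act))
  have hg₂ : (η[M.base.X] ▷ X.base.X ≫ w.1) ≫ g₁.base.hom =
    ((λ_ X.base.X).hom ≫ ε[X.base.X] ≫ η[N₁.base.X]) ≫ g₁.base.hom := congrArg Prod.fst hg₁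
  have hg₃ : (M.act ▷ X.X ≫ w.2) ≫ g₁.hom = ((M.base.X ⊗ M.X) ◁ X.coact ≫
    tensorμ M.base.X M.X X.base.X X.X ≫ (w.1 ⊗ₘ w.2) ≫ N₁.act) ≫ g₁.hom := congrArg Prod.snd hg₁
  obtain ⟨b, hb⟩ : ∃ b, b = w.1 ≫ g₁.base.hom := ⟨_, rfl⟩
  obtain ⟨k, hk⟩ : ∃ k, k = w.2 ≫ g₁.hom := ⟨_, rfl⟩
  have hb₂ : b ≫ f₂.base.hom = m.base := by
    rw [← hw₁, hb, Category.assoc]; rfl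
  have hk₂ : k ≫ f₂.hom = m.hom := by
    rw [← hw₂, hk, Category.assoc]; rfl
  have h₁ : η[M.base.X] ▷ X.base.X ≫ b = (λ_ X.base.X).hom ≫ ε[X.base.X] ≫ η[N₂.base.X] := by
    rw [hb, ← Category.assoc, hg₂]
    simp only [Category.assoc, IsMonHom.one_hom]
  have h₂ : M.act ▷ X.X ≫ k = (M.base.X ⊗ M.X) ◁ X.coact ≫
      tensorμ M.base.X M.X X.base.X X.X ≫ (b ⊗ₘ k) ≫ N₂.act := by
    rw [measuring_postcomp_aux _ _ _ _ _ _ _ (GlobalMod.act_tensorHom g₁), Category.assoc] at hg₃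
    rw [hb, hk, hg₃]
  -- The second slot carries `k` on both sides, so no condition is imposed there. The laws obtained
  -- before persist along `g₂`.
  obtain ⟨N₃, hN₃, g₂, f₃, rfl, hg₄⟩ := GlobalMod.exists_of_hom h hN₂ f₂
    (c := ((M.base.X ⊗ M.base.X) ⊗ X.base.X, M.X ⊗ X.X))
    ⟨h.tensor _ _ (h.tensor _ _ hM.1 hM.1) hX.1, hMX⟩
    (CategoryTheory.Prod.mkHom (μ[M.base.X] ▷ X.base.X ≫ b) k)
    (CategoryTheory.Prod.mkHom ((M.base.X ⊗ M.base.X) ◁ Δ[X.base.X] ≫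
      tensorμ M.base.X M.base.X X.base.X X.base.X ≫ (b ⊗ₘ b) ≫ μ[N₂.base.X]) k)
    (Prod.ext (by
      change (μ[M.base.X] ▷ X.base.X ≫ b) ≫ f₂.base.hom = (_ ≫ _ ≫ _ ≫ _) ≫ f₂.base.hom
      rw [measuring_postcomp_aux _ _ _ _ _ _ _ (IsMonHom.mul_hom f₂.base.hom), Category.assoc,
        hb₂]
      exact m.mul) rfl)
  have hg₅ : (μ[M.base.X] ▷ X.base.X ≫ b) ≫ g₂.base.hom = ((M.base.X ⊗ M.base.X) ◁ Δ[X.base.X] ≫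
      tensorμ M.base.X M.base.X X.base.X X.base.X ≫ (b ⊗ₘ b) ≫ μ[N₂.base.X]) ≫ g₂.base.hom :=
    congrArg Prod.fst hg₄
  rw [measuring_postcomp_aux _ _ _ _ _ _ _ (IsMonHom.mul_hom g₂.base.hom), Category.assoc] at hg₅
  refine ⟨N₃, hN₃, f₃, ⟨b ≫ g₂.base.hom, k ≫ g₂.hom, ?_, hg₅, ?_⟩, ?_⟩
  · rw [← Category.assoc, h₁]
    simp only [Category.assoc, IsMonHom.one_hom]
  · rw [← Category.assoc, h₂, measuring_postcomp_aux _ _ _ _ _ _ _ (GlobalMod.act_tensorHom g₂)]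
  · ext
    · exact (Category.assoc _ _ _).trans hb₂
    · exact (Category.assoc _ _ _).trans hk₂

end Measuring

/-! ### Preservation of limits and colimits, checked on components -/

section Prod

open Limits

variable {J A C D : Type*} [Category* J] [Category* A] [Category* C] [Category* D] (F : A ⥤ C × D)

lemma preservesLimitsOfShape_of_prod
    [PreservesLimitsOfShape J (F ⋙ CategoryTheory.Prod.fst C D)]
    [PreservesLimitsOfShape J (F ⋙ CategoryTheory.Prod.snd C D)] :
    PreservesLimitsOfShape J F where
  preservesLimit := ⟨fun hc => ⟨prodIsLimit
    (isLimitOfPreserves (F ⋙ CategoryTheory.Prod.fst C D) hc)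
    (isLimitOfPreserves (F ⋙ CategoryTheory.Prod.snd C D) hc)⟩⟩

lemma preservesColimitsOfShape_of_prod
    [PreservesColimitsOfShape J (F ⋙ CategoryTheory.Prod.fst C D)]
    [PreservesColimitsOfShape J (F ⋙ CategoryTheory.Prod.snd C D)] :
    PreservesColimitsOfShape J F where
  preservesColimit := ⟨fun hc => ⟨prodIsColimit
    (isColimitOfPreserves (F ⋙ CategoryTheory.Prod.fst C D) hc)
    (isColimitOfPreserves (F ⋙ CategoryTheory.Prod.snd C D) hc)⟩⟩

end Prod

/-! ### Closedness, universal measuring comodules, and left adjoints of internal homs -/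

section Closed

open Limits

variable {V : Type u} [Category.{v} V] [MonoidalCategory V] [SymmetricCategory V]
  [MonoidalClosed V] (J : Type v) [SmallCategory J]

omit [SymmetricCategory V] in
lemma ihomMap_id_left {X M N : V} (g : M ⟶ N) : ihomMap (𝟙 X) g = (ihom X).map g := by
  simp [ihomMap]

omit [SymmetricCategory V] in
lemma ihomMap_id_right {X Y M : V} (f : X ⟶ Y) : ihomMap f (𝟙 M) = (MonoidalClosed.pre f).app M := by
  simp [ihomMap]

/-- On carriers this functor is a pair of internal homs out of fixed objects, which are right
adjoints, and limits of modules are detected on carriers. -/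
instance [HasLimitsOfShape J V] (X : (GlobalComod V)ᵒᵖ) :
    PreservesLimitsOfShape J ((homFunctor V).obj X) := by
  have : PreservesLimitsOfShape J (((homFunctor V).obj X ⋙ GlobalMod.forget V) ⋙ fstObj V) :=
    let i : (GlobalMod.forget V ⋙ fstObj V) ⋙ ihom X.unop.base.X ≅
        ((homFunctor V).obj X ⋙ GlobalMod.forget V) ⋙ fstObj V :=
      NatIso.ofComponents (fun _ => Iso.refl _) fun f =>
        (Category.comp_id _).trans ((ihomMap_id_left _).symm.trans (Category.id_comp _).symm)
    preservesLimitsOfShape_of_natIso i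
  have : PreservesLimitsOfShape J (((homFunctor V).obj X ⋙ GlobalMod.forget V) ⋙ sndObj V) :=
    let i : (GlobalMod.forget V ⋙ sndObj V) ⋙ ihom X.unop.X ≅
        ((homFunctor V).obj X ⋙ GlobalMod.forget V) ⋙ sndObj V :=
      NatIso.ofComponents (fun _ => Iso.refl _) fun f =>
        (Category.comp_id _).trans ((ihomMap_id_left _).symm.trans (Category.id_comp _).symm)
    preservesLimitsOfShape_of_natIso i
  have := preservesLimitsOfShape_of_prod (J := J) ((homFunctor V).obj X ⋙ GlobalMod.forget V)
  exact preservesLimitsOfShape_of_reflects_of_preserves _ (GlobalMod.forget V)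

/-- The internal hom turns colimits in its first variable into limits, and colimits of comodules are
formed on carriers. -/
instance [HasLimitsOfShape J V] [HasColimitsOfShape Jᵒᵖ V] (N : GlobalMod V) :
    PreservesLimitsOfShape J ((homFunctor V).flip.obj N) := by
  have := preservesLimitsOfShape_op J (GlobalComod.forget V ⋙ fstObj V)
  have := preservesLimitsOfShape_op J (GlobalComod.forget V ⋙ sndObj V)
  have : PreservesLimitsOfShape J
      (((homFunctor V).flip.obj N ⋙ GlobalMod.forget V) ⋙ fstObj V) :=
    let i : (GlobalComod.forget V ⋙ fstObj V).op ⋙ MonoidalClosed.internalHom.flip.obj N.base.X ≅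
        ((homFunctor V).flip.obj N ⋙ GlobalMod.forget V) ⋙ fstObj V :=
      NatIso.ofComponents (fun _ => Iso.refl _) fun f =>
        (Category.comp_id _).trans ((ihomMap_id_right _).symm.trans (Category.id_comp _).symm)
    preservesLimitsOfShape_of_natIso i
  have : PreservesLimitsOfShape J
      (((homFunctor V).flip.obj N ⋙ GlobalMod.forget V) ⋙ sndObj V) :=
    let i : (GlobalComod.forget V ⋙ sndObj V).op ⋙ MonoidalClosed.internalHom.flip.obj N.X ≅
        ((homFunctor V).flip.obj N ⋙ GlobalMod.forget V) ⋙ sndObj V :=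
      NatIso.ofComponents (fun _ => Iso.refl _) fun f =>
        (Category.comp_id _).trans ((ihomMap_id_right _).symm.trans (Category.id_comp _).symm)
    preservesLimitsOfShape_of_natIso i
  have := preservesLimitsOfShape_of_prod (J := J)
    ((homFunctor V).flip.obj N ⋙ GlobalMod.forget V)
  exact preservesLimitsOfShape_of_reflects_of_preserves _ (GlobalMod.forget V)

instance [HasColimitsOfShape J V] (X : GlobalComod V) :
    PreservesColimitsOfShape J (tensorLeft X) := by
  have : PreservesColimitsOfShape J ((tensorLeft X ⋙ GlobalComod.forget V) ⋙ fstObj V) :=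
    inferInstanceAs (PreservesColimitsOfShape J
      ((GlobalComod.forget V ⋙ fstObj V) ⋙ tensorLeft X.base.X))
  have : PreservesColimitsOfShape J ((tensorLeft X ⋙ GlobalComod.forget V) ⋙ sndObj V) :=
    inferInstanceAs (PreservesColimitsOfShape J
      ((GlobalComod.forget V ⋙ sndObj V) ⋙ tensorLeft X.X))
  have := preservesColimitsOfShape_of_prod (J := J) (tensorLeft X ⋙ GlobalComod.forget V)
  exact preservesColimitsOfShape_of_reflects_of_preserves _ (GlobalComod.forget V)

variable (V) in
/-- The global category of comodules is closed. -/
theorem GlobalComod.nonempty_monoidalClosed [IsLocallyPresentable.{v} V] :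
    Nonempty (MonoidalClosed (GlobalComod V)) := by
  have := hasColimits_of_isLocallyPresentable V
  have (X : GlobalComod V) : PreservesColimitsOfSize.{v, v} (tensorLeft X) := ⟨inferInstance⟩
  have (X : GlobalComod V) : (tensorLeft X).IsLeftAdjoint :=
    GlobalComod.isLeftAdjoint_of_preservesColimits _
  exact ⟨⟨fun X => ⟨_, Adjunction.ofIsLeftAdjoint (tensorLeft X)⟩⟩⟩

/-- Universal measuring comodules exist. -/
theorem exists_universalMeasuringComodule [IsLocallyPresentable.{v} V] (M N : GlobalMod V) :
    ∃ Q : GlobalComod V, Nonempty (UniversalMeasuringComodule M N Q) := by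
  have := hasColimits_of_isLocallyPresentable V
  have := hasLimits_of_isLocallyPresentable V
  -- Viewed as a covariant functor from comodules to the opposite of modules, `Hom(-, N)` is
  -- cocontinuous; its right adjoint at `M` is the required object.
  have : PreservesColimitsOfSize.{v, v} ((homFunctor V).flip.obj N).rightOp :=
    ⟨preservesColimitsOfShape_rightOp _ _⟩
  have : ((homFunctor V).flip.obj N).rightOp.IsLeftAdjoint :=
    GlobalComod.isLeftAdjoint_of_preservesColimits _
  let adj := Adjunction.ofIsLeftAdjoint ((homFunctor V).flip.obj N).rightOp
  exact ⟨_, ⟨{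
    homEquiv := fun X => (adj.homEquiv X (op M)).symm.trans (opEquiv _ _)
    homEquiv_comp := fun f g =>
      congrArg Quiver.Hom.unop (adj.homEquiv_naturality_left_symm f g) }⟩⟩

/-- The functor `[X, -]` on modules is a right adjoint. -/
theorem isRightAdjoint_homFunctor [IsLocallyPresentable.{v} V] (X : GlobalComod V) :
    ((homFunctor V).obj (op X)).IsRightAdjoint := by
  have := hasColimits_of_isLocallyPresentable V
  have := hasLimits_of_isLocallyPresentable V
  have : HasLimitsOfSize.{v, v} (GlobalMod V) := ⟨fun _ _ => inferInstance⟩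
  have : PreservesLimitsOfSize.{v, v} ((homFunctor V).obj (op X)) := ⟨inferInstance⟩
  refine isRightAdjoint_of_preservesLimits_of_solutionSetCondition _ fun M => ?_
  -- The class is chosen after `M` and `X`, so that their carriers are small. A solution set is then
  -- formed by all maps from `M` to `[X, B]`, with `B` ranging over representatives of the small
  -- modules.
  obtain ⟨Q, h, hQ⟩ := exists_isTensorClosed (![M.base.X, M.X, X.base.X, X.X])
  have := h.essentiallySmall
  have hs := Dialg.essentiallySmall_satisfies
    (Dialg.Satisfies (ModDialg.lhs V) (ModDialg.rhs V)) (pairs Q)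
  obtain ⟨P₀, _, -, hP₀⟩ := ObjectProperty.EssentiallySmall.exists_small_le.{v} (pairs Q |>.inverseImage
    ((Dialg.Satisfies (ModDialg.lhs V) (ModDialg.rhs V)).ι ⋙ Dialg.forget _ _))
  have : Small.{v} (Subtype P₀) := inferInstanceAs (ObjectProperty.Small.{v} P₀)
  let e := (ModDialg.functor V).asEquivalence
  let B (k : Shrink.{v} (Subtype P₀)) : GlobalMod V := e.inverse.obj ((equivShrink _).symm k).1
  refine ⟨Σ k, (M ⟶ homMod X (B k)), fun i => B i.1, fun i => i.2, fun N f => ?_⟩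
  obtain ⟨N', hN', g, m, hm⟩ := Measuring.exists_factorization h
    (⟨hQ 2, hQ 3⟩ : pairs Q ((GlobalComod.forget V).obj X))
    (⟨hQ 0, hQ 1⟩ : pairs Q ((GlobalMod.forget V).obj M)) (Measuring.ofHom f)
  obtain ⟨D, hD, ⟨i⟩⟩ := hP₀ (e.functor.obj N') hN'
  let k := equivShrink _ (⟨D, hD⟩ : Subtype P₀)
  have j : N' ≅ B k := e.unitIso.app N' ≪≫ e.inverse.mapIso
    (i ≪≫ eqToIso (congrArg Subtype.val ((equivShrink _).symm_apply_apply ⟨D, hD⟩)).symm)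
  refine ⟨⟨k, m.toHom ≫ ((homFunctor V).obj (op X)).map j.hom⟩, j.inv ≫ g, ?_⟩
  refine (Category.assoc _ _ _).trans ?_
  refine (congrArg (m.toHom ≫ ·) ((((homFunctor V).obj (op X)).map_comp _ _).symm.trans
    (congrArg _ (Iso.hom_inv_id_assoc j g)))).trans ?_
  apply Measuring.equivHom.symm.injective
  exact (Measuring.ofHom_comp_map m.toHom g).trans
    ((congrArg (fun m => Measuring.postcomp m g) (Measuring.equivHom.symm_apply_apply m)).trans hm)

end Closed

/-! ### Left adjoints of a bifunctor, with parameter -/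

section Parametrized

variable {C₁ C₂ C₃ : Type*} [Category* C₁] [Category* C₂] [Category* C₃]
  (G : C₁ᵒᵖ ⥤ C₃ ⥤ C₂) (L : C₁ → C₂ ⥤ C₃) (adj : ∀ X, L X ⊣ G.obj (op X))

/-- Pointwise left adjoints of a bifunctor form a bifunctor. -/
def parametrizedLeftAdjoint : C₁ ⥤ C₂ ⥤ C₃ where
  obj := L
  map {X Y} f := (conjugateEquiv (adj Y) (adj X)).symm (G.map f.op)
  map_id X := by simp
  map_comp f g := by simp

/-- Pointwise adjunctions form an adjunction with a parameter. -/
def parametrizedAdjunction : parametrizedLeftAdjoint G L adj ⊣₂ G where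
  adj := adj
  unit_whiskerRight_map {X Y} f := by
    ext M
    exact (unit_conjugateEquiv_symm (adj Y) (adj X) (G.map f.op) M).symm

end Parametrized

/-! ### From universal measuring comodules to universal measuring comonoids -/

section Base

open Limits

variable {V : Type u} [Category.{v} V] [MonoidalCategory V]

/-- Corestriction of a comodule along a morphism of comonoids. -/
abbrev Comodule.corestrict {C D : Comon V} (g : C ⟶ D) (X : Comodule C) : Comodule D where
  X := X.X
  comod :=
    { coact := coaction C.X X.X ≫ g.hom ▷ X.X
      counit_coact := by
        rw [Category.assoc, ← comp_whiskerRight, IsComonHom.hom_counit, ComodObj.counit_coact]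
      comul_coact := by
        rw [Category.assoc, ← comp_whiskerRight, IsComonHom.hom_comul, comp_whiskerRight,
          ← Category.assoc, ComodObj.comul_coact]
        simp [← whisker_exchange_assoc, MonoidalCategory.tensorHom_def] }

/-- Corestriction along an isomorphism of comonoids. -/
def GlobalComod.corestrictIso (X : GlobalComod V) {D : Comon V} (e : X.base ≅ D) :
    X ≅ ⟨D, X.fib.corestrict e.hom⟩ :=
  GlobalComod.mkIso e (Iso.refl _) ((by simp : X.coact ≫ (e.hom.hom ⊗ₘ 𝟙 X.X) =
    𝟙 X.X ≫ X.coact ≫ e.hom.hom ▷ X.X))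

variable [HasInitial V]

/-- The initial object as a comodule. -/
noncomputable abbrev GlobalComod.bot (C : Comon V) : GlobalComod V where
  base := C
  fib :=
    { X := ⊥_ V
      comod := ⟨initial.to _, initial.hom_ext _ _, initial.hom_ext _ _⟩ }

/-- Morphisms out of the initial comodule. -/
noncomputable def GlobalComod.botDesc {C : Comon V} {X : GlobalComod V} (g : C ⟶ X.base) :
    GlobalComod.bot C ⟶ X :=
  Hom.mk g (initial.to _) (initial.hom_ext _ _)

lemma GlobalComod.bot_hom_ext {C : Comon V} {X : GlobalComod V} {f g : GlobalComod.bot C ⟶ X}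
    (h : f.base = g.base) : f = g :=
  hom_ext h (initial.hom_ext _ _)

variable [SymmetricCategory V] [MonoidalClosed V]

/-- `[⊥, N]` is a terminal object. -/
noncomputable def isTerminalIhomInitial (N : V) : IsTerminal ((ihom (⊥_ V)).obj N) :=
  IsTerminal.isTerminalObj (MonoidalClosed.internalHom.flip.obj N) _
    (terminalOpOfInitial initialIsInitial)

variable {M N : GlobalMod V} {C : Comon V}

/-- Morphisms into the module `[⊥, N]`. -/
noncomputable def GlobalMod.lift (g : M.base ⟶ convMon C N.base) : M ⟶ homMod (GlobalComod.bot C) N :=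
  Hom.mk g ((isTerminalIhomInitial N.X).from _) ((isTerminalIhomInitial N.X).hom_ext _ _)

lemma GlobalMod.lift_hom_ext {f g : M ⟶ homMod (GlobalComod.bot C) N} (h : f.base = g.base) :
    f = g :=
  hom_ext h ((isTerminalIhomInitial N.X).hom_ext _ _)

namespace UniversalMeasuringComodule

variable {Q : GlobalComod V} (h : UniversalMeasuringComodule M N Q)

/-- The comonoid of a universal measuring comodule is a universal measuring comonoid. -/
noncomputable def toComonoid : UniversalMeasuringComonoid M.base N.base Q.base where
  homEquiv C :=
    -- Morphisms out of `bot C` are determined by their comonoid part, and morphisms into `[⊥, N]`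
    -- by their monoid part, so here the universal property of `Q` concerns the bases alone.
    { toFun := fun g => (h.homEquiv (GlobalComod.bot C) (GlobalComod.botDesc g)).base
      invFun := fun f => ((h.homEquiv (GlobalComod.bot C)).symm (GlobalMod.lift f)).base
      left_inv := fun g => by
        have e : GlobalMod.lift (h.homEquiv (GlobalComod.bot C) (GlobalComod.botDesc g)).base =
          h.homEquiv (GlobalComod.bot C) (GlobalComod.botDesc g) := GlobalMod.lift_hom_ext rfl
        exact congrArg GlobalComod.Hom.base ((Equiv.symm_apply_eq _).2 e)
      right_inv := fun f => by
        have e : GlobalComod.botDesc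
            ((h.homEquiv (GlobalComod.bot C)).symm (GlobalMod.lift f)).base =
          (h.homEquiv (GlobalComod.bot C)).symm (GlobalMod.lift f) :=
            GlobalComod.bot_hom_ext rfl
        exact congrArg GlobalMod.Hom.base ((Equiv.eq_symm_apply _).1 e) }
  homEquiv_comp {C' C} f g := by
    let i : GlobalComod.bot C' ⟶ GlobalComod.bot C := GlobalComod.botDesc f
    have e : i ≫ GlobalComod.botDesc (X := Q) g = GlobalComod.botDesc (f ≫ g) :=
      GlobalComod.bot_hom_ext rfl
    have := h.homEquiv_comp i (GlobalComod.botDesc g)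
    rw [e] at this
    exact congrArg GlobalMod.Hom.base this

/-- Restrict along the map from the initial comodule over `X.base`. It is the identity on comonoids,
so by naturality the monoid part is unchanged. -/
lemma toComonoid_homEquiv {X : GlobalComod V} (f : X ⟶ Q) :
    (h.homEquiv X f).base = h.toComonoid.homEquiv X.base f.base := by
  let i : GlobalComod.bot X.base ⟶ X := GlobalComod.botDesc (𝟙 _)
  have e : i ≫ f = GlobalComod.botDesc f.base := GlobalComod.bot_hom_ext (Category.id_comp _)
  have := h.homEquiv_comp i f
  rw [e] at this
  refine Eq.trans ?_ (congrArg GlobalMod.Hom.base this).symm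
  refine ((Category.comp_id _).symm.trans (congrArg (_ ≫ ·) ?_))
  exact (congrArg (fun t => t.app N.base) ((convMonFunctor V).map_id (op X.base))).symm

omit [HasInitial V] in
/-- Transport of a universal measuring comodule along an isomorphism. -/
def ofIso {Q' : GlobalComod V} (e : Q' ≅ Q) : UniversalMeasuringComodule M N Q' where
  homEquiv X := (Iso.homToEquiv e).trans (h.homEquiv X)
  homEquiv_comp f g :=
    (congrArg (h.homEquiv _) (Category.assoc f g e.hom)).trans (h.homEquiv_comp _ _)

end UniversalMeasuringComodule

omit [HasInitial V] in
/-- Universal measuring comonoids are unique. -/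
lemma UniversalMeasuringComonoid.exists_iso {A B : Mon V} {P P' : Comon V}
    (h : UniversalMeasuringComonoid A B P) (h' : UniversalMeasuringComonoid A B P') :
    ∃ e : P ≅ P', ∀ (C : Comon V) (g : C ⟶ P'),
      h.homEquiv C (g ≫ e.inv) = h'.homEquiv C g := by
  -- The comparison map is the one corresponding to the universal measuring of `P'`. Proved for an
  -- arbitrary pair, the formula yields both inverse laws by exchanging the roles.
  have key {P P' : Comon V} (h : UniversalMeasuringComonoid A B P)
      (h' : UniversalMeasuringComonoid A B P') (C : Comon V) (g : C ⟶ P') :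
      h.homEquiv C (g ≫ (h.homEquiv P').symm (h'.homEquiv P' (𝟙 _))) = h'.homEquiv C g := by
    rw [h.homEquiv_comp, Equiv.apply_symm_apply, ← h'.homEquiv_comp, Category.comp_id]
  refine ⟨⟨(h'.homEquiv P).symm (h.homEquiv P (𝟙 _)),
    (h.homEquiv P').symm (h'.homEquiv P' (𝟙 _)), ?_, ?_⟩, key h h'⟩
  · exact (h.homEquiv _).injective ((key h h' _ _).trans (Equiv.apply_symm_apply _ _))
  · exact (h'.homEquiv _).injective ((key h' h _ _).trans (Equiv.apply_symm_apply _ _))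

/-- Corestricting `Q` along the isomorphism between its base and `P` replaces the base by the
prescribed comonoid and preserves the universal property. -/
lemma UniversalMeasuringComodule.exists_over {Q : GlobalComod V}
    (h : UniversalMeasuringComodule M N Q) {P : Comon V}
    (hP : UniversalMeasuringComonoid M.base N.base P) :
    ∃ (Q' : Comodule P) (h' : UniversalMeasuringComodule M N ⟨P, Q'⟩),
      ∀ (X : GlobalComod V) (f : X ⟶ ⟨P, Q'⟩),
        (h'.homEquiv X f).base = hP.homEquiv X.base f.base := by
  obtain ⟨e, he⟩ := h.toComonoid.exists_iso hP
  exact ⟨Q.fib.corestrict e.hom, h.ofIso (Q.corestrictIso e).symm, fun X f =>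
    (h.toComonoid_homEquiv _).trans (he _ _)⟩

end Base

/-! ### Existence results -/

section Existence

variable {V : Type u} [Category.{v} V] [MonoidalCategory V] [SymmetricCategory V]
  [MonoidalClosed V] [IsLocallyPresentable.{v} V]

/-- Universal measuring comonoids exist. -/
theorem exists_universalMeasuringComonoid (A B : Mon V) :
    ∃ P : Comon V, Nonempty (UniversalMeasuringComonoid A B P) := by
  have := hasColimits_of_isLocallyPresentable V
  -- Any modules over `A` and `B` would serve; the regular ones are always available.
  obtain ⟨Q, ⟨h⟩⟩ := exists_universalMeasuringComodule (⟨A, Mod.regular A.X⟩ : GlobalMod V)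
    ⟨B, Mod.regular B.X⟩
  exact ⟨Q.base, ⟨h.toComonoid⟩⟩

/-- Universal measuring comodules exist over any universal measuring comonoid. -/
theorem exists_universalMeasuringComodule_over (M N : GlobalMod V) {P : Comon V}
    (hP : UniversalMeasuringComonoid M.base N.base P) :
    ∃ (Q : Comodule P) (h : UniversalMeasuringComodule M N ⟨P, Q⟩),
      ∀ (X : GlobalComod V) (f : X ⟶ ⟨P, Q⟩),
        (h.homEquiv X f).base = hP.homEquiv X.base f.base := by
  have := hasColimits_of_isLocallyPresentable V
  obtain ⟨Q, ⟨h⟩⟩ := exists_universalMeasuringComodule M N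
  exact h.exists_over hP

/-- The functors `[X, -]` on modules have left adjoints, naturally in `X`. -/
theorem exists_parametrizedAdjunction_homFunctor :
    ∃ T : GlobalComod V ⥤ GlobalMod V ⥤ GlobalMod V, Nonempty (T ⊣₂ homFunctor V) := by
  have (X : GlobalComod V) := isRightAdjoint_homFunctor X
  exact ⟨_, ⟨parametrizedAdjunction (homFunctor V) _ fun X =>
    Adjunction.ofIsRightAdjoint ((homFunctor V).obj (op X))⟩⟩

end Existence

/-! ### Tensors and cotensors, tested by Yoneda and passed to the opposite -/

namespace EnrichmentOn

universe v₁ u₁ v₂ u₂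

variable {W : Type u₁} [Category.{v₁} W] [MonoidalCategory W] {A : Type u₂} [Category.{v₂} A]
  {H : A → A → W}

/-- Yoneda together with currying. It reduces tensors and cotensors to bijections of sets of
morphisms, which can be read in terms of measurings. -/
lemma isIso_curry [MonoidalClosed W] {X Y Z : W} (k : X ⊗ Y ⟶ Z)
    (h : ∀ U : W, Function.Bijective (fun f : U ⟶ Y => X ◁ f ≫ k)) :
    IsIso (MonoidalClosed.curry k) := by
  refine isIso_iff_yoneda_map_bijective _ |>.2 fun U => ?_
  have e : (fun f : U ⟶ Y => f ≫ MonoidalClosed.curry k) =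
      ((ihom.adjunction X).homEquiv U Z) ∘ fun f : U ⟶ Y => X ◁ f ≫ k :=
    funext fun f => (MonoidalClosed.curry_natural_left f k).symm
  rw [e]
  exact (Equiv.bijective _).comp (h U)

variable [SymmetricCategory W] [MonoidalClosed W] {E : EnrichmentOn W A H} {X : W}

/-- A cotensor is a tensor in the opposite category. -/
lemma IsCotensor.op {N K : A} {c : X ⟶ H K N} (h : E.IsCotensor X N K c) :
    E.op.IsTensor X (Opposite.op N) (Opposite.op K) c := by
  intro M
  have := h M.unop
  rw [← BraidedCategory.braiding_naturality_left_assoc] at this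
  exact this

/-- A tensor is a cotensor in the opposite category. -/
lemma IsTensor.op {M T : A} {c : X ⟶ H M T} (h : E.IsTensor X M T c) :
    E.op.IsCotensor X (Opposite.op M) (Opposite.op T) c := by
  intro N
  have := h N.unop
  rw [← SymmetricCategory.symmetry_assoc X (H T N.unop) (c ▷ H T N.unop ≫ E.comp M T N.unop),
    ← BraidedCategory.braiding_naturality_right_assoc] at this
  exact this

end EnrichmentOn

/-! ### The enrichment by universal measuring comodules -/

section Enrichment

variable {V : Type u} [Category.{v} V] [MonoidalCategory V] [SymmetricCategory V]
  [MonoidalClosed V] {H : GlobalMod V → GlobalMod V → GlobalComod V}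
  (hQ : ∀ M N, UniversalMeasuringComodule M N (H M N))

namespace UniversalMeasuringComodule

variable {M N : GlobalMod V} {Q : GlobalComod V} (h : UniversalMeasuringComodule M N Q)
  {X Y : GlobalComod V}

/-- Morphisms into a universal measuring comodule correspond to measurings. -/
def equivMeasuring : (X ⟶ Q) ≃ Measuring X M N :=
  (h.homEquiv X).trans Measuring.equivHom.symm

lemma equivMeasuring_comp (f : Y ⟶ X) (g : X ⟶ Q) :
    h.equivMeasuring (f ≫ g) = (h.equivMeasuring g).restrict f :=
  (congrArg Measuring.ofHom (h.homEquiv_comp f g)).trans (Measuring.ofHom_comp_app _ _)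

lemma equivMeasuring_eq (f : X ⟶ Q) :
    h.equivMeasuring f = (h.equivMeasuring (𝟙 Q)).restrict f := by
  rw [← equivMeasuring_comp, Category.comp_id]

lemma equivMeasuring_homEquiv_symm (f : M ⟶ homMod X N) :
    h.equivMeasuring ((h.homEquiv X).symm f) = Measuring.ofHom f :=
  congrArg Measuring.ofHom (Equiv.apply_symm_apply _ _)

variable {K L : GlobalMod V} {R S : GlobalComod V} {Z : GlobalComod V}

variable (h' : UniversalMeasuringComodule L M R) (h'' : UniversalMeasuringComodule L N S)

/-- Composition of universal measuring comodules. -/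
def comp : R ⊗ Q ⟶ S :=
  h''.equivMeasuring.symm ((h'.equivMeasuring (𝟙 R)).comp (h.equivMeasuring (𝟙 Q)))

/-- Composition is defined by composing the universal measurings; naturality extends this to
generalized elements, so identities between composites reduce to those between measurings. -/
lemma equivMeasuring_comp_comp (f : X ⟶ R) (g : Y ⟶ Q) :
    h''.equivMeasuring ((f ⊗ₘ g) ≫ h.comp h' h'') =
      (h'.equivMeasuring f).comp (h.equivMeasuring g) := by
  rw [equivMeasuring_comp, comp, Equiv.apply_symm_apply, ← Measuring.restrict_comp_restrict,
    ← equivMeasuring_eq, ← equivMeasuring_eq]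

lemma equivMeasuring_whiskerRight_comp (f : X ⟶ R) :
    h''.equivMeasuring (f ▷ Q ≫ h.comp h' h'') =
      (h'.equivMeasuring f).comp (h.equivMeasuring (𝟙 Q)) := by
  rw [← tensorHom_id, equivMeasuring_comp_comp]

lemma equivMeasuring_whiskerLeft_comp (g : Y ⟶ Q) :
    h''.equivMeasuring (R ◁ g ≫ h.comp h' h'') =
      (h'.equivMeasuring (𝟙 R)).comp (h.equivMeasuring g) := by
  rw [← id_tensorHom, equivMeasuring_comp_comp]

end UniversalMeasuringComodule

omit [MonoidalClosed V] in
lemma Measuring.precomp_ofMod {L M N : GlobalMod V} (f : L ⟶ M) (g : M ⟶ N) :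
    (Measuring.ofMod g).precomp f = Measuring.ofMod (f ≫ g) := by
  have e {A B C : V} (f : A ⟶ B) (g : B ⟶ C) :
      f ▷ 𝟙_ V ≫ (ρ_ B).hom ≫ g = (ρ_ A).hom ≫ f ≫ g := by simp
  exact Measuring.ext (e _ _) (e _ _)

lemma Measuring.ofHom_toHom {M N : GlobalMod V} {X : GlobalComod V} (m : Measuring X M N) :
    Measuring.ofHom m.toHom = m :=
  Measuring.equivHom.symm_apply_apply m

/-- Morphisms of modules are measurings by the unit. -/
noncomputable def Measuring.ofModEquiv {M N : GlobalMod V} :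
    (M ⟶ N) ≃ Measuring (𝟙_ (GlobalComod V)) M N :=
  Equiv.ofBijective Measuring.ofMod ⟨Measuring.ofMod_injective, Measuring.ofMod_surjective⟩

open UniversalMeasuringComodule

/-- The enrichment of modules in comodules given by universal measuring comodules. -/
noncomputable def enrichment : EnrichmentOn (GlobalComod V) (GlobalMod V) H where
  id M := (hQ M M).equivMeasuring.symm (Measuring.ofMod (𝟙 M))
  comp L M N := (hQ M N).comp (hQ L M) (hQ L N)
  id_comp M N := (hQ M N).equivMeasuring.injective (by
    rw [equivMeasuring_comp, equivMeasuring_whiskerRight_comp, Equiv.apply_symm_apply,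
      Measuring.ofMod_comp, Measuring.precomp_id])
  comp_id M N := (hQ M N).equivMeasuring.injective (by
    rw [equivMeasuring_comp, equivMeasuring_whiskerLeft_comp, Equiv.apply_symm_apply,
      Measuring.comp_ofMod, Measuring.postcomp_id])
  assoc K L M N := (hQ K N).equivMeasuring.injective (by
    rw [equivMeasuring_comp, equivMeasuring_whiskerRight_comp, equivMeasuring_whiskerLeft_comp,
      comp, comp, Equiv.apply_symm_apply, Equiv.apply_symm_apply, Measuring.comp_assoc])
  homEquiv := Measuring.ofModEquiv.trans (hQ _ _).equivMeasuring.symm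
  homEquiv_id M := rfl
  homEquiv_comp {L M N} f g := (hQ L N).equivMeasuring.injective (by
    rw [equivMeasuring_comp, equivMeasuring_comp_comp]
    simp only [Equiv.trans_apply, Equiv.apply_symm_apply]
    exact (((Measuring.ofMod_comp _ _).trans (Measuring.precomp_ofMod f g))).symm)

variable {K L M N : GlobalMod V} {X : GlobalComod V}

/-- Enriched precomposition pairs with the measuring by the unit attached to `g`, and composing with
such a measuring is ordinary precomposition by `Measuring.ofMod_comp`. -/
lemma equivMeasuring_comp_precomp (g : L ⟶ M) (f : X ⟶ H M N) :
    (hQ L N).equivMeasuring (f ≫ (enrichment hQ).precomp g N) =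
      ((hQ M N).equivMeasuring f).precomp g := by
  have e : (hQ L N).equivMeasuring ((enrichment hQ).precomp g N) =
      ((hQ M N).equivMeasuring (𝟙 _)).precomp g := by
    refine (equivMeasuring_comp _ _ _).trans ?_
    refine (congrArg (Measuring.restrict · _)
      (equivMeasuring_whiskerRight_comp (hQ M N) (hQ L M) (hQ L N) _)).trans ?_
    refine (congrArg (fun m => (Measuring.comp m _).restrict _)
      (Equiv.apply_symm_apply (hQ L M).equivMeasuring _)).trans ?_
    exact Measuring.ofMod_comp _ _
  rw [equivMeasuring_comp, e, equivMeasuring_eq (hQ M N) f, Measuring.restrict_precomp]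

lemma equivMeasuring_comp_postcomp (g : M ⟶ N) (f : X ⟶ H L M) :
    (hQ L N).equivMeasuring (f ≫ (enrichment hQ).postcomp L g) =
      ((hQ L M).equivMeasuring f).postcomp g := by
  have e : (hQ L N).equivMeasuring ((enrichment hQ).postcomp L g) =
      ((hQ L M).equivMeasuring (𝟙 _)).postcomp g := by
    refine (equivMeasuring_comp _ _ _).trans ?_
    refine (congrArg (Measuring.restrict · _)
      (equivMeasuring_whiskerLeft_comp (hQ M N) (hQ L M) (hQ L N) _)).trans ?_
    refine (congrArg (fun m => (Measuring.comp _ m).restrict _)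
      (Equiv.apply_symm_apply (hQ M N).equivMeasuring _)).trans ?_
    exact Measuring.comp_ofMod _ _
  rw [equivMeasuring_comp, e, equivMeasuring_eq (hQ L M) f, Measuring.restrict_postcomp]

/-- The universal property of universal measuring comodules is natural in the source. -/
lemma homEquiv_comp_precomp (g : L ⟶ M) (f : X ⟶ H M N) :
    (hQ L N).homEquiv X (f ≫ (enrichment hQ).precomp g N) = g ≫ (hQ M N).homEquiv X f :=
  Measuring.equivHom.symm.injective
    ((equivMeasuring_comp_precomp hQ g f).trans (Measuring.ofHom_comp _ _).symm)

/-- The universal property of universal measuring comodules is natural in the target. -/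
lemma homEquiv_comp_postcomp (g : M ⟶ N) (f : X ⟶ H L M) :
    (hQ L N).homEquiv X (f ≫ (enrichment hQ).postcomp L g) =
      (hQ L M).homEquiv X f ≫ ((homFunctor V).obj (op X)).map g :=
  Measuring.equivHom.symm.injective
    ((equivMeasuring_comp_postcomp hQ g f).trans (Measuring.ofHom_comp_map _ _).symm)

variable [MonoidalClosed (GlobalComod V)]

/-- The modules `[X, N]` are cotensors. -/
theorem isCotensor_enrichment (X : GlobalComod V) (N : GlobalMod V) :
    (enrichment hQ).IsCotensor X N (((homFunctor V).obj (op X)).obj N)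
      ((hQ (((homFunctor V).obj (op X)).obj N) N).homEquiv X |>.symm (𝟙 _)) := by
  intro M
  refine EnrichmentOn.isIso_curry _ fun Y => ?_
  let K := homMod X N
  let c : X ⟶ H K N := ((hQ K N).homEquiv X).symm (𝟙 _)
  have hc : (hQ K N).equivMeasuring c = Measuring.ev X N := equivMeasuring_homEquiv_symm _ _
  -- The counit represents evaluation, so up to the symmetry the map under study is `f ↦ f` composed
  -- with evaluation, a bijection by currying of measurings.
  have e (f : Y ⟶ H M K) : X ◁ f ≫ (β_ X (H M K)).hom ≫ H M K ◁ c ≫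
      (hQ K N).comp (hQ M K) (hQ M N) = (β_ X Y).hom ≫ (hQ M N).equivMeasuring.symm
        (((hQ M K).equivMeasuring f).comp (Measuring.ev X N)) := by
    rw [BraidedCategory.braiding_naturality_right_assoc, ← hc,
      ← equivMeasuring_comp_comp (hQ K N) (hQ M K) (hQ M N), Equiv.symm_apply_apply,
      MonoidalCategory.tensorHom_def, Category.assoc]
  change Function.Bijective fun f : Y ⟶ H M K =>
    X ◁ f ≫ (β_ X (H M K)).hom ≫ H M K ◁ c ≫ (hQ K N).comp (hQ M K) (hQ M N)
  simp only [e]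
  exact (Iso.homFromEquiv (Z := H M N) (β_ X Y)).symm.bijective.comp
    ((hQ M N).equivMeasuring.symm.bijective.comp
      ((Measuring.comp_ev_bijective (Y := X) (N := N)).comp (hQ M K).equivMeasuring.bijective))

/-- The left adjoints of `[X, -]` are tensors. -/
theorem isTensor_enrichment {T : GlobalComod V ⥤ GlobalMod V ⥤ GlobalMod V}
    (hT : T ⊣₂ homFunctor V) (X : GlobalComod V) (M : GlobalMod V) :
    (enrichment hQ).IsTensor X M ((T.obj X).obj M)
      ((hQ M ((T.obj X).obj M)).homEquiv X |>.symm (hT.homEquiv (𝟙 _))) := by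
  intro N
  refine EnrichmentOn.isIso_curry _ fun Y => ?_
  let S := (T.obj X).obj M
  let w : X ⟶ H M S := ((hQ M S).homEquiv X).symm (hT.homEquiv (𝟙 _))
  have hw : (hQ M S).equivMeasuring w = Measuring.ofHom (hT.homEquiv (𝟙 _)) :=
    equivMeasuring_homEquiv_symm _ _
  -- Write a measuring out of `S` as a module map `S ⟶ [Y, N]`. Composing it with the unit is
  -- transposition to `M ⟶ [X, [Y, N]]`, and uncurrying gives a measuring by `X ⊗ Y`; each passage
  -- is bijective.
  have e (f : Y ⟶ H S N) : X ◁ f ≫ w ▷ H S N ≫ (hQ S N).comp (hQ M S) (hQ M N) =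
      (hQ M N).equivMeasuring.symm ((Measuring.ofHom (hT.homEquiv
        (Measuring.toHom ((hQ S N).equivMeasuring f)))).comp (Measuring.ev Y N)) := by
    rw [Equiv.eq_symm_apply, ← Category.assoc, ← MonoidalCategory.tensorHom_def',
      equivMeasuring_comp_comp, hw]
    generalize (hQ S N).equivMeasuring f = n
    have h₁ : hT.homEquiv n.toHom =
        hT.homEquiv (𝟙 S) ≫ ((homFunctor V).obj (op X)).map n.toHom := by
      rw [← hT.homEquiv_naturality_three, Category.id_comp]
    have h₂ : Measuring.ofHom (hT.homEquiv n.toHom) =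
        (Measuring.ofHom (hT.homEquiv (𝟙 S))).postcomp n.toHom :=
      (congrArg Measuring.ofHom h₁).trans (Measuring.ofHom_comp_map _ _)
    refine Eq.trans ?_ (congrArg (Measuring.comp · _) h₂.symm)
    rw [Measuring.postcomp_comp, ← Measuring.ofHom_eq, Measuring.ofHom_toHom]
  change Function.Bijective fun f : Y ⟶ H S N =>
    X ◁ f ≫ w ▷ H S N ≫ (hQ S N).comp (hQ M S) (hQ M N)
  simp only [e]
  exact (hQ M N).equivMeasuring.symm.bijective.comp
    ((Measuring.comp_ev_bijective (Y := Y) (N := N)).comp (Measuring.equivHom.symm.bijective.comp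
      (hT.homEquiv.bijective.comp (Measuring.equivHom.bijective.comp
        (hQ S N).equivMeasuring.bijective))))

end Enrichment

end MeasuringComodule

theorem mainTheorem1 {V : Type u} [Category.{v} V] [MonoidalCategory V] [SymmetricCategory V]
    [MonoidalClosed V] [IsLocallyPresentable.{v} V] :
    ∃ (_ : MonoidalClosed (GlobalComod V))
      -- universal measuring comonoids and, over them, universal measuring comodules
      (P : Mon V → Mon V → Comon V)
      (hP : ∀ A B : Mon V, UniversalMeasuringComonoid A B (P A B))
      (Q : ∀ M N : GlobalMod V, Comodule (P M.base N.base))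
      (hQ : ∀ M N : GlobalMod V, UniversalMeasuringComodule M N ⟨P M.base N.base, Q M N⟩)
      -- the functor which is left adjoint to `Hom` in each comodule variable
      (T : GlobalComod V ⥤ GlobalMod V ⥤ GlobalMod V)
      (hT : T ⊣₂ homFunctor V)
      -- the enrichment of the global category of modules
      (E : EnrichmentOn (GlobalComod V) (GlobalMod V) (fun M N => ⟨P M.base N.base, Q M N⟩)),
      -- the universal property of `Q` lies over the universal property of `P`
      (∀ (M N : GlobalMod V) (X : GlobalComod V) (f : X ⟶ ⟨P M.base N.base, Q M N⟩),
        ((hQ M N).homEquiv X f).base = (hP M.base N.base).homEquiv X.base f.base) ∧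
      -- the universal property of `Q(M, N)` is natural in `M` and in `N`
      (∀ (M M' N : GlobalMod V) (X : GlobalComod V) (g : M' ⟶ M)
        (f : X ⟶ ⟨P M.base N.base, Q M N⟩),
        (hQ M' N).homEquiv X (f ≫ E.precomp g N) = g ≫ (hQ M N).homEquiv X f) ∧
      (∀ (M N N' : GlobalMod V) (X : GlobalComod V) (g : N ⟶ N')
        (f : X ⟶ ⟨P M.base N.base, Q M N⟩),
        (hQ M N').homEquiv X (f ≫ E.postcomp M g) =
          (hQ M N).homEquiv X f ≫ ((homFunctor V).obj (op X)).map g) ∧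
      -- the opposite of the global category of modules is tensored and cotensored
      (∀ (X : GlobalComod V) (N : GlobalMod V),
        E.op.IsTensor X (op N) (op (((homFunctor V).obj (op X)).obj N))
          ((hQ (((homFunctor V).obj (op X)).obj N) N).homEquiv X |>.symm (𝟙 _))) ∧
      (∀ (X : GlobalComod V) (M : GlobalMod V),
        E.op.IsCotensor X (op M) (op ((T.obj X).obj M))
          ((hQ M ((T.obj X).obj M)).homEquiv X |>.symm (hT.homEquiv (𝟙 _)))) ∧
      -- the global category of modules is tensored and cotensored
      (∀ (X : GlobalComod V) (M : GlobalMod V),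
        E.IsTensor X M ((T.obj X).obj M)
          ((hQ M ((T.obj X).obj M)).homEquiv X |>.symm (hT.homEquiv (𝟙 _)))) ∧
      (∀ (X : GlobalComod V) (N : GlobalMod V),
        E.IsCotensor X N (((homFunctor V).obj (op X)).obj N)
          ((hQ (((homFunctor V).obj (op X)).obj N) N).homEquiv X |>.symm (𝟙 _))) := by
  obtain ⟨closed⟩ := GlobalComod.nonempty_monoidalClosed V
  choose P hP using fun A B : Mon V => exists_universalMeasuringComonoid A B
  let hP' (A B : Mon V) := (hP A B).some
  -- The comodules are chosen over the comonoids already fixed, with bijections compatible with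
  -- those of `hP'`.
  choose Q hQ h using fun M N : GlobalMod V =>
    exists_universalMeasuringComodule_over M N (hP' M.base N.base)
  obtain ⟨T, ⟨hT⟩⟩ := exists_parametrizedAdjunction_homFunctor (V := V)
  exact ⟨closed, P, hP', Q, hQ, T, hT, enrichment hQ, h,
    fun M M' N X g f => homEquiv_comp_precomp hQ g f,
    fun M N N' X g f => homEquiv_comp_postcomp hQ g f,
    fun X N => (isCotensor_enrichment hQ X N).op,
    fun X M => (isTensor_enrichment hQ hT X M).op,
    fun X M => isTensor_enrichment hQ hT X M,
    fun X N => isCotensor_enrichment hQ X N⟩
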